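/- Let $\tau:E\to M$ be a Lie algebroid with bracket $[\![\cdot,\cdot]\!]$ and anchor $\rho:E\to TM$ over a smooth (Hausdorff, paracompact, finite-dimensional) manifold $M$, let $\tau^*:E^*\to M$ be the dual bundle and let $H:E^*\to\mathbb R$ be a smooth function. Let $$\mathcal L^{\tau^*}E=\{(b,v)\in E\times TE^*\mid \rho(b)=(T\tau^*)(v)\}\to E^*$$ be the prolongation of $E$ over $\tau^*$, with anchor $(b,v)\mapsto v$ and with the bracket $$[\![(h_iX_i\circ\tau^*,X'),(s_jY_j\circ\tau^*,Y')]\!]=\bigl(h_is_j[\![X_i,Y_j]\!]\circ\tau^*+X'(s_j)\,Y_j\circ\tau^*-Y'(h_i)\,X_i\circ\tau^*,\ [X',Y']\bigr),$$ where $X_i,Y_j$ are sections of $E$, $h_i,s_j$ are functions on $E^*$ and $X',Y'$ are vector fields on $E^*$. Let $\lambda_E(p)(b,v)=p(b)$ and $\Omega_E=-d\lambda_E$, where $d$ is the differential of $\mathcal L^{\tau^*}E$. Then $\mathcal L^{\tau^*}E$ is a Lie algebroid over $E^*$, $\Omega_E$ is a symplectic (nondegenerate and closed) section of it, and there is a unique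 section $\xi_H$ of $\mathcal L^{\tau^*}E\to E^*$ with $i_{\xi_H}\Omega_E=dH$; it is smooth. Moreover: 1. $S_H=\xi_H(E^*)$ is a Lagrangian submanifold of the symplectic Lie algebroid $\mathcal L^{\tau^*}E$. 2. For every open set (in particular every open interval) $J\subseteq\mathbb R$, the map $\Psi_H:c\mapsto\xi_H\circ c$ is a bijection from the smooth curves $c:J\to E^*$ onto the smooth curves in $S_H$ (smooth maps $\gamma:J\to\mathcal L^{\tau^*}E$ with $\gamma(J)\subseteq S_H$), and it restricts to a bijection from the solutions $c:J\to E^*$ of the Hamilton equations for $H$ onto the admissible curves $\gamma:J\to S_H$. Here a submanifold $i:S\hookrightarrow\mathcal E$ of a symplectic Lie algebroid $(\pi:\mathcal E\to N,\Omega)$ with anchor $\rho_{\mathcal E}$ is Lagrangian if $\dim\bigl(\rho_{\mathcal E}(\mathcal E_{\pi(s)})+T_s(\pi\circ i)(T_sS)\bigr)$ does not depend on $s\in S$ and if, for every $s\in S$, the image of $\{(b,v)\in \mathcal E_{\pi(s)}\times T_sS\mid\rho_{\mathcal E}(b)=T_s(\pi\circ i)(v)\}$ under $(\mathrm{Id},T_si)$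 is a Lagrangian subspace (isotropic, of half the dimension) of the fibre $\{(b,w)\in\mathcal E_{\pi(s)}\times T_{s}\mathcal E\mid\rho_{\mathcal E}(b)=T_s\pi(w)\}$ of $\mathcal L^{\pi}\mathcal E$ at $s$ for the complete lift $\Omega^{\mathbf c}$. The latter is the $2$-section of $\mathcal L^{\pi}\mathcal E$ with $$\Omega^{\mathbf c}(X^{\mathbf c},Y^{\mathbf c})(a)=\rho_{\mathcal E}(a)\bigl(\Omega(X,Y)\bigr),\qquad \Omega^{\mathbf c}(X^{\mathbf v},Y^{\mathbf c})=\Omega(X,Y)\circ\pi,\qquad \Omega^{\mathbf c}(X^{\mathbf v},Y^{\mathbf v})=0$$ for all smooth sections $X,Y$ of $\mathcal E$, where $X^{\mathbf v}(a)$ is the pair of $0$ and the vertical lift of $X(\pi(a))$ to $T_a\mathcal E$, and $X^{\mathbf c}(a)$ is the pair of $X(\pi(a))$ and the value at $a$ of the vector field on $\mathcal E$ that projects on $\rho_{\mathcal E}(X)$ and sends the fibrewise linear function of each section $\alpha$ of $\mathcal E^*$ to the one of the Lie derivative $i_Xd\alpha+d(i_X\alpha)$. A curve $\gamma=(\gamma_1,\gamma_2):J\to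 S_H\subseteq E\times TE^*$ is admissible if $\gamma_2(t)=\dot c(t)$ for all $t$, where $c$ is the projection of $\gamma$ to $E^*$. A solution of the Hamilton equations is a smooth curve in $E^*$ which in all local coordinates $(x^i)$ on $M$ and local frames $(e_\alpha)$ of $E$, with the induced coordinates $(x^i,y_\alpha)$ on $E^*$ and with $\rho(e_\alpha)=\rho^i_\alpha\,\partial/\partial x^i$, $[\![e_\alpha,e_\beta]\!]=C_{\alpha\beta}^\gamma e_\gamma$, satisfies $$\frac{dx^i}{dt}=\rho^i_\beta\frac{\partial H}{\partial y_\beta},\qquad \frac{dy_\alpha}{dt}=-\Bigl(C_{\alpha\beta}^\gamma y_\gamma\frac{\partial H}{\partial y_\beta}+\rho^i_\alpha\frac{\partial H}{\partial x^i}\Bigr).$$ -/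

import Mathlib

open Bundle Set
open scoped Manifold ContDiff Topology

set_option linter.unusedSectionVars false

noncomputable section

namespace LieAlgebroid

section Basic

variable {EM : Type*} [NormedAddCommGroup EM] [NormedSpace ℝ EM]
  {HM : Type*} [TopologicalSpace HM] (I : ModelWithCorners ℝ EM HM)
  {M : Type*} [TopologicalSpace M] [ChartedSpace HM M] [IsManifold I ∞ M]
  (F : Type*) [NormedAddCommGroup F] [NormedSpace ℝ F]
  (E : M → Type*) [TopologicalSpace (TotalSpace F E)] [∀ x, TopologicalSpace (E x)]
  [∀ x, AddCommGroup (E x)] [∀ x, Module ℝ (E x)]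
  [FiberBundle F E] [VectorBundle ℝ F E]

/-- The data of a Lie algebroid structure on the vector bundle `E → M`: a smooth bundle map
`ρ : E → TM` (the anchor) and a bracket on sections. As for the Lie bracket of vector fields in
Mathlib, the bracket is a total function on all sections; only its values on smooth sections
carry any meaning. -/
structure AlgebroidData where
  anchor : ∀ x, E x →L[ℝ] TangentSpace I x
  contMDiff_anchor : ContMDiff I (I.prod 𝓘(ℝ, F →L[ℝ] EM)) ∞
    (fun x => TotalSpace.mk' (F →L[ℝ] EM) (E := fun x => E x →L[ℝ] TangentSpace I x) x (anchor x))
  bracket : (∀ x, E x) → (∀ x, E x) → ∀ x, E x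

variable {I F E}

end Basic

section Prol

variable {EM : Type*} [NormedAddCommGroup EM] [NormedSpace ℝ EM]
  {HM : Type*} [TopologicalSpace HM] {I : ModelWithCorners ℝ EM HM}
  {M : Type*} [TopologicalSpace M] [ChartedSpace HM M] [IsManifold I ∞ M]
  {F : Type*} [NormedAddCommGroup F] [NormedSpace ℝ F]
  {E : M → Type*} [TopologicalSpace (TotalSpace F E)] [∀ x, TopologicalSpace (E x)]
  [∀ x, AddCommGroup (E x)] [∀ x, Module ℝ (E x)]
  [FiberBundle F E] [VectorBundle ℝ F E]
  {EN : Type*} [NormedAddCommGroup EN] [NormedSpace ℝ EN]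
  {HN : Type*} [TopologicalSpace HN] (J : ModelWithCorners ℝ EN HN)
  {N : Type*} [TopologicalSpace N] [ChartedSpace HN N]

/-- The fibre at `y ∈ N` of the prolongation `L^f E` of `E` over `f : N → M`, that is
`{(b, v) ∈ E_{f(y)} × T_y N | ρ(b) = T_y f (v)}`. -/
def prolFiber (A : AlgebroidData I F E) (f : N → M) (y : N) :
    Submodule ℝ (E (f y) × TangentSpace J y) :=
  LinearMap.eqLocus
    ((A.anchor (f y) : E (f y) →ₗ[ℝ] TangentSpace I (f y)) ∘ₗ
      LinearMap.fst ℝ (E (f y)) (TangentSpace J y))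
    ((mfderiv J I f y : TangentSpace J y →ₗ[ℝ] TangentSpace I (f y)) ∘ₗ
      LinearMap.snd ℝ (E (f y)) (TangentSpace J y))

variable {J} in
theorem mem_prolFiber {A : AlgebroidData I F E} {f : N → M} {y : N}
    {w : E (f y) × TangentSpace J y} :
    w ∈ prolFiber J A f y ↔ A.anchor (f y) w.1 = mfderiv J I f y w.2 := Iff.rfl

end Prol

section ProlBundle

variable {EM : Type*} [NormedAddCommGroup EM] [NormedSpace ℝ EM]
  {HM : Type*} [TopologicalSpace HM] {I : ModelWithCorners ℝ EM HM}
  {M : Type*} [TopologicalSpace M] [ChartedSpace HM M] [IsManifold I ∞ M]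
  {F : Type*} [NormedAddCommGroup F] [NormedSpace ℝ F]
  {E : M → Type*} [TopologicalSpace (TotalSpace F E)] [∀ x, TopologicalSpace (E x)]
  [∀ x, AddCommGroup (E x)] [∀ x, Module ℝ (E x)]
  [FiberBundle F E] [VectorBundle ℝ F E] [ContMDiffVectorBundle ∞ F E I]
  (G : Type*) [NormedAddCommGroup G] [NormedSpace ℝ G]
  (V : M → Type*) [TopologicalSpace (TotalSpace G V)] [∀ x, TopologicalSpace (V x)]
  [∀ x, AddCommGroup (V x)] [∀ x, Module ℝ (V x)]
  [FiberBundle G V] [VectorBundle ℝ G V] [ContMDiffVectorBundle ∞ G V I]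

/-- The prolongation `L^{π} E` of `E` over the projection `π : V → M` of a vector bundle, as a family
of vector spaces over the total space of `V`. Below it is made into a smooth vector bundle. -/
def Prol (A : AlgebroidData I F E) (p : TotalSpace G V) : Type _ :=
  prolFiber (I.prod 𝓘(ℝ, G)) A (π G V) p

variable (A : AlgebroidData I F E)

instance (p : TotalSpace G V) : AddCommGroup (Prol G V A p) :=
  inferInstanceAs (AddCommGroup (prolFiber (I.prod 𝓘(ℝ, G)) A (π G V) p))
instance (p : TotalSpace G V) : Module ℝ (Prol G V A p) :=
  inferInstanceAs (Module ℝ (prolFiber (I.prod 𝓘(ℝ, G)) A (π G V) p))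
instance (p : TotalSpace G V) : TopologicalSpace (Prol G V A p) :=
  inferInstanceAs (TopologicalSpace (prolFiber (I.prod 𝓘(ℝ, G)) A (π G V) p))


theorem mem_chartAt_source_iff {p₀ p : TotalSpace G V} :
    p ∈ (chartAt (ModelProd HM G) p₀).source ↔
      p.proj ∈ (trivializationAt G V p₀.proj).baseSet ∧ p.proj ∈ (chartAt HM p₀.proj).source := by
  rw [FiberBundle.chartedSpace_chartAt]
  simp only [mfld_simps]
  rw [Trivialization.mem_source]
  refine and_congr_right fun h => ?_
  rw [Trivialization.coe_fst' _ h]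

theorem fst_clmAt_tangent {p₀ p : TotalSpace G V}
    (hp : p ∈ (chartAt (ModelProd HM G) p₀).source)
    (v : TangentSpace (I.prod 𝓘(ℝ, G)) p) :
    (trivializationAt EM (TangentSpace I) p₀.proj).continuousLinearMapAt ℝ p.proj
        (mfderiv (I.prod 𝓘(ℝ, G)) I (π G V) p v) =
      ((trivializationAt (EM × G) (TangentSpace (I.prod 𝓘(ℝ, G))) p₀).continuousLinearMapAt ℝ p
        v).1 := by
  have hp' := (mem_chartAt_source_iff G V).1 hp
  rw [TangentBundle.continuousLinearMapAt_trivializationAt hp,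
    TangentBundle.continuousLinearMapAt_trivializationAt hp'.2]
  have h1 : MDifferentiableAt (I.prod 𝓘(ℝ, G)) I (π G V) p :=
    (Bundle.contMDiff_proj V (n := ∞)).mdifferentiableAt (by simp)
  have h2 : MDifferentiableAt I 𝓘(ℝ, EM) (extChartAt I p₀.proj) p.proj :=
    mdifferentiableAt_extChartAt hp'.2
  have h3 : MDifferentiableAt (I.prod 𝓘(ℝ, G)) 𝓘(ℝ, EM × G)
    (extChartAt (I.prod 𝓘(ℝ, G)) p₀) p := mdifferentiableAt_extChartAt hp
  have h4 : MDifferentiableAt 𝓘(ℝ, EM × G) 𝓘(ℝ, EM) (Prod.fst : EM × G → EM)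
    (extChartAt (I.prod 𝓘(ℝ, G)) p₀ p) := differentiableAt_fst.mdifferentiableAt
  have e1 := mfderiv_comp_apply p h2 h1 v
  have e2 := mfderiv_comp_apply p h4 h3 v
  have h5 : (extChartAt I p₀.proj ∘ π G V) =ᶠ[𝓝 p]
      ((Prod.fst : EM × G → EM) ∘ extChartAt (I.prod 𝓘(ℝ, G)) p₀) := by
    filter_upwards [(chartAt (ModelProd HM G) p₀).open_source.mem_nhds hp] with q hq
    have hq' := (mem_chartAt_source_iff G V).1 hq
    have e : (trivializationAt G V p₀.proj q).1 = q.proj := Trivialization.coe_fst' _ hq'.1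
    simp only [extChartAt, FiberBundle.chartedSpace_chartAt, Function.comp_apply, mfld_simps, e]
  refine e1.symm.trans ?_
  rw [h5.mfderiv_eq]
  refine e2.trans ?_
  rw [mfderiv_eq_fderiv, fderiv_fst]
  rfl

/-- The coordinates `(z, w)` of `(b, v) ∈ L^{π} E` at `p`, with respect to the trivializations of
`E`, `V` and `TM` at `p₀`: `z` are those of `b`, `w` are the fibre components of `v`. -/
def prolCoord (p₀ p : TotalSpace G V) : Prol G V A p →L[ℝ] F × G :=
  (((trivializationAt F E p₀.proj).continuousLinearMapAt ℝ p.proj).comp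
      (ContinuousLinearMap.fst ℝ _ _ ∘L
        (prolFiber (I.prod 𝓘(ℝ, G)) A (π G V) p).subtypeL)).prod
    (ContinuousLinearMap.snd ℝ EM G ∘L
      ((trivializationAt (EM × G) (TangentSpace (I.prod 𝓘(ℝ, G))) p₀).continuousLinearMapAt ℝ
        p).comp
      (ContinuousLinearMap.snd ℝ _ _ ∘L
        (prolFiber (I.prod 𝓘(ℝ, G)) A (π G V) p).subtypeL))

/-- The anchor in the trivializations at `x₀`. -/
def anchorCoord (x₀ x : M) : F →L[ℝ] EM :=
  (trivializationAt EM (TangentSpace I) x₀).continuousLinearMapAt ℝ x ∘L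
    A.anchor x ∘L (trivializationAt F E x₀).symmL ℝ x

/-- The inverse of `prolCoord`. -/
def prolLift (p₀ p : TotalSpace G V) :
    F × G →L[ℝ] E p.proj × TangentSpace (I.prod 𝓘(ℝ, G)) p :=
  ((trivializationAt F E p₀.proj).symmL ℝ p.proj ∘L ContinuousLinearMap.fst ℝ F G).prod
    ((trivializationAt (EM × G) (TangentSpace (I.prod 𝓘(ℝ, G))) p₀).symmL ℝ p ∘L
      ((anchorCoord A p₀.proj p.proj ∘L ContinuousLinearMap.fst ℝ F G).prod
        (ContinuousLinearMap.snd ℝ F G)))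

/-- The domain on which `prolCoord` is a coordinate system. -/
def prolBase (_A : AlgebroidData I F E) (p₀ : TotalSpace G V) : Set (TotalSpace G V) :=
  (chartAt (ModelProd HM G) p₀).source ∩ (π G V) ⁻¹' (trivializationAt F E p₀.proj).baseSet

theorem prolLift_mem {p₀ p : TotalSpace G V}
    (hp : p ∈ (chartAt (ModelProd HM G) p₀).source)
    (w : F × G) : prolLift G V A p₀ p w ∈ prolFiber (I.prod 𝓘(ℝ, G)) A (π G V) p := by
  have hp' := (mem_chartAt_source_iff G V).1 hp
  have hT : p.proj ∈ (trivializationAt EM (TangentSpace I) p₀.proj).baseSet := hp'.2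
  have hT' : p ∈ (trivializationAt (EM × G)
    (TangentSpace (I.prod 𝓘(ℝ, G)) : TotalSpace G V → Type _) p₀).baseSet := hp
  rw [mem_prolFiber]
  have key := fst_clmAt_tangent (I := I) G V hp (prolLift G V A p₀ p w).2
  have h2 : (trivializationAt (EM × G) (TangentSpace (I.prod 𝓘(ℝ, G))) p₀).continuousLinearMapAt
      ℝ p (prolLift G V A p₀ p w).2 = (anchorCoord A p₀.proj p.proj w.1, w.2) :=
    Trivialization.continuousLinearMapAt_symmL _ hT' _
  rw [h2] at key
  have h3 := congrArg ((trivializationAt EM (TangentSpace I) p₀.proj).symmL ℝ p.proj) key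
  rw [Trivialization.symmL_continuousLinearMapAt _ hT] at h3
  rw [h3]
  exact (Trivialization.symmL_continuousLinearMapAt _ hT _).symm

theorem prolLift_prolCoord {p₀ p : TotalSpace G V} (hp : p ∈ prolBase G V A p₀)
    (w : Prol G V A p) : prolLift G V A p₀ p (prolCoord G V A p₀ p w) = w.1 := by
  obtain ⟨⟨b, v⟩, hw⟩ := w
  rw [mem_prolFiber] at hw
  have hb : (trivializationAt F E p₀.proj).symmL ℝ p.proj
      ((trivializationAt F E p₀.proj).continuousLinearMapAt ℝ p.proj b) = b :=
    Trivialization.symmL_continuousLinearMapAt _ hp.2 _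
  have hT' : p ∈ (trivializationAt (EM × G)
    (TangentSpace (I.prod 𝓘(ℝ, G)) : TotalSpace G V → Type _) p₀).baseSet := hp.1
  refine Prod.ext hb ?_
  change (trivializationAt (EM × G) (TangentSpace (I.prod 𝓘(ℝ, G))) p₀).symmL ℝ p
    ((trivializationAt EM (TangentSpace I) p₀.proj).continuousLinearMapAt ℝ p.proj
      (A.anchor p.proj ((trivializationAt F E p₀.proj).symmL ℝ p.proj
      ((trivializationAt F E p₀.proj).continuousLinearMapAt ℝ p.proj b))),
      ((trivializationAt (EM × G) (TangentSpace (I.prod 𝓘(ℝ, G))) p₀).continuousLinearMapAt ℝ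
        p v).2) = v
  rw [hb]
  have := fst_clmAt_tangent (I := I) G V hp.1 v
  erw [hw, this]
  exact Trivialization.symmL_continuousLinearMapAt _ hT' _

theorem prolCoord_prolLift {p₀ p : TotalSpace G V} (hp : p ∈ prolBase G V A p₀)
    (w : F × G) : prolCoord G V A p₀ p ⟨prolLift G V A p₀ p w, prolLift_mem G V A hp.1 w⟩ = w := by
  have hT' : p ∈ (trivializationAt (EM × G)
    (TangentSpace (I.prod 𝓘(ℝ, G)) : TotalSpace G V → Type _) p₀).baseSet := hp.1
  refine Prod.ext (Trivialization.continuousLinearMapAt_symmL _ hp.2 _) ?_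
  have : (trivializationAt (EM × G) (TangentSpace (I.prod 𝓘(ℝ, G))) p₀).continuousLinearMapAt
      ℝ p (prolLift G V A p₀ p w).2 = (anchorCoord A p₀.proj p.proj w.1, w.2) :=
    Trivialization.continuousLinearMapAt_symmL _ hT' _
  have h2 := congrArg Prod.snd this
  exact h2

open Classical in
/-- `prolLift` as an element of the prolongation. -/
def prolMk (p₀ p : TotalSpace G V) (w : F × G) : Prol G V A p :=
  if h : prolLift G V A p₀ p w ∈ prolFiber (I.prod 𝓘(ℝ, G)) A (π G V) p then ⟨_, h⟩ else 0

theorem prolMk_val {p₀ p : TotalSpace G V}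
    (hp : p ∈ (chartAt (ModelProd HM G) p₀).source) (w : F × G) :
    (prolMk G V A p₀ p w).1 = prolLift G V A p₀ p w := by
  have h : prolMk G V A p₀ p w = ⟨prolLift G V A p₀ p w, prolLift_mem G V A hp w⟩ :=
    dif_pos (prolLift_mem G V A hp w)
  exact congrArg Subtype.val h

theorem prolMk_prolCoord {p₀ p : TotalSpace G V} (hp : p ∈ prolBase G V A p₀)
    (w : Prol G V A p) : prolMk G V A p₀ p (prolCoord G V A p₀ p w) = w :=
  Subtype.ext ((prolMk_val G V A hp.1 _).trans (prolLift_prolCoord G V A hp w))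

theorem prolCoord_prolMk {p₀ p : TotalSpace G V} (hp : p ∈ prolBase G V A p₀)
    (w : F × G) : prolCoord G V A p₀ p (prolMk G V A p₀ p w) = w := by
  have : prolMk G V A p₀ p w = ⟨prolLift G V A p₀ p w, prolLift_mem G V A hp.1 w⟩ :=
    Subtype.ext (prolMk_val G V A hp.1 _)
  rw [this, prolCoord_prolLift G V A hp]

/-- The local trivialization of the prolongation given by `prolCoord`. -/
def prolPretriv (p₀ : TotalSpace G V) :
    Pretrivialization (F × G) (π (F × G) (Prol G V A)) where
  toFun q := ⟨q.1, prolCoord G V A p₀ q.1 q.2⟩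
  invFun q := ⟨q.1, prolMk G V A p₀ q.1 q.2⟩
  source := TotalSpace.proj ⁻¹' prolBase G V A p₀
  target := prolBase G V A p₀ ×ˢ univ
  map_source' _ h := ⟨h, mem_univ _⟩
  map_target' _ h := h.1
  left_inv' := by
    rintro ⟨p, w⟩ (h : p ∈ prolBase G V A p₀)
    exact congrArg (TotalSpace.mk p) (prolMk_prolCoord G V A h w)
  right_inv' := by
    rintro ⟨p, w⟩ ⟨h, -⟩
    exact congrArg (Prod.mk p) (prolCoord_prolMk G V A h w)
  open_target := by
    refine IsOpen.prod ?_ isOpen_univ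
    exact (chartAt (ModelProd HM G) p₀).open_source.inter
      ((trivializationAt F E p₀.proj).open_baseSet.preimage (FiberBundle.continuous_proj G V))
  baseSet := prolBase G V A p₀
  open_baseSet := (chartAt (ModelProd HM G) p₀).open_source.inter
      ((trivializationAt F E p₀.proj).open_baseSet.preimage (FiberBundle.continuous_proj G V))
  source_eq := rfl
  target_eq := rfl
  proj_toFun _ _ := rfl

theorem prolPretriv_symm_apply {p₀ p : TotalSpace G V} (hp : p ∈ prolBase G V A p₀) (w : F × G) :
    (prolPretriv G V A p₀).symm p w = prolMk G V A p₀ p w :=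
  Pretrivialization.symm_apply (prolPretriv G V A p₀) hp w

instance (p₀ : TotalSpace G V) : (prolPretriv G V A p₀).IsLinear ℝ where
  linear p _ :=
    { map_add := fun x y => map_add (prolCoord G V A p₀ p) x y
      map_smul := fun c x => map_smul (prolCoord G V A p₀ p) c x }

/-- The transition maps between the trivializations of the prolongation. -/
def prolCoordChange (p₀ p₁ p : TotalSpace G V) : F × G →L[ℝ] F × G :=
  (((trivializationAt F E p₁.proj).continuousLinearMapAt ℝ p.proj ∘L
    (trivializationAt F E p₀.proj).symmL ℝ p.proj) ∘L ContinuousLinearMap.fst ℝ F G).prod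
   (ContinuousLinearMap.snd ℝ EM G ∘L
    ((trivializationAt (EM × G) (TangentSpace (I.prod 𝓘(ℝ, G))) p₁).continuousLinearMapAt ℝ p ∘L
     (trivializationAt (EM × G) (TangentSpace (I.prod 𝓘(ℝ, G))) p₀).symmL ℝ p) ∘L
      ((anchorCoord A p₀.proj p.proj ∘L ContinuousLinearMap.fst ℝ F G).prod
        (ContinuousLinearMap.snd ℝ F G)))

theorem contMDiffOn_anchorCoord (x₀ : M) :
    ContMDiffOn I 𝓘(ℝ, F →L[ℝ] EM) ∞ (anchorCoord A x₀)
      ((trivializationAt F E x₀).baseSet ∩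
        (trivializationAt EM (TangentSpace I) x₀).baseSet) := by
  have := (Bundle.Trivialization.contMDiffOn_section_iff (n := ∞)
    (trivializationAt (F →L[ℝ] EM) (fun x => E x →L[ℝ] TangentSpace I x) x₀) (s := A.anchor)
    (trivializationAt (F →L[ℝ] EM) (fun x => E x →L[ℝ] TangentSpace I x) x₀).open_baseSet
    subset_rfl).1 A.contMDiff_anchor.contMDiffOn
  exact this

theorem contMDiffOn_prolCoordChange (p₀ p₁ : TotalSpace G V) :
    ContMDiffOn (I.prod 𝓘(ℝ, G)) 𝓘(ℝ, F × G →L[ℝ] F × G) ∞ (prolCoordChange G V A p₀ p₁)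
      (prolBase G V A p₀ ∩ prolBase G V A p₁) := by
  have hE : ContMDiffOn (I.prod 𝓘(ℝ, G)) 𝓘(ℝ, F →L[ℝ] F) ∞
      (fun p : TotalSpace G V => (trivializationAt F E p₁.proj).continuousLinearMapAt ℝ p.proj ∘L
        (trivializationAt F E p₀.proj).symmL ℝ p.proj)
      (prolBase G V A p₀ ∩ prolBase G V A p₁) := by
    have h := (contMDiffOn_coordChangeL (n := ∞) (IB := I) (trivializationAt F E p₀.proj)
      (trivializationAt F E p₁.proj)).comp
      (Bundle.contMDiff_proj V (n := ∞) (IB := I)).contMDiffOn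
      (s := prolBase G V A p₀ ∩ prolBase G V A p₁) (fun p hp => ⟨hp.1.2, hp.2.2⟩)
    refine h.congr fun p hp => ?_
    ext z
    simp only [Function.comp_apply]
    rw [ContinuousLinearEquiv.coe_coe, Trivialization.coordChangeL_apply _ _ ⟨hp.1.2, hp.2.2⟩]
    simp only [ContinuousLinearMap.comp_apply, Trivialization.continuousLinearMapAt_apply,
      Trivialization.coe_linearMapAt_of_mem _ hp.2.2, Trivialization.symmL_apply _ hp.1.2]
  have hT : ContMDiffOn (I.prod 𝓘(ℝ, G)) 𝓘(ℝ, EM × G →L[ℝ] EM × G) ∞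
      (fun p : TotalSpace G V =>
        (trivializationAt (EM × G) (TangentSpace (I.prod 𝓘(ℝ, G))) p₁).continuousLinearMapAt ℝ p ∘L
        (trivializationAt (EM × G) (TangentSpace (I.prod 𝓘(ℝ, G))) p₀).symmL ℝ p)
      (prolBase G V A p₀ ∩ prolBase G V A p₁) := by
    have h := (contMDiffOn_coordChangeL (n := ∞) (IB := I.prod 𝓘(ℝ, G))
      (trivializationAt (EM × G) (TangentSpace (I.prod 𝓘(ℝ, G)) : TotalSpace G V → Type _) p₀)
      (trivializationAt (EM × G) (TangentSpace (I.prod 𝓘(ℝ, G)) : TotalSpace G V → Type _) p₁))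
    have h' := h.mono (s := _) (t := prolBase G V A p₀ ∩ prolBase G V A p₁)
      (fun p hp => ⟨hp.1.1, hp.2.1⟩)
    refine h'.congr fun p hp => ?_
    have hp1 : p ∈ (trivializationAt (EM × G)
      (TangentSpace (I.prod 𝓘(ℝ, G)) : TotalSpace G V → Type _) p₁).baseSet := hp.2.1
    have hp0 : p ∈ (trivializationAt (EM × G)
      (TangentSpace (I.prod 𝓘(ℝ, G)) : TotalSpace G V → Type _) p₀).baseSet := hp.1.1
    refine ContinuousLinearMap.ext fun z => ?_
    rw [ContinuousLinearEquiv.coe_coe, Trivialization.coordChangeL_apply _ _ ⟨hp0, hp1⟩]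
    simp only [ContinuousLinearMap.comp_apply, Trivialization.continuousLinearMapAt_apply,
      Trivialization.coe_linearMapAt_of_mem _ hp1, Trivialization.symmL_apply _ hp0]
  have hA : ContMDiffOn (I.prod 𝓘(ℝ, G)) 𝓘(ℝ, F →L[ℝ] EM) ∞
      (fun p : TotalSpace G V => anchorCoord A p₀.proj p.proj)
      (prolBase G V A p₀ ∩ prolBase G V A p₁) :=
    (contMDiffOn_anchorCoord A p₀.proj).comp
      (Bundle.contMDiff_proj V (n := ∞) (IB := I)).contMDiffOn
      (fun p hp => ⟨hp.1.2, ((mem_chartAt_source_iff G V).1 hp.1.1).2⟩)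
  have h1 : ContMDiffOn (I.prod 𝓘(ℝ, G)) 𝓘(ℝ, F × G →L[ℝ] EM × G) ∞
      (fun p : TotalSpace G V => ContinuousLinearMap.inl ℝ EM G ∘L
        (anchorCoord A p₀.proj p.proj ∘L ContinuousLinearMap.fst ℝ F G) +
        ContinuousLinearMap.inr ℝ EM G ∘L ContinuousLinearMap.snd ℝ F G)
      (prolBase G V A p₀ ∩ prolBase G V A p₁) :=
    (contMDiffOn_const.clm_comp (hA.clm_comp contMDiffOn_const)).add contMDiffOn_const
  have h2 : ContMDiffOn (I.prod 𝓘(ℝ, G)) 𝓘(ℝ, F × G →L[ℝ] F × G) ∞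
      (fun p : TotalSpace G V => ContinuousLinearMap.inl ℝ F G ∘L
        (((trivializationAt F E p₁.proj).continuousLinearMapAt ℝ p.proj ∘L
          (trivializationAt F E p₀.proj).symmL ℝ p.proj) ∘L ContinuousLinearMap.fst ℝ F G) +
        ContinuousLinearMap.inr ℝ F G ∘L (ContinuousLinearMap.snd ℝ EM G ∘L
          ((trivializationAt (EM × G) (TangentSpace (I.prod 𝓘(ℝ, G))) p₁).continuousLinearMapAt ℝ p
            ∘L (trivializationAt (EM × G) (TangentSpace (I.prod 𝓘(ℝ, G))) p₀).symmL ℝ p) ∘L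
          (ContinuousLinearMap.inl ℝ EM G ∘L
        (anchorCoord A p₀.proj p.proj ∘L ContinuousLinearMap.fst ℝ F G) +
        ContinuousLinearMap.inr ℝ EM G ∘L ContinuousLinearMap.snd ℝ F G)))
      (prolBase G V A p₀ ∩ prolBase G V A p₁) :=
    (contMDiffOn_const.clm_comp (hE.clm_comp contMDiffOn_const)).add
      (contMDiffOn_const.clm_comp (contMDiffOn_const.clm_comp (hT.clm_comp h1)))
  refine h2.congr fun p hp => ContinuousLinearMap.ext fun z => ?_
  simp only [prolCoordChange, ContinuousLinearMap.prod_apply, ContinuousLinearMap.comp_apply,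
    add_apply, ContinuousLinearMap.inl_apply, ContinuousLinearMap.inr_apply,
    Prod.mk_add_mk, add_zero, zero_add]

theorem prolCoordChange_apply {p₀ p₁ p : TotalSpace G V}
    (hp : p ∈ prolBase G V A p₀ ∩ prolBase G V A p₁) (z : F × G) :
    prolCoordChange G V A p₀ p₁ p z =
      (prolPretriv G V A p₁ ⟨p, (prolPretriv G V A p₀).symm p z⟩).2 := by
  rw [prolPretriv_symm_apply G V A hp.1]
  change _ = prolCoord G V A p₁ p (prolMk G V A p₀ p z)
  have h : prolMk G V A p₀ p z = ⟨prolLift G V A p₀ p z, prolLift_mem G V A hp.1.1 z⟩ :=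
    Subtype.ext (prolMk_val G V A hp.1.1 z)
  rw [h]
  rfl

theorem isInducing_prolCoord (p : TotalSpace G V) :
    Topology.IsInducing (prolCoord G V A p p) := by
  have hp : p ∈ prolBase G V A p :=
    ⟨mem_chart_source _ p, mem_baseSet_trivializationAt F E p.proj⟩
  let e : Prol G V A p ≃L[ℝ] F × G :=
    { toFun := prolCoord G V A p p
      map_add' := map_add _
      map_smul' := map_smul _
      invFun := prolMk G V A p p
      left_inv := fun w => prolMk_prolCoord G V A hp w
      right_inv := fun w => prolCoord_prolMk G V A hp w
      continuous_toFun := (prolCoord G V A p p).continuous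
      continuous_invFun := by
        refine Topology.IsInducing.subtypeVal.continuous_iff.2 ?_
        exact (prolLift G V A p p).continuous.congr fun w => (prolMk_val G V A hp.1 w).symm }
  exact e.toHomeomorph.isInducing

/-- The vector bundle structure of the prolongation. -/
def prolPrebundle : VectorPrebundle ℝ (F × G) (Prol G V A) where
  pretrivializationAtlas := range (prolPretriv G V A)
  pretrivialization_linear' := by
    rintro _ ⟨p, rfl⟩
    infer_instance
  pretrivializationAt := prolPretriv G V A
  mem_base_pretrivializationAt p :=
    ⟨mem_chart_source _ p, mem_baseSet_trivializationAt F E p.proj⟩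
  pretrivialization_mem_atlas p := mem_range_self p
  exists_coordChange := by
    rintro _ ⟨p₀, rfl⟩ _ ⟨p₁, rfl⟩
    exact ⟨prolCoordChange G V A p₀ p₁, (contMDiffOn_prolCoordChange G V A p₀ p₁).continuousOn,
      fun p hp z => prolCoordChange_apply G V A hp z⟩
  totalSpaceMk_isInducing p :=
    Topology.isInducing_const_prod.mpr (isInducing_prolCoord G V A p)

instance : (prolPrebundle G V A).IsContMDiff (I.prod 𝓘(ℝ, G)) ∞ where
  exists_contMDiffCoordChange := by
    rintro _ ⟨p₀, rfl⟩ _ ⟨p₁, rfl⟩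
    exact ⟨prolCoordChange G V A p₀ p₁, contMDiffOn_prolCoordChange G V A p₀ p₁,
      fun p hp z => prolCoordChange_apply G V A hp z⟩

instance : TopologicalSpace (TotalSpace (F × G) (Prol G V A)) :=
  (prolPrebundle G V A).totalSpaceTopology
instance : FiberBundle (F × G) (Prol G V A) := (prolPrebundle G V A).toFiberBundle
instance : VectorBundle ℝ (F × G) (Prol G V A) := (prolPrebundle G V A).toVectorBundle
instance : ContMDiffVectorBundle ∞ (F × G) (Prol G V A) (I.prod 𝓘(ℝ, G)) :=
  (prolPrebundle G V A).contMDiffVectorBundle (I.prod 𝓘(ℝ, G))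

/-- The anchor `(b, v) ↦ v` of the prolongation. -/
def prolAnchor (p : TotalSpace G V) : Prol G V A p →L[ℝ] TangentSpace (I.prod 𝓘(ℝ, G)) p :=
  ContinuousLinearMap.snd ℝ _ _ ∘L (prolFiber (I.prod 𝓘(ℝ, G)) A (π G V) p).subtypeL

theorem contMDiff_prolAnchor : ContMDiff (I.prod 𝓘(ℝ, G))
    ((I.prod 𝓘(ℝ, G)).prod 𝓘(ℝ, F × G →L[ℝ] EM × G)) ∞
    (fun p => TotalSpace.mk' (F × G →L[ℝ] EM × G)
      (E := fun p => Prol G V A p →L[ℝ] TangentSpace (I.prod 𝓘(ℝ, G)) p) p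
      (prolAnchor G V A p)) := by
  intro p₀
  rw [contMDiffAt_hom_bundle]
  refine ⟨contMDiffAt_id, ?_⟩
  have hp₀ : p₀ ∈ prolBase G V A p₀ :=
    ⟨mem_chart_source _ p₀, mem_baseSet_trivializationAt F E p₀.proj⟩
  have hnhds : prolBase G V A p₀ ∈ 𝓝 p₀ := (prolPretriv G V A p₀).open_baseSet.mem_nhds hp₀
  have hA : ContMDiffAt (I.prod 𝓘(ℝ, G)) 𝓘(ℝ, F →L[ℝ] EM) ∞
      (fun p : TotalSpace G V => anchorCoord A p₀.proj p.proj) p₀ :=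
    ((contMDiffOn_anchorCoord A p₀.proj).comp (s := prolBase G V A p₀)
      (Bundle.contMDiff_proj V (n := ∞) (IB := I)).contMDiffOn
      (fun p hp => ⟨hp.2, ((mem_chartAt_source_iff G V).1 hp.1).2⟩)).contMDiffAt hnhds
  have h1 : ContMDiffAt (I.prod 𝓘(ℝ, G)) 𝓘(ℝ, F × G →L[ℝ] EM × G) ∞
      (fun p : TotalSpace G V => ContinuousLinearMap.inl ℝ EM G ∘L
        (anchorCoord A p₀.proj p.proj ∘L ContinuousLinearMap.fst ℝ F G) +
        ContinuousLinearMap.inr ℝ EM G ∘L ContinuousLinearMap.snd ℝ F G) p₀ :=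
    (contMDiffAt_const.clm_comp (hA.clm_comp contMDiffAt_const)).add contMDiffAt_const
  refine h1.congr_of_eventuallyEq ?_
  filter_upwards [hnhds] with p hp
  refine ContinuousLinearMap.ext fun z => ?_
  have hb : p ∈ (trivializationAt (F × G) (Prol G V A) p₀).baseSet := hp
  have hs : (trivializationAt (F × G) (Prol G V A) p₀).symmL ℝ p z = prolMk G V A p₀ p z := by
    rw [Trivialization.symmL_apply _ hb]
    exact prolPretriv_symm_apply G V A hp z
  have hT' : p ∈ (trivializationAt (EM × G)
    (TangentSpace (I.prod 𝓘(ℝ, G)) : TotalSpace G V → Type _) p₀).baseSet := hp.1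
  change (trivializationAt (EM × G) (TangentSpace (I.prod 𝓘(ℝ, G))) p₀).continuousLinearMapAt
      ℝ p (prolAnchor G V A p ((trivializationAt (F × G) (Prol G V A) p₀).symmL ℝ p z)) =
    (anchorCoord A p₀.proj p.proj z.1, 0) + (0, z.2)
  rw [hs]
  have h2 : prolAnchor G V A p (prolMk G V A p₀ p z) = (prolLift G V A p₀ p z).2 :=
    congrArg Prod.snd (prolMk_val G V A hp.1 z)
  rw [h2, Prod.mk_add_mk, add_zero, zero_add]
  exact Trivialization.continuousLinearMapAt_symmL _ hT' _

end ProlBundle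
section Algebroid

variable {EM : Type*} [NormedAddCommGroup EM] [NormedSpace ℝ EM]
  {HM : Type*} [TopologicalSpace HM] {I : ModelWithCorners ℝ EM HM}
  {M : Type*} [TopologicalSpace M] [ChartedSpace HM M] [IsManifold I ∞ M]
  {F : Type*} [NormedAddCommGroup F] [NormedSpace ℝ F]
  {E : M → Type*} [TopologicalSpace (TotalSpace F E)] [∀ x, TopologicalSpace (E x)]
  [∀ x, AddCommGroup (E x)] [∀ x, Module ℝ (E x)]
  [FiberBundle F E] [VectorBundle ℝ F E]

variable (I F) in
/-- The section `X` of the bundle `E` is smooth. -/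
def SmoothSection (X : ∀ x, E x) : Prop :=
  ContMDiff I (I.prod 𝓘(ℝ, F)) ∞ (fun x => TotalSpace.mk' F x (X x))

variable (I F) in
/-- The section `α` of the dual bundle of `E` is smooth. -/
def SmoothDualSection (α : ∀ x, E x →L[ℝ] ℝ) : Prop :=
  ContMDiff I (I.prod 𝓘(ℝ, F →L[ℝ] ℝ)) ∞
    (fun x => TotalSpace.mk' (F →L[ℝ] ℝ) (E := fun x => E x →L[ℝ] ℝ) x (α x))

variable (I) in
/-- The derivative at `x` of the vector-valued function `f` along the tangent vector `v`. -/
def dirDeriv {W : Type*} [NormedAddCommGroup W] [NormedSpace ℝ W] (f : M → W) (x : M)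
    (v : TangentSpace I x) : W :=
  mfderiv I 𝓘(ℝ, W) f x v

/-- The axioms of a Lie algebroid: the bracket makes the real vector space of smooth sections a Lie
algebra and satisfies the Leibniz rule `⟦X, f Y⟧ = f ⟦X, Y⟧ + ρ(X)(f) Y`. -/
structure IsLieAlgebroid (A : AlgebroidData I F E) : Prop where
  smooth : ∀ X Y, SmoothSection I F X → SmoothSection I F Y → SmoothSection I F (A.bracket X Y)
  add_right : ∀ X Y Z, SmoothSection I F X → SmoothSection I F Y → SmoothSection I F Z →
    A.bracket X (Y + Z) = A.bracket X Y + A.bracket X Z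
  smul_right : ∀ (c : ℝ) X Y, SmoothSection I F X → SmoothSection I F Y →
    A.bracket X (c • Y) = c • A.bracket X Y
  skew : ∀ X Y, SmoothSection I F X → SmoothSection I F Y → A.bracket X Y = -A.bracket Y X
  jacobi : ∀ X Y Z, SmoothSection I F X → SmoothSection I F Y → SmoothSection I F Z →
    A.bracket X (A.bracket Y Z) + A.bracket Y (A.bracket Z X) + A.bracket Z (A.bracket X Y) = 0
  leibniz : ∀ (f : M → ℝ) X Y, ContMDiff I 𝓘(ℝ, ℝ) ∞ f → SmoothSection I F X →
    SmoothSection I F Y → ∀ x, A.bracket X (fun y => f y • Y y) x =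
      f x • A.bracket X Y x + dirDeriv I f x (A.anchor x (X x)) • Y x

variable (I F) in
/-- A smooth global section that, near `x`, has constant coordinates in the trivialization at `x`
and takes the value `u` at `x` (it exists on every finite-dimensional Hausdorff manifold). -/
def localExt {x : M} (u : E x) : ∀ y, E y :=
  Classical.epsilon fun s : ∀ y, E y =>
    SmoothSection I F s ∧ ∀ᶠ y in 𝓝 x, s y = FiberBundle.extend F u y

/-- The differential of a `1`-section: `dα(X, Y) = ρ(X)(α(Y)) - ρ(Y)(α(X)) - α(⟦X, Y⟧)`, where
`X`, `Y` are smooth sections with the given values at `x`. -/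
def d1 (A : AlgebroidData I F E) (α : ∀ x, E x →L[ℝ] ℝ) (x : M) (u v : E x) : ℝ :=
  dirDeriv I (fun y => α y (localExt I F v y)) x (A.anchor x u) -
    dirDeriv I (fun y => α y (localExt I F u y)) x (A.anchor x v) -
    α x (A.bracket (localExt I F u) (localExt I F v) x)

/-- The Lie derivative `L_X α = i_X dα + d(i_X α)` of a `1`-section. -/
def lieDeriv (A : AlgebroidData I F E) (X : ∀ x, E x) (α : ∀ x, E x →L[ℝ] ℝ) (x : M) (u : E x) :
    ℝ :=
  d1 A α x (X x) u + dirDeriv I (fun y => α y (X y)) x (A.anchor x u)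

variable (I F) in
/-- `Ω` is a smooth section of `∧² E* → M`. -/
structure IsTwoSection (Ω : ∀ x, E x → E x → ℝ) : Prop where
  add_left : ∀ x u u' v, Ω x (u + u') v = Ω x u v + Ω x u' v
  smul_left : ∀ x (c : ℝ) u v, Ω x (c • u) v = c * Ω x u v
  skew : ∀ x u v, Ω x u v = -Ω x v u
  smooth : ∀ X Y, SmoothSection I F X → SmoothSection I F Y →
    ContMDiff I 𝓘(ℝ, ℝ) ∞ fun x => Ω x (X x) (Y x)

/-- `Ω` is a symplectic section of the Lie algebroid: a nondegenerate closed `2`-section. -/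
structure IsSymplecticSection (A : AlgebroidData I F E) (Ω : ∀ x, E x → E x → ℝ) : Prop
    extends IsTwoSection I F Ω where
  nondegenerate : ∀ x u, (∀ v, Ω x u v = 0) → u = 0
  closed : ∀ X Y Z, SmoothSection I F X → SmoothSection I F Y → SmoothSection I F Z → ∀ x,
    dirDeriv I (fun y => Ω y (Y y) (Z y)) x (A.anchor x (X x)) -
      dirDeriv I (fun y => Ω y (X y) (Z y)) x (A.anchor x (Y x)) +
      dirDeriv I (fun y => Ω y (X y) (Y y)) x (A.anchor x (Z x)) -
      Ω x (A.bracket X Y x) (Z x) + Ω x (A.bracket X Z x) (Y x) -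
      Ω x (A.bracket Y Z x) (X x) = 0

end Algebroid

section CompleteLift

variable {EM : Type*} [NormedAddCommGroup EM] [NormedSpace ℝ EM]
  {HM : Type*} [TopologicalSpace HM] {I : ModelWithCorners ℝ EM HM}
  {M : Type*} [TopologicalSpace M] [ChartedSpace HM M] [IsManifold I ∞ M]
  {F : Type*} [NormedAddCommGroup F] [NormedSpace ℝ F]
  {E : M → Type*} [TopologicalSpace (TotalSpace F E)] [∀ x, TopologicalSpace (E x)]
  [∀ x, AddCommGroup (E x)] [∀ x, Module ℝ (E x)]
  [FiberBundle F E] [VectorBundle ℝ F E]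

variable (I F) in
/-- The vertical lift of `e ∈ E x` at `a ∈ E x`: the velocity of `t ↦ a + t e` at `t = 0`. -/
def verticalLift (a : TotalSpace F E) (e : E a.proj) : TangentSpace (I.prod 𝓘(ℝ, F)) a :=
  (mfderiv 𝓘(ℝ, ℝ) (I.prod 𝓘(ℝ, F))
    (fun t : ℝ => TotalSpace.mk' F a.proj (a.2 + t • e)) 0 (1 : ℝ) : EM × F)

/-- `w` is the value at `a ∈ E` of the complete lift `X^c` of the section `X`, the vector field on
the total space of `E` that projects on `ρ(X)` and satisfies `X^c(α̂) = (L_X α)^` for every smooth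
`1`-section `α`, where `α̂` is the fibrewise linear function on `E` defined by `α`. -/
def IsCompleteLiftAt (A : AlgebroidData I F E) (X : ∀ x, E x) (a : TotalSpace F E)
    (w : TangentSpace (I.prod 𝓘(ℝ, F)) a) : Prop :=
  mfderiv (I.prod 𝓘(ℝ, F)) I (π F E) a w = A.anchor a.proj (X a.proj) ∧
  ∀ α : ∀ x, E x →L[ℝ] ℝ, SmoothDualSection I F α →
    dirDeriv (I.prod 𝓘(ℝ, F)) (fun b : TotalSpace F E => α b.proj b.2) a w =
      lieDeriv A X α a.proj a.2

/-- `Ωc` is the complete lift of the `2`-section `Ω`: the `2`-section of the prolongation of `E` over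
`E → M` with `Ωc(X^c, Y^c) = Ω(X, Y)^c`, `Ωc(X^v, Y^c) = Ω(X, Y) ∘ π`, `Ωc(X^v, Y^v) = 0`. Here the
complete and vertical lifts of a section `X` to the prolongation are
`a ↦ (X(π(a)), X^c(a))` and `a ↦ (0, X^v(a))`, and `f^c(a) = ρ(a)(f)` for a function `f`. -/
structure IsCompleteLift (A : AlgebroidData I F E) (Ω : ∀ x, E x → E x → ℝ)
    (Ωc : ∀ a : TotalSpace F E, prolFiber (I.prod 𝓘(ℝ, F)) A (π F E) a →
      prolFiber (I.prod 𝓘(ℝ, F)) A (π F E) a → ℝ) : Prop where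
  add_left : ∀ a u u' v, Ωc a (u + u') v = Ωc a u v + Ωc a u' v
  smul_left : ∀ a (c : ℝ) u v, Ωc a (c • u) v = c * Ωc a u v
  skew : ∀ a u v, Ωc a u v = -Ωc a v u
  complete_complete : ∀ X Y, SmoothSection I F X → SmoothSection I F Y → ∀ a u v,
    u.1.1 = X a.proj → IsCompleteLiftAt A X a u.1.2 →
    v.1.1 = Y a.proj → IsCompleteLiftAt A Y a v.1.2 →
    Ωc a u v = dirDeriv I (fun x => Ω x (X x) (Y x)) a.proj (A.anchor a.proj a.2)
  vertical_complete : ∀ X Y, SmoothSection I F X → SmoothSection I F Y → ∀ a u v,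
    u.1 = (0, verticalLift I F a (X a.proj)) →
    v.1.1 = Y a.proj → IsCompleteLiftAt A Y a v.1.2 →
    Ωc a u v = Ω a.proj (X a.proj) (Y a.proj)
  vertical_vertical : ∀ X Y, SmoothSection I F X → SmoothSection I F Y → ∀ a u v,
    u.1 = (0, verticalLift I F a (X a.proj)) → v.1 = (0, verticalLift I F a (Y a.proj)) →
    Ωc a u v = 0

/-- The embedding `i : S → E` presents a Lagrangian submanifold of the symplectic Lie algebroid
`(E, Ω)` with bundle projection `π`: the subspaces `ρ(E) + T(π ∘ i)(TS)` of `TM` have constant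
dimension, and the image `W` of the prolongation of `E` over `π ∘ i` under `(Id, Ti)` is, at each
point, a Lagrangian subspace (isotropic, of half the dimension) of the prolongation of `E` over `π`
with the complete lift of `Ω`. -/
def IsLagrangianSubmanifold
    {ES : Type*} [NormedAddCommGroup ES] [NormedSpace ℝ ES]
    {HS : Type*} [TopologicalSpace HS] (J : ModelWithCorners ℝ ES HS)
    {S : Type*} [TopologicalSpace S] [ChartedSpace HS S]
    (A : AlgebroidData I F E) (Ω : ∀ x, E x → E x → ℝ) (i : S → TotalSpace F E) : Prop :=
  ContMDiff J (I.prod 𝓘(ℝ, F)) ∞ i ∧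
  Topology.IsEmbedding i ∧
  (∀ s, Function.Injective (mfderiv J (I.prod 𝓘(ℝ, F)) i s)) ∧
  (∃ n : ℕ, ∀ s, Module.finrank ℝ ↥(LinearMap.range (A.anchor (i s).proj).toLinearMap ⊔
    LinearMap.range (mfderiv J I (fun s => (i s).proj) s).toLinearMap) = n) ∧
  ∃ Ωc, IsCompleteLift A Ω Ωc ∧ ∀ s,
    ∃ W : Submodule ℝ (prolFiber (I.prod 𝓘(ℝ, F)) A (π F E) (i s)),
      (∀ w, w ∈ W ↔ ∃ z ∈ prolFiber J A (fun s => (i s).proj) s,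
        w.1 = (z.1, mfderiv J (I.prod 𝓘(ℝ, F)) i s z.2)) ∧
      (∀ w ∈ W, ∀ w' ∈ W, Ωc (i s) w w' = 0) ∧
      2 * Module.finrank ℝ W = Module.finrank ℝ (prolFiber (I.prod 𝓘(ℝ, F)) A (π F E) (i s))

end CompleteLift


section Prolongation

variable {EM : Type*} [NormedAddCommGroup EM] [NormedSpace ℝ EM]
  {HM : Type*} [TopologicalSpace HM] {I : ModelWithCorners ℝ EM HM}
  {M : Type*} [TopologicalSpace M] [ChartedSpace HM M] [IsManifold I ∞ M]
  {F : Type*} [NormedAddCommGroup F] [NormedSpace ℝ F]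
  {E : M → Type*} [TopologicalSpace (TotalSpace F E)] [∀ x, TopologicalSpace (E x)]
  [∀ x, AddCommGroup (E x)] [∀ x, Module ℝ (E x)]
  [FiberBundle F E] [VectorBundle ℝ F E] [ContMDiffVectorBundle ∞ F E I]
  (G : Type*) [NormedAddCommGroup G] [NormedSpace ℝ G]
  (V : M → Type*) [TopologicalSpace (TotalSpace G V)] [∀ x, TopologicalSpace (V x)]
  [∀ x, AddCommGroup (V x)] [∀ x, Module ℝ (V x)]
  [FiberBundle G V] [VectorBundle ℝ G V] [ContMDiffVectorBundle ∞ G V I]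
  (A : AlgebroidData I F E)

/-- The coordinates of the first component of a section of the prolongation. -/
def fstCoord {G : Type*} [NormedAddCommGroup G] [NormedSpace ℝ G]
    {V : M → Type*} [TopologicalSpace (TotalSpace G V)] [∀ x, TopologicalSpace (V x)]
    [∀ x, AddCommGroup (V x)] [∀ x, Module ℝ (V x)]
    [FiberBundle G V] [VectorBundle ℝ G V] [ContMDiffVectorBundle ∞ G V I]
    {A : AlgebroidData I F E} (S : ∀ p, Prol G V A p) (x : M) (q : TotalSpace G V) : F :=
  (trivializationAt F E x ⟨q.proj, (S q).1.1⟩).2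

/-- The first component of the bracket of two sections `S = (h_i e_i, S₂)`, `T = (s_j e_j, T₂)` of
the prolongation, namely `h_i s_j ⟦e_i, e_j⟧ + S₂(s_j) e_j - T₂(h_i) e_i`, for the local frame `e_i`
of `E` that is constant in the trivialization at the base point. -/
def prolBracketFst (S T : ∀ p, Prol G V A p) (p : TotalSpace G V) : E p.proj :=
  (trivializationAt F E p.proj).symm p.proj
    (dirDeriv (I.prod 𝓘(ℝ, G)) (fstCoord T p.proj) p (S p).1.2 -
      dirDeriv (I.prod 𝓘(ℝ, G)) (fstCoord S p.proj) p (T p).1.2) +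
  A.bracket (localExt I F (S p).1.1) (localExt I F (T p).1.1) p.proj

open Classical in
/-- The bracket of two sections of the prolongation. Its second component is the Lie bracket of
vector fields. (For smooth sections of a Lie algebroid the pair always lies in the prolongation.) -/
def prolBracket (S T : ∀ p, Prol G V A p) (p : TotalSpace G V) : Prol G V A p :=
  if h : (prolBracketFst G V A S T p,
      VectorField.mlieBracket (I.prod 𝓘(ℝ, G)) (fun q => (S q).1.2) (fun q => (T q).1.2) p) ∈
      prolFiber (I.prod 𝓘(ℝ, G)) A (π G V) p
  then ⟨_, h⟩ else 0

/-- The Lie algebroid structure of the prolongation `L^{π} E` over the projection of a vector bundle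
`V`. -/
def prolong : AlgebroidData (I.prod 𝓘(ℝ, G)) (F × G) (Prol G V A) where
  anchor := prolAnchor G V A
  contMDiff_anchor := contMDiff_prolAnchor G V A
  bracket := prolBracket G V A

end Prolongation

section Hamilton

variable {EM : Type*} [NormedAddCommGroup EM] [NormedSpace ℝ EM]
  {HM : Type*} [TopologicalSpace HM] {I : ModelWithCorners ℝ EM HM}
  {M : Type*} [TopologicalSpace M] [ChartedSpace HM M] [IsManifold I ∞ M]
  {F : Type*} [NormedAddCommGroup F] [NormedSpace ℝ F]
  {E : M → Type*} [TopologicalSpace (TotalSpace F E)] [∀ x, TopologicalSpace (E x)]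
  [∀ x, AddCommGroup (E x)] [∀ x, Module ℝ (E x)]
  [FiberBundle F E] [VectorBundle ℝ F E] [ContMDiffVectorBundle ∞ F E I]

variable (E) in
/-- The dual bundle `E*`. -/
abbrev Dual (x : M) : Type _ := E x →L[ℝ] ℝ

variable (F E) in
/-- The total space of the dual bundle `E*`. -/
abbrev DualSpace : Type _ := TotalSpace (F →L[ℝ] ℝ) (Dual E)

variable (I F) in
/-- The model of the manifold `E*`. -/
abbrev dualModel : ModelWithCorners ℝ (EM × (F →L[ℝ] ℝ)) (ModelProd HM (F →L[ℝ] ℝ)) :=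
  I.prod 𝓘(ℝ, F →L[ℝ] ℝ)


/-- prol -/
abbrev CoProl (A : AlgebroidData I F E) : DualSpace F E → Type _ := Prol (F →L[ℝ] ℝ) (Dual E) A

/-- prol -/
abbrev coProlong (A : AlgebroidData I F E) :
    AlgebroidData (dualModel I F) (F × (F →L[ℝ] ℝ)) (CoProl A) :=
  prolong (F →L[ℝ] ℝ) (Dual E) A

/-- The Liouville section `λ_E` of the dual of `L^{τ*} E`: `λ_E(p)(b, v) = p(b)`. -/
def liouville (A : AlgebroidData I F E) (p : DualSpace F E) : CoProl A p →L[ℝ] ℝ :=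
  p.2 ∘L ContinuousLinearMap.fst ℝ _ _ ∘L
    (prolFiber (dualModel I F) A (π (F →L[ℝ] ℝ) (Dual E)) p).subtypeL

/-- The canonical symplectic section `Ω_E = -dλ_E`. -/
def canonicalSection (A : AlgebroidData I F E) (p : DualSpace F E) (u v : CoProl A p) : ℝ :=
  -d1 (coProlong A) (liouville A) p u v

/-- `ξ` is the Hamiltonian section of `H`: `i_ξ Ω_E = dH`, where `dH(w) = ρ(w)(H)`. -/
def IsHamiltonianSection (A : AlgebroidData I F E) (H : DualSpace F E → ℝ)
    (ξ : ∀ p, CoProl A p) : Prop :=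
  ∀ p (w : CoProl A p), canonicalSection A p (ξ p) w =
    dirDeriv (dualModel I F) H p ((coProlong A).anchor p w)

variable (I F E) in
/-- Local coordinates on `M` and a local frame of `E` with its dual coframe, over an open set `dom`.
(The frame consists of restrictions to `dom` of global smooth sections.) -/
structure LocalCoords where
  chart : OpenPartialHomeomorph M HM
  chart_mem : chart ∈ IsManifold.maximalAtlas I ∞ M
  rank : ℕ
  dom : Set M
  isOpen_dom : IsOpen dom
  dom_subset : dom ⊆ chart.source
  frame : Fin rank → ∀ x, E x
  smooth_frame : ∀ α, SmoothSection I F (frame α)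
  coframe : Fin rank → ∀ x, Dual E x
  coframe_frame : ∀ α β, ∀ x ∈ dom, coframe α x (frame β x) = if α = β then 1 else 0
  sum_coframe : ∀ x ∈ dom, ∀ v : E x, ∑ α, coframe α x v • frame α x = v

namespace LocalCoords

variable (φ : LocalCoords I F E)

/-- The coordinates `x^i`. -/
def baseCoord (p : DualSpace F E) : EM := φ.chart.extend I p.proj

/-- The coordinates `y_α`. -/
def fiberCoord (p : DualSpace F E) (α : Fin φ.rank) : ℝ := p.2 (φ.frame α p.proj)

/-- The point of `E*` with coordinates `(x^i, y_α)`. -/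
def point (x : EM) (y : Fin φ.rank → ℝ) : DualSpace F E :=
  ⟨(φ.chart.extend I).symm x, ∑ α, y α • φ.coframe α ((φ.chart.extend I).symm x)⟩

/-- The vector `(ρ_α^i)_i` of components of the anchor. -/
def anchorComp (A : AlgebroidData I F E) (α : Fin φ.rank) (x : M) : EM :=
  mfderiv I 𝓘(ℝ, EM) (φ.chart.extend I) x (A.anchor x (φ.frame α x))

/-- The structure functions `C_{αβ}^γ`. -/
def structureFun (A : AlgebroidData I F E) (α β γ : Fin φ.rank) (x : M) : ℝ :=
  φ.coframe γ x (A.bracket (φ.frame α) (φ.frame β) x)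

/-- `∂H/∂y_β`. -/
def partialFiber (H : DualSpace F E → ℝ) (p : DualSpace F E) (β : Fin φ.rank) : ℝ :=
  deriv (fun t => H (φ.point (φ.baseCoord p) (Function.update (φ.fiberCoord p) β t)))
    (φ.fiberCoord p β)

/-- `e^i ∂H/∂x^i`. -/
def partialBase (H : DualSpace F E → ℝ) (p : DualSpace F E) (e : EM) : ℝ :=
  fderiv ℝ (fun x => H (φ.point x (φ.fiberCoord p))) (φ.baseCoord p) e

end LocalCoords

/-- The curve `c` is a solution of the Hamilton equations for `H`, that is, in all local coordinates
`dx^i/dt = ρ_β^i ∂H/∂y_β` and `dy_α/dt = -(C_{αβ}^γ y_γ ∂H/∂y_β + ρ_α^i ∂H/∂x^i)`. -/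
def IsHamiltonSolution (A : AlgebroidData I F E) (H : DualSpace F E → ℝ)
    {J : TopologicalSpace.Opens ℝ} (c : J → DualSpace F E) : Prop :=
  ContMDiff 𝓘(ℝ, ℝ) (dualModel I F) ∞ c ∧
  ∀ (φ : LocalCoords I F E) (t : J), (c t).proj ∈ φ.dom →
    dirDeriv 𝓘(ℝ, ℝ) (fun s => φ.baseCoord (c s)) t (1 : ℝ) =
      ∑ β, φ.partialFiber H (c t) β • φ.anchorComp A β (c t).proj ∧
    ∀ α, dirDeriv 𝓘(ℝ, ℝ) (fun s => φ.fiberCoord (c s) α) t (1 : ℝ) =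
      -(∑ β, ∑ γ, φ.structureFun A α β γ (c t).proj * φ.fiberCoord (c t) γ *
          φ.partialFiber H (c t) β +
        φ.partialBase H (c t) (φ.anchorComp A α (c t).proj))

/-- The curve `γ = (γ₁, γ₂)` in `L^{τ*} E ⊆ E × TE*` is admissible: `γ₂` is the velocity of the curve
that it projects to in `E*`. -/
def IsAdmissible (A : AlgebroidData I F E) {J : TopologicalSpace.Opens ℝ}
    (γ : J → TotalSpace (F × (F →L[ℝ] ℝ)) (CoProl A)) : Prop :=
  ContMDiff 𝓘(ℝ, ℝ) ((dualModel I F).prod 𝓘(ℝ, F × (F →L[ℝ] ℝ))) ∞ γ ∧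
  ∀ t, (coProlong A).anchor (γ t).proj (γ t).2 =
    mfderiv 𝓘(ℝ, ℝ) (dualModel I F) (fun s => (γ s).proj) t (1 : ℝ)

/-- A section `ξ` of `L^{τ*} E` as a map into the total space. For the Hamiltonian section `ξ` of `H`
its range is the submanifold `S_H`. -/
def sectionMap {A : AlgebroidData I F E} (ξ : ∀ p, CoProl A p) (p : DualSpace F E) :
    TotalSpace (F × (F →L[ℝ] ℝ)) (CoProl A) :=
  ⟨p, ξ p⟩

end Hamilton

end LieAlgebroid

end

open LieAlgebroid

/-!
The whole argument rests on two general facts about a skew-symmetric bracket that satisfies the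
Leibniz rule. An operation on smooth sections that is linear over the smooth functions at a point
depends only on the value of the section at that point (`eq_of_tensorial`, proved with cut-off
functions). And the bracket at a point is determined by the brackets of the sections with constant
coordinates in a trivialization (`IsSkewAlgebroid.bracket_eq`). So every identity needs to be checked
only for convenient sections through given vectors. In the presence of the Jacobi identity the anchor
is a homomorphism (`IsLieAlgebroid.anchorDeriv_bracket`), because the Jacobiator fails to be tensorial
exactly by the defect of the anchor.

*The prolongation.* Convenient sections of the prolongation are those that project to a section of
`E`, and there is one through each vector. On these the bracket projects to the bracket of `E` and to
the Lie bracket of vector fields. The pair of the two brackets lies in the prolongation because the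
anchor of `E` is a homomorphism (`IsLieAlgebroid.prolBracket_mem`). The anchor of the prolongation is
a homomorphism by construction, so its Jacobiator is tensorial, and it vanishes on projectable
sections (`IsLieAlgebroid.jacobiator_prolong`).

*The canonical section.* It is exact, hence closed (`IsLieAlgebroid.neg_d1_closed`). With sections
`X`, `Y` of `E` through the first components of `u = (b, v)` and `w = (b', v')`, its value at `p` is
`v'(X) - v(Y) + p(⟦X, Y⟧)`, where tangent vectors to `E*` act on the fibrewise linear functions of
sections (`IsLieAlgebroid.canonicalSection_apply`). Vertical vectors detect the first component, and
the remaining vectors detect the vertical ones, so it is nondegenerate. The Hamiltonian section is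
then unique, and it is smooth because the inverse of a smooth invertible matrix is smooth
(`IsTwoSection.existsUnique_smooth_of_nondegenerate`).

*The Lagrangian submanifold.* This holds for the Hamiltonian section `ξ` of a function `H` on any
symplectic Lie algebroid. The complete lift of `Ω` is given by an explicit formula (`completeLift`),
whose value at the vectors `(b, Tξ(ρ(b)))` and `(b', Tξ(ρ(b')))` tangent to the image of `ξ` is
`ρ(ξ)(Ω(X, Y)) + Ω(⟦X, ξ⟧, Y) + Ω(X, ⟦Y, ξ⟧)` for sections `X`, `Y` through `b` and `b'`. As `Ω` is
closed and `Ω(ξ, ·)` is the differential of `H`, this is the defect of the anchor to be a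
homomorphism, evaluated on `H`, and so it vanishes. The graph of `b ↦ Tξ(ρ(b))` has half the
dimension of the fibre (`IsLieAlgebroid.isLagrangianSubmanifold`).

*The Hamilton equations.* Pairing `ξ` with the vertical vectors shows that its first component has
the coordinates `∂H/∂y_β`, and its second component projects to `ρ` of the first; this is the first
equation. Pairing it with the vectors over the frame that have vanishing fibre coordinates gives the
second one. Thus the solutions are the integral curves of the second component of `ξ`
(`IsLieAlgebroid.isHamiltonSolution_iff`), and for a curve `ξ ∘ c` this is admissibility. The
projection to `E*` is inverse to composition with `ξ`.
-/


noncomputable section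

namespace LieAlgebroid

/-! ### Directional derivatives -/

section DirDeriv

variable {EM : Type*} [NormedAddCommGroup EM] [NormedSpace ℝ EM]
  {HM : Type*} [TopologicalSpace HM] {I : ModelWithCorners ℝ EM HM}
  {M : Type*} [TopologicalSpace M] [ChartedSpace HM M]
  {EN : Type*} [NormedAddCommGroup EN] [NormedSpace ℝ EN]
  {HN : Type*} [TopologicalSpace HN] {J : ModelWithCorners ℝ EN HN}
  {N : Type*} [TopologicalSpace N] [ChartedSpace HN N]
  {W W' W'' : Type*} [NormedAddCommGroup W] [NormedSpace ℝ W]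
  [NormedAddCommGroup W'] [NormedSpace ℝ W'] [NormedAddCommGroup W''] [NormedSpace ℝ W'']

theorem dirDeriv_congr {f g : M → W} {x : M} (h : f =ᶠ[𝓝 x] g) (v : TangentSpace I x) :
    dirDeriv I f x v = dirDeriv I g x v := by
  unfold dirDeriv
  rw [h.mfderiv_eq]
  rfl

theorem dirDeriv_vec_add (f : M → W) (x : M) (v w : TangentSpace I x) :
    dirDeriv I f x (v + w) = dirDeriv I f x v + dirDeriv I f x w :=
  map_add (mfderiv I 𝓘(ℝ, W) f x) v w

theorem dirDeriv_vec_sub (f : M → W) (x : M) (v w : TangentSpace I x) :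
    dirDeriv I f x (v - w) = dirDeriv I f x v - dirDeriv I f x w :=
  map_sub (mfderiv I 𝓘(ℝ, W) f x) v w

theorem dirDeriv_vec_smul (f : M → W) (x : M) (c : ℝ) (v : TangentSpace I x) :
    dirDeriv I f x (c • v) = c • dirDeriv I f x v :=
  map_smul (mfderiv I 𝓘(ℝ, W) f x) c v

theorem dirDeriv_vec_zero (f : M → W) (x : M) :
    dirDeriv I f x (0 : TangentSpace I x) = 0 :=
  map_zero (mfderiv I 𝓘(ℝ, W) f x)

theorem dirDeriv_const (c : W) (x : M) (v : TangentSpace I x) :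
    dirDeriv I (fun _ => c) x v = 0 := by
  unfold dirDeriv
  rw [mfderiv_const]
  rfl

theorem dirDeriv_comp {f : N → W} {g : M → N} {x : M} (hf : MDifferentiableAt J 𝓘(ℝ, W) f (g x))
    (hg : MDifferentiableAt I J g x) (v : TangentSpace I x) :
    dirDeriv I (fun y => f (g y)) x v = dirDeriv J f (g x) (mfderiv I J g x v) :=
  mfderiv_comp_apply x hf hg v

theorem dirDeriv_bilin (B : W →L[ℝ] W' →L[ℝ] W'') {f : M → W} {g : M → W'} {x : M}
    (hf : MDifferentiableAt I 𝓘(ℝ, W) f x) (hg : MDifferentiableAt I 𝓘(ℝ, W') g x)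
    (v : TangentSpace I x) :
    dirDeriv I (fun y => B (f y) (g y)) x v =
      B (dirDeriv I f x v) (g x) + B (f x) (dirDeriv I g x v) := by
  have h1 : HasMFDerivAt I 𝓘(ℝ, W × W') (fun y => (f y, g y)) x
      ((mfderiv I 𝓘(ℝ, W) f x).prod (mfderiv I 𝓘(ℝ, W') g x)) :=
    ⟨hf.hasMFDerivAt.1.prodMk hg.hasMFDerivAt.1, hf.hasMFDerivAt.2.prodMk hg.hasMFDerivAt.2⟩
  have h2 : HasFDerivAt (fun p : W × W' => B p.1 p.2) _ (f x, g x) :=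
    B.isBoundedBilinearMap.hasFDerivAt (f x, g x)
  have h3 := (h2.hasMFDerivAt.comp x h1).mfderiv
  have h4 := congrArg (fun L : EM →L[ℝ] W'' => L v) h3
  refine h4.trans ?_
  exact add_comm _ _

theorem dirDeriv_clm (L : W →L[ℝ] W') {f : M → W} {x : M}
    (hf : MDifferentiableAt I 𝓘(ℝ, W) f x) (v : TangentSpace I x) :
    dirDeriv I (fun y => L (f y)) x v = L (dirDeriv I f x v) := by
  have := (L.hasFDerivAt.hasMFDerivAt.comp x hf.hasMFDerivAt).mfderiv
  exact congrArg (fun L : EM →L[ℝ] W' => L v) this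

theorem dirDeriv_add {f g : M → W} {x : M}
    (hf : MDifferentiableAt I 𝓘(ℝ, W) f x) (hg : MDifferentiableAt I 𝓘(ℝ, W) g x)
    (v : TangentSpace I x) :
    dirDeriv I (fun y => f y + g y) x v = dirDeriv I f x v + dirDeriv I g x v := by
  have := (hf.hasMFDerivAt.add hg.hasMFDerivAt).mfderiv
  exact congrArg (fun L : EM →L[ℝ] W => L v) this

theorem dirDeriv_neg {f : M → W} {x : M} (v : TangentSpace I x)
    (hf : MDifferentiableAt I 𝓘(ℝ, W) f x) :
    dirDeriv I (fun y => -f y) x v = -dirDeriv I f x v := by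
  have := hf.hasMFDerivAt.neg.mfderiv
  exact congrArg (fun L : EM →L[ℝ] W => L v) this

theorem dirDeriv_sub {f g : M → W} {x : M}
    (hf : MDifferentiableAt I 𝓘(ℝ, W) f x) (hg : MDifferentiableAt I 𝓘(ℝ, W) g x)
    (v : TangentSpace I x) :
    dirDeriv I (fun y => f y - g y) x v = dirDeriv I f x v - dirDeriv I g x v := by
  have := (hf.hasMFDerivAt.sub hg.hasMFDerivAt).mfderiv
  exact congrArg (fun L : EM →L[ℝ] W => L v) this

theorem dirDeriv_smul {f : M → ℝ} {g : M → W} {x : M}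
    (hf : MDifferentiableAt I 𝓘(ℝ, ℝ) f x) (hg : MDifferentiableAt I 𝓘(ℝ, W) g x)
    (v : TangentSpace I x) :
    dirDeriv I (fun y => f y • g y) x v =
      f x • dirDeriv I g x v + dirDeriv I f x v • g x := by
  rw [add_comm]
  exact dirDeriv_bilin (ContinuousLinearMap.lsmul ℝ ℝ) hf hg v

theorem dirDeriv_mul {f g : M → ℝ} {x : M}
    (hf : MDifferentiableAt I 𝓘(ℝ, ℝ) f x) (hg : MDifferentiableAt I 𝓘(ℝ, ℝ) g x)
    (v : TangentSpace I x) :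
    dirDeriv I (fun y => f y * g y) x v =
      f x * dirDeriv I g x v + dirDeriv I f x v * g x :=
  dirDeriv_smul hf hg v

end DirDeriv

/-! ### Smooth sections, cut-offs and tensoriality -/

section Sections

variable {EM : Type*} [NormedAddCommGroup EM] [NormedSpace ℝ EM]
  {HM : Type*} [TopologicalSpace HM] {I : ModelWithCorners ℝ EM HM}
  {M : Type*} [TopologicalSpace M] [ChartedSpace HM M] [IsManifold I ∞ M]
  {F : Type*} [NormedAddCommGroup F] [NormedSpace ℝ F]
  {E : M → Type*} [TopologicalSpace (TotalSpace F E)] [∀ x, TopologicalSpace (E x)]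
  [∀ x, AddCommGroup (E x)] [∀ x, Module ℝ (E x)]
  [FiberBundle F E] [VectorBundle ℝ F E]

theorem SmoothSection.add {X Y : ∀ x, E x} (hX : SmoothSection I F X) (hY : SmoothSection I F Y) :
    SmoothSection I F (X + Y) := ContMDiff.add_section hX hY

theorem SmoothSection.neg {X : ∀ x, E x} (hX : SmoothSection I F X) :
    SmoothSection I F (-X) := ContMDiff.neg_section hX

theorem SmoothSection.sub {X Y : ∀ x, E x} (hX : SmoothSection I F X) (hY : SmoothSection I F Y) :
    SmoothSection I F (X - Y) := ContMDiff.sub_section hX hY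

theorem SmoothSection.smul {f : M → ℝ} {X : ∀ x, E x} (hf : ContMDiff I 𝓘(ℝ, ℝ) ∞ f)
    (hX : SmoothSection I F X) : SmoothSection I F (fun x => f x • X x) :=
  ContMDiff.smul_section hf hX

theorem SmoothSection.const_smul (c : ℝ) {X : ∀ x, E x}
    (hX : SmoothSection I F X) : SmoothSection I F (c • X) :=
  ContMDiff.const_smul_section hX

theorem smoothSection_zero : SmoothSection I F (0 : ∀ x, E x) := contMDiff_zeroSection ℝ E

/-- The coordinates of a section in the trivialization of the bundle at `x`. -/
def coordAt (F : Type*) [NormedAddCommGroup F] [NormedSpace ℝ F]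
    {E : M → Type*} [TopologicalSpace (TotalSpace F E)] [∀ x, TopologicalSpace (E x)]
    [∀ x, AddCommGroup (E x)] [∀ x, Module ℝ (E x)]
    [FiberBundle F E] [VectorBundle ℝ F E] (x : M) (X : ∀ y, E y) (y : M) : F :=
  (trivializationAt F E x ⟨y, X y⟩).2

theorem coordAt_eq_continuousLinearMapAt {x y : M} (X : ∀ y, E y)
    (hy : y ∈ (trivializationAt F E x).baseSet) :
    coordAt F x X y = (trivializationAt F E x).continuousLinearMapAt ℝ y (X y) := by
  rw [Trivialization.continuousLinearMapAt_apply, Trivialization.coe_linearMapAt_of_mem _ hy]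
  rfl

theorem symm_coordAt {x y : M} (X : ∀ y, E y) (hy : y ∈ (trivializationAt F E x).baseSet) :
    (trivializationAt F E x).symm y (coordAt F x X y) = X y := by
  rw [coordAt_eq_continuousLinearMapAt X hy, ← Trivialization.symmL_apply (R := ℝ) _ hy]
  exact Trivialization.symmL_continuousLinearMapAt _ hy _

theorem contMDiffAt_coordAt [ContMDiffVectorBundle ∞ F E I] {x y : M} {X : ∀ y, E y}
    (hX : ContMDiffAt I (I.prod 𝓘(ℝ, F)) ∞ (fun y => TotalSpace.mk' F y (X y)) y)
    (hy : y ∈ (trivializationAt F E x).baseSet) :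
    ContMDiffAt I 𝓘(ℝ, F) ∞ (coordAt F x X) y :=
  ((trivializationAt F E x).contMDiffAt_section_iff hy).1 hX

theorem contMDiffAt_of_coordAt [ContMDiffVectorBundle ∞ F E I] {x y : M} {X : ∀ y, E y}
    (hy : y ∈ (trivializationAt F E x).baseSet)
    (hX : ContMDiffAt I 𝓘(ℝ, F) ∞ (coordAt F x X) y) :
    ContMDiffAt I (I.prod 𝓘(ℝ, F)) ∞ (fun y => TotalSpace.mk' F y (X y)) y :=
  ((trivializationAt F E x).contMDiffAt_section_iff hy).2 hX

theorem SmoothSection.mdifferentiableAt_coordAt [ContMDiffVectorBundle ∞ F E I] {X : ∀ y, E y}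
    (hX : SmoothSection I F X) {x y : M} (hy : y ∈ (trivializationAt F E x).baseSet) :
    MDifferentiableAt I 𝓘(ℝ, F) (coordAt F x X) y :=
  (contMDiffAt_coordAt (hX y) hy).mdifferentiableAt (by simp)

theorem coordAt_add {x y : M} (X Y : ∀ y, E y) (hy : y ∈ (trivializationAt F E x).baseSet) :
    coordAt F x (X + Y) y = coordAt F x X y + coordAt F x Y y := by
  simp only [coordAt_eq_continuousLinearMapAt _ hy, Pi.add_apply, map_add]

theorem coordAt_smul {x y : M} (f : M → ℝ) (X : ∀ y, E y)
    (hy : y ∈ (trivializationAt F E x).baseSet) :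
    coordAt F x (fun y => f y • X y) y = f y • coordAt F x X y := by
  simp only [coordAt_eq_continuousLinearMapAt _ hy, map_smul]

theorem baseSet_mem_nhds (x : M) : (trivializationAt F E x).baseSet ∈ 𝓝 x :=
  (trivializationAt F E x).open_baseSet.mem_nhds (FiberBundle.mem_baseSet_trivializationAt F E x)

variable [FiniteDimensional ℝ EM] [I.Boundaryless] [T2Space M]

theorem exists_cutoff {x : M} {U : Set M} (hU : U ∈ 𝓝 x) :
    ∃ χ : M → ℝ, ContMDiff I 𝓘(ℝ, ℝ) ∞ χ ∧ χ =ᶠ[𝓝 x] 1 ∧ tsupport χ ⊆ U := by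
  obtain ⟨f, -, hf⟩ := (SmoothBumpFunction.nhds_basis_tsupport (I := I) x).mem_iff.1 hU
  exact ⟨f, f.contMDiff, f.eventuallyEq_one, hf⟩

theorem exists_smooth_eventuallyEq {W : Type*} [NormedAddCommGroup W] [NormedSpace ℝ W]
    {x : M} {U : Set M} (hU : IsOpen U) (hx : x ∈ U) {f : M → W}
    (hf : ContMDiffOn I 𝓘(ℝ, W) ∞ f U) :
    ∃ g : M → W, ContMDiff I 𝓘(ℝ, W) ∞ g ∧ g =ᶠ[𝓝 x] f := by
  obtain ⟨χ, hχ, h1, h2⟩ := exists_cutoff (I := I) (hU.mem_nhds hx)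
  refine ⟨fun y => χ y • f y, ?_, ?_⟩
  · refine contMDiff_of_tsupport fun y hy => ?_
    have hy' : y ∈ U := h2 (tsupport_smul_subset_left _ _ hy)
    exact (hχ y).smul ((hf y hy').contMDiffAt (hU.mem_nhds hy'))
  · filter_upwards [h1] with y hy
    simp [hy]

variable [ContMDiffVectorBundle ∞ F E I]

theorem exists_smoothSection_eventuallyEq
    {x : M} {U : Set M} (hU : IsOpen U) (hx : x ∈ U) {X : ∀ y, E y}
    (hX : ContMDiffOn I (I.prod 𝓘(ℝ, F)) ∞ (fun y => TotalSpace.mk' F y (X y)) U) :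
    ∃ Y : ∀ y, E y, SmoothSection I F Y ∧ ∀ᶠ y in 𝓝 x, Y y = X y := by
  obtain ⟨χ, hχ, h1, h2⟩ := exists_cutoff (I := I) (hU.mem_nhds hx)
  refine ⟨fun y => χ y • X y, ContMDiffOn.smul_section_of_tsupport hχ.contMDiffOn hU h2 hX, ?_⟩
  filter_upwards [h1] with y hy
  simp [hy]

theorem contMDiffOn_extend {x : M} (u : E x) :
    ContMDiffOn I (I.prod 𝓘(ℝ, F)) ∞
      (fun y => TotalSpace.mk' F y (FiberBundle.extend F u y)) (trivializationAt F E x).baseSet := by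
  rw [(trivializationAt F E x).contMDiffOn_section_baseSet_iff]
  refine (contMDiffOn_const (c := (trivializationAt F E x ⟨x, u⟩).2)).congr fun y hy => ?_
  have h := congrArg Prod.snd ((trivializationAt F E x).apply_mk_symm hy
    (trivializationAt F E x ⟨x, u⟩).2)
  exact h

/-- The defining property of `localExt`: such a section exists by cutting off the section with
constant coordinates, so the choice made in the definition is not a junk value. -/
theorem localExt_spec {x : M} (u : E x) :
    SmoothSection I F (localExt I F u) ∧
      ∀ᶠ y in 𝓝 x, localExt I F u y = FiberBundle.extend F u y :=
  Classical.epsilon_spec (exists_smoothSection_eventuallyEq (trivializationAt F E x).open_baseSet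
    (FiberBundle.mem_baseSet_trivializationAt F E x) (contMDiffOn_extend u))

theorem smooth_localExt {x : M} (u : E x) : SmoothSection I F (localExt I F u) :=
  (localExt_spec u).1

theorem localExt_self {x : M} (u : E x) : localExt I F u x = u := by
  rw [(localExt_spec (I := I) (F := F) u).2.self_of_nhds, FiberBundle.extend_apply_self]

theorem coordAt_localExt {x : M} (u : E x) :
    ∀ᶠ y in 𝓝 x, coordAt F x (localExt I F u) y = (trivializationAt F E x ⟨x, u⟩).2 := by
  filter_upwards [(localExt_spec (I := I) (F := F) u).2, baseSet_mem_nhds (F := F) (E := E) x]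
    with y hy hy'
  unfold coordAt
  rw [hy]
  have h := congrArg Prod.snd ((trivializationAt F E x).apply_mk_symm hy'
    (trivializationAt F E x ⟨x, u⟩).2)
  exact h

theorem dirDeriv_coordAt_localExt {x : M} (u : E x) (v : TangentSpace I x) :
    dirDeriv I (coordAt F x (localExt I F u)) x v = 0 := by
  rw [dirDeriv_congr (coordAt_localExt u), dirDeriv_const]

theorem localExt_add {x : M} (u v : E x) :
    ∀ᶠ y in 𝓝 x, localExt I F (u + v) y = localExt I F u y + localExt I F v y := by
  filter_upwards [coordAt_localExt (I := I) (F := F) u, coordAt_localExt (I := I) (F := F) v,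
    coordAt_localExt (I := I) (F := F) (u + v), baseSet_mem_nhds (F := F) (E := E) x]
    with y h1 h2 h3 hy
  have hx := FiberBundle.mem_baseSet_trivializationAt F E x
  have e : (trivializationAt F E x ⟨x, u + v⟩).2 =
    (trivializationAt F E x ⟨x, u⟩).2 + (trivializationAt F E x ⟨x, v⟩).2 :=
    ((trivializationAt F E x).linear ℝ hx).map_add u v
  rw [← symm_coordAt (localExt I F (u + v)) hy, h3, e, ← h1, ← h2,
    ← coordAt_add _ _ hy, symm_coordAt _ hy]
  rfl

theorem localExt_smul {x : M} (c : ℝ) (u : E x) :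
    ∀ᶠ y in 𝓝 x, localExt I F (c • u) y = c • localExt I F u y := by
  filter_upwards [coordAt_localExt (I := I) (F := F) u,
    coordAt_localExt (I := I) (F := F) (c • u), baseSet_mem_nhds (F := F) (E := E) x]
    with y h1 h3 hy
  have hx := FiberBundle.mem_baseSet_trivializationAt F E x
  have e : (trivializationAt F E x ⟨x, c • u⟩).2 =
    c • (trivializationAt F E x ⟨x, u⟩).2 :=
    ((trivializationAt F E x).linear ℝ hx).map_smul c u
  rw [← symm_coordAt (localExt I F (c • u)) hy, h3, e, ← h1,
    ← coordAt_smul (fun _ => c) _ hy, symm_coordAt _ hy]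

/-- Near `x`, a smooth section is a combination, with globally defined smooth coefficients, of the
sections with constant coordinates in the trivialization at `x`. -/
theorem exists_eventually_eq_sum [FiniteDimensional ℝ F] {X : ∀ y, E y} (hX : SmoothSection I F X)
    (x : M) :
    ∃ (f : Fin (Module.finrank ℝ F) → M → ℝ) (u : Fin (Module.finrank ℝ F) → E x),
      (∀ i, ContMDiff I 𝓘(ℝ, ℝ) ∞ (f i)) ∧
      (∀ᶠ y in 𝓝 x, X y = ∑ i, f i y • localExt I F (u i) y) ∧
      (X x = 0 → ∀ i, f i x = 0) := by
  let b := Module.finBasis ℝ F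
  have hx := FiberBundle.mem_baseSet_trivializationAt F E x
  have h1 : ∀ i, ∃ g : M → ℝ, ContMDiff I 𝓘(ℝ, ℝ) ∞ g ∧
      g =ᶠ[𝓝 x] fun y => b.coord i (coordAt F x X y) := fun i => by
    refine exists_smooth_eventuallyEq (trivializationAt F E x).open_baseSet hx fun y hy => ?_
    have : ContDiff ℝ ∞ (b.coord i : F → ℝ) :=
      (LinearMap.toContinuousLinearMap (b.coord i)).contDiff
    exact (this.contMDiff.contMDiffAt.comp y (contMDiffAt_coordAt (hX y) hy)).contMDiffWithinAt
  choose f hf hf' using h1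
  refine ⟨f, fun i => (trivializationAt F E x).symm x (b i), hf, ?_, ?_⟩
  · have h2 : ∀ᶠ y in 𝓝 x, ∀ i, f i y = b.coord i (coordAt F x X y) :=
      Filter.eventually_all.2 hf'
    have h3 : ∀ᶠ y in 𝓝 x, ∀ i, coordAt F x
        (localExt I F ((trivializationAt F E x).symm x (b i))) y = b i := by
      refine Filter.eventually_all.2 fun i => ?_
      filter_upwards [coordAt_localExt (I := I) (F := F)
        ((trivializationAt F E x).symm x (b i))] with y hy
      rw [hy]
      exact congrArg Prod.snd (Trivialization.apply_mk_symm _ hx _)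
    filter_upwards [h2, h3, baseSet_mem_nhds (F := F) (E := E) x] with y h2 h3 hy
    conv_lhs => rw [← symm_coordAt X hy, ← b.sum_repr (coordAt F x X y)]
    rw [← Trivialization.symmL_apply (R := ℝ) _ hy, map_sum]
    refine Finset.sum_congr rfl fun i _ => ?_
    rw [map_smul, h2, ← symm_coordAt (localExt I F _) hy, h3,
      ← Trivialization.symmL_apply (R := ℝ) _ hy]
    rfl
  · intro h0 i
    refine (hf' i).self_of_nhds.trans ?_
    simp only [coordAt_eq_continuousLinearMapAt _ hx, h0, map_zero]

/-- An additive operation on smooth sections that is homogeneous with respect to multiplication by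
smooth functions, up to evaluation at `x`, depends only on the value of the section at `x`. -/
theorem eq_of_tensorial [FiniteDimensional ℝ F] {W : Type*} [AddCommGroup W] [Module ℝ W]
    {x : M} {Φ : (∀ y, E y) → W}
    (hadd : ∀ X Y, SmoothSection I F X → SmoothSection I F Y → Φ (X + Y) = Φ X + Φ Y)
    (hsmul : ∀ (f : M → ℝ) X, ContMDiff I 𝓘(ℝ, ℝ) ∞ f → SmoothSection I F X →
      Φ (fun y => f y • X y) = f x • Φ X)
    {X Y : ∀ y, E y} (hX : SmoothSection I F X) (hY : SmoothSection I F Y) (h : X x = Y x) :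
    Φ X = Φ Y := by
  have h0 : Φ 0 = 0 := by
    have := hsmul (fun _ => 0) 0 contMDiff_const smoothSection_zero
    simpa using! this
  -- by additivity it suffices to treat sections vanishing at `x`; near `x` these are combinations of
  -- global smooth sections with coefficients vanishing at `x`
  have key : ∀ Z, SmoothSection I F Z → Z x = 0 → Φ Z = 0 := by
    intro Z hZ hZx
    obtain ⟨f, u, hf, hfu, hf0⟩ := exists_eventually_eq_sum hZ x
    obtain ⟨χ, hχ, h1, h2⟩ := exists_cutoff (I := I) hfu
    have hs : ∀ s : Finset (Fin (Module.finrank ℝ F)),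
        SmoothSection I F (fun y => ∑ i ∈ s, f i y • localExt I F (u i) y) ∧
        Φ (fun y => ∑ i ∈ s, f i y • localExt I F (u i) y) = 0 := by
      classical
      intro s
      induction s using Finset.induction_on with
      | empty => exact ⟨by simpa using! smoothSection_zero, by simpa using! h0⟩
      | insert a s ha ih =>
        have hsa : SmoothSection I F (fun y => f a y • localExt I F (u a) y) :=
          (smooth_localExt _).smul (hf a)
        simp only [Finset.sum_insert ha]
        refine ⟨hsa.add ih.1, (hadd _ _ hsa ih.1).trans ?_⟩
        rw [ih.2, hsmul _ _ (hf a) (smooth_localExt _), hf0 hZx a, zero_smul, add_zero]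
    have hs := hs Finset.univ
    set S : ∀ y, E y := fun y => ∑ i, f i y • localExt I F (u i) y with hS
    -- multiplied by the cut-off `χ`, the local identity `Z = S` holds everywhere, and `χ x = 1`
    have e1 : (fun y => χ y • Z y) = fun y => χ y • S y := by
      ext y
      by_cases hy : y ∈ tsupport χ
      · have : Z y = S y := h2 hy
        rw [this]
      · rw [image_eq_zero_of_notMem_tsupport hy, zero_smul, zero_smul]
    have e2 := hsmul χ Z hχ hZ
    rw [e1, hsmul χ S hχ hs.1, hs.2, h1.self_of_nhds] at e2
    simpa using e2.symm
  have h3 := hadd (X - Y) Y (hX.sub hY) hY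
  rw [sub_add_cancel, key _ (hX.sub hY) (by simp [h]), zero_add] at h3
  exact h3

end Sections

/-! ### Vector fields as derivations -/

section VectorFields

variable {EM : Type*} [NormedAddCommGroup EM] [NormedSpace ℝ EM]
  {HM : Type*} [TopologicalSpace HM] {I : ModelWithCorners ℝ EM HM}
  {M : Type*} [TopologicalSpace M] [ChartedSpace HM M] [IsManifold I ∞ M]
  {W : Type*} [NormedAddCommGroup W] [NormedSpace ℝ W]

theorem contMDiff_dirDeriv {f : M → W} (hf : ContMDiff I 𝓘(ℝ, W) ∞ f)
    {V : ∀ x : M, TangentSpace I x} (hV : SmoothSection I EM V) :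
    ContMDiff I 𝓘(ℝ, W) ∞ (fun x => dirDeriv I f x (V x)) :=
  (contMDiff_snd_tangentBundle_modelSpace W 𝓘(ℝ, W)).comp
    ((hf.contMDiff_tangentMap (m := ∞) le_rfl).comp hV)

theorem dirDeriv_mfderiv_extChartAt_inverse {f : M → W} {x y : M}
    (hy : y ∈ (extChartAt I x).source) [I.Boundaryless]
    (hf : MDifferentiableAt I 𝓘(ℝ, W) f y) (w : EM) :
    dirDeriv I f y ((mfderiv I 𝓘(ℝ, EM) (extChartAt I x) y).inverse w) =
      fderiv ℝ (f ∘ (extChartAt I x).symm) (extChartAt I x y) w := by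
  have hy' : y ∈ (chartAt HM x).source := by rwa [extChartAt_source] at hy
  have h1 : MDifferentiableAt I 𝓘(ℝ, EM) (extChartAt I x) y := mdifferentiableAt_extChartAt hy'
  have h0 : (extChartAt I x).symm (extChartAt I x y) = y := (extChartAt I x).left_inv hy
  have ht : extChartAt I x y ∈ (extChartAt I x).target := (extChartAt I x).map_source hy
  have h2 : MDifferentiableAt 𝓘(ℝ, EM) I (extChartAt I x).symm (extChartAt I x y) :=
    ((contMDiffOn_extChartAt_symm (n := ∞) x).contMDiffAt
      ((isOpen_extChartAt_target x).mem_nhds ht)).mdifferentiableAt (by simp)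
  have h3 : MDifferentiableAt 𝓘(ℝ, EM) 𝓘(ℝ, W) (f ∘ (extChartAt I x).symm) (extChartAt I x y) := by
    refine MDifferentiableAt.comp _ (I' := I) ?_ h2
    rwa [h0]
  have h4 : f =ᶠ[𝓝 y] fun z => (f ∘ (extChartAt I x).symm) (extChartAt I x z) := by
    filter_upwards [(isOpen_extChartAt_source (I := I) x).mem_nhds hy] with z hz
    exact (congrArg f ((extChartAt I x).left_inv hz)).symm
  rw [dirDeriv_congr h4, dirDeriv_comp (J := 𝓘(ℝ, EM)) h3 h1]
  have h5 := isInvertible_mfderiv_extChartAt hy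
  have h6 : mfderiv I 𝓘(ℝ, EM) (extChartAt I x) y
      ((mfderiv I 𝓘(ℝ, EM) (extChartAt I x) y).inverse w) = w := by
    obtain ⟨e, he⟩ := h5
    rw [← he, ContinuousLinearMap.inverse_equiv]
    exact e.apply_symm_apply w
  unfold dirDeriv
  erw [h6, mfderiv_eq_fderiv]
  rfl

/-- The Lie bracket of vector fields acts on functions as the commutator of derivations. -/
theorem dirDeriv_mlieBracket [FiniteDimensional ℝ EM] [I.Boundaryless] {f : M → ℝ}
    (hf : ContMDiff I 𝓘(ℝ, ℝ) ∞ f) {V V' : ∀ x : M, TangentSpace I x}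
    (hV : SmoothSection I EM V) (hV' : SmoothSection I EM V') (x : M) :
    dirDeriv I f x (VectorField.mlieBracket I V V' x) =
      dirDeriv I (fun y => dirDeriv I f y (V' y)) x (V x) -
        dirDeriv I (fun y => dirDeriv I f y (V y)) x (V' x) := by
  have : CompleteSpace EM := FiniteDimensional.complete ℝ EM
  set φ := extChartAt I x with hφ
  have hx : x ∈ φ.source := mem_extChartAt_source x
  let P : (∀ x : M, TangentSpace I x) → EM → EM := fun U =>
    VectorField.mpullbackWithin 𝓘(ℝ, EM) I φ.symm U (range I)
  have hP : ∀ U : ∀ x : M, TangentSpace I x, ∀ᶠ y in 𝓝 x,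
      U y = (mfderiv I 𝓘(ℝ, EM) φ y).inverse (P U (φ y)) := fun U => by
    have := VectorField.eventuallyEq_mpullback_mpullbackWithin_extChartAt (I := I) (s := univ)
      (x := x) U
    rwa [nhdsWithin_univ] at this
  have hdP : ∀ U : ∀ x : M, TangentSpace I x, SmoothSection I EM U →
      DifferentiableAt ℝ (P U) (φ x) := fun U hU => by
    have := MDifferentiableWithinAt.differentiableWithinAt_mpullbackWithin_vectorField
      (I := I) (s := univ) (x := x) (V := U)
      ((hU x).mdifferentiableAt (by simp)).mdifferentiableWithinAt
    simp only [preimage_univ, univ_inter] at this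
    change DifferentiableWithinAt ℝ (P U) (range I) (φ x) at this
    rwa [I.range_eq_univ, differentiableWithinAt_univ] at this
  have hft : ContDiffAt ℝ ∞ (f ∘ φ.symm) (φ x) := by
    have h1 : ContMDiffAt 𝓘(ℝ, EM) I ∞ φ.symm (φ x) :=
      (contMDiffOn_extChartAt_symm (n := ∞) x).contMDiffAt
        ((isOpen_extChartAt_target x).mem_nhds (mem_extChartAt_target x))
    exact ((hf _).comp _ h1).contDiffAt
  have hff : DifferentiableAt ℝ (fderiv ℝ (f ∘ φ.symm)) (φ x) :=
    (hft.fderiv_right (m := ∞) le_rfl).differentiableAt (by simp)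
  -- the iterated derivative, computed in the chart
  have key : ∀ U U' : ∀ x : M, TangentSpace I x, SmoothSection I EM U → SmoothSection I EM U' →
      dirDeriv I (fun y => dirDeriv I f y (U' y)) x (U x) =
        fderiv ℝ (fderiv ℝ (f ∘ φ.symm)) (φ x) (P U (φ x)) (P U' (φ x)) +
          fderiv ℝ (f ∘ φ.symm) (φ x) (fderiv ℝ (P U') (φ x) (P U (φ x))) := by
    intro U U' hU hU'
    have h1 : MDifferentiableAt I 𝓘(ℝ, ℝ) (fun y => dirDeriv I f y (U' y)) x :=
      (contMDiff_dirDeriv hf hU' x).mdifferentiableAt (by simp)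
    rw [(hP U).self_of_nhds, dirDeriv_mfderiv_extChartAt_inverse hx h1]
    have h2 : ∀ᶠ y in 𝓝 x, dirDeriv I f y (U' y) =
        fderiv ℝ (f ∘ φ.symm) (φ y) (P U' (φ y)) := by
      filter_upwards [hP U', (isOpen_extChartAt_source (I := I) x).mem_nhds hx] with y h3 hy
      rw [h3, dirDeriv_mfderiv_extChartAt_inverse hy ((hf y).mdifferentiableAt (by simp))]
    have h3 : (fun y => dirDeriv I f y (U' y)) ∘ φ.symm =ᶠ[𝓝 (φ x)]
        fun z => fderiv ℝ (f ∘ φ.symm) z (P U' z) := by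
      have h4 : Filter.Tendsto φ.symm (𝓝 (φ x)) (𝓝 x) := by
        have := continuousAt_extChartAt_symm (I := I) x
        rwa [ContinuousAt, extChartAt_to_inv] at this
      filter_upwards [h4.eventually h2,
        (isOpen_extChartAt_target (I := I) x).mem_nhds (mem_extChartAt_target x)] with z hz hz'
      have h5 : φ (φ.symm z) = z := φ.right_inv hz'
      rw [Function.comp_apply, hz, h5]
    rw [h3.fderiv_eq, fderiv_clm_apply hff (hdP U' hU')]
    simp [add_comm]
  rw [key V V' hV hV', key V' V hV' hV]
  have hs : fderiv ℝ (fderiv ℝ (f ∘ φ.symm)) (φ x) (P V (φ x)) (P V' (φ x)) =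
      fderiv ℝ (fderiv ℝ (f ∘ φ.symm)) (φ x) (P V' (φ x)) (P V (φ x)) :=
    hft.isSymmSndFDerivAt (by simpa using ENat.LEInfty.out) _ _
  have hb : VectorField.mlieBracket I V V' x = (mfderiv I 𝓘(ℝ, EM) φ x).inverse
      (fderiv ℝ (P V') (φ x) (P V (φ x)) - fderiv ℝ (P V) (φ x) (P V' (φ x))) := by
    rw [← VectorField.mlieBracketWithin_univ, VectorField.mlieBracketWithin_apply]
    simp only [preimage_univ, univ_inter]
    have hr : ∀ z : EM, VectorField.lieBracketWithin ℝ (P V) (P V') (range I) z =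
        fderiv ℝ (P V') z (P V z) - fderiv ℝ (P V) z (P V' z) := fun z => by
      rw [I.range_eq_univ, VectorField.lieBracketWithin_univ, VectorField.lieBracket_eq]
    exact congrArg (mfderiv I 𝓘(ℝ, EM) φ x).inverse (hr (φ x))
  rw [hb, dirDeriv_mfderiv_extChartAt_inverse hx ((hf x).mdifferentiableAt (by simp)), map_sub, hs]
  abel

/-- Tangent vectors are separated by the smooth functions. -/
theorem eq_zero_of_dirDeriv_eq_zero [FiniteDimensional ℝ EM] [I.Boundaryless] [T2Space M]
    {x : M} {v : TangentSpace I x}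
    (h : ∀ f : M → ℝ, ContMDiff I 𝓘(ℝ, ℝ) ∞ f → dirDeriv I f x v = 0) : v = 0 := by
  have h1 : ContMDiffOn I 𝓘(ℝ, EM) ∞ (extChartAt I x) (chartAt HM x).source :=
    contMDiffOn_extChartAt
  have hm : MDifferentiableAt I 𝓘(ℝ, EM) (extChartAt I x) x :=
    mdifferentiableAt_extChartAt (mem_chart_source HM x)
  have h2 : ∀ L : EM →L[ℝ] ℝ, L (dirDeriv I (extChartAt I x) x v) = 0 := fun L => by
    obtain ⟨g, hg, hg'⟩ := exists_smooth_eventuallyEq (I := I) (chartAt HM x).open_source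
      (mem_chart_source HM x) (L.contDiff.contMDiff.comp_contMDiffOn h1)
    rw [← dirDeriv_clm L hm, ← h g hg]
    exact dirDeriv_congr hg'.symm v
  have h3 : mfderiv I 𝓘(ℝ, EM) (extChartAt I x) x v = 0 :=
    SeparatingDual.eq_zero_of_forall_dual_eq_zero (R := ℝ) (V := EM) h2
  obtain ⟨e, he⟩ := isInvertible_mfderiv_extChartAt (I := I) (mem_extChartAt_source x)
  rw [← he] at h3
  exact e.map_eq_zero_iff.1 h3

theorem eq_of_dirDeriv_eq [FiniteDimensional ℝ EM] [I.Boundaryless] [T2Space M]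
    {x : M} {v w : TangentSpace I x}
    (h : ∀ f : M → ℝ, ContMDiff I 𝓘(ℝ, ℝ) ∞ f → dirDeriv I f x v = dirDeriv I f x w) : v = w :=
  sub_eq_zero.1 (eq_zero_of_dirDeriv_eq_zero fun f hf => by
    rw [dirDeriv_vec_sub, h f hf, sub_self])

end VectorFields

/-! ### Brackets satisfying the Leibniz rule -/

section Skew

variable {EM : Type*} [NormedAddCommGroup EM] [NormedSpace ℝ EM]
  {HM : Type*} [TopologicalSpace HM] {I : ModelWithCorners ℝ EM HM}
  {M : Type*} [TopologicalSpace M] [ChartedSpace HM M] [IsManifold I ∞ M]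
  {F : Type*} [NormedAddCommGroup F] [NormedSpace ℝ F]
  {E : M → Type*} [TopologicalSpace (TotalSpace F E)] [∀ x, TopologicalSpace (E x)]
  [∀ x, AddCommGroup (E x)] [∀ x, Module ℝ (E x)]
  [FiberBundle F E] [VectorBundle ℝ F E]

/-- A skew-symmetric bracket on smooth sections that is additive and satisfies the Leibniz rule.
Neither the smoothness of brackets nor the Jacobi identity is required. -/
structure IsSkewAlgebroid (A : AlgebroidData I F E) : Prop where
  add_right : ∀ X Y Z, SmoothSection I F X → SmoothSection I F Y → SmoothSection I F Z →
    A.bracket X (Y + Z) = A.bracket X Y + A.bracket X Z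
  skew : ∀ X Y, SmoothSection I F X → SmoothSection I F Y → A.bracket X Y = -A.bracket Y X
  leibniz : ∀ (f : M → ℝ) X Y, ContMDiff I 𝓘(ℝ, ℝ) ∞ f → SmoothSection I F X →
    SmoothSection I F Y → ∀ x, A.bracket X (fun y => f y • Y y) x =
      f x • A.bracket X Y x + dirDeriv I f x (A.anchor x (X x)) • Y x

theorem IsLieAlgebroid.isSkewAlgebroid {A : AlgebroidData I F E} (h : IsLieAlgebroid A) :
    IsSkewAlgebroid A := ⟨h.add_right, h.skew, h.leibniz⟩

/-- The derivative `ρ(X)(f)` of a function along the vector field `ρ(X)`. -/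
def anchorDeriv (A : AlgebroidData I F E) (X : ∀ x, E x) {W : Type*} [NormedAddCommGroup W]
    [NormedSpace ℝ W] (f : M → W) (x : M) : W :=
  dirDeriv I f x (A.anchor x (X x))

variable {A : AlgebroidData I F E}

section Anchor

variable [ContMDiffVectorBundle ∞ F E I]

theorem smoothSection_anchor (A : AlgebroidData I F E) {X : ∀ x, E x} (hX : SmoothSection I F X) :
    SmoothSection I EM (fun x => A.anchor x (X x)) :=
  A.contMDiff_anchor.clm_bundle_apply hX

theorem contMDiff_anchorDeriv (A : AlgebroidData I F E) {X : ∀ x, E x}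
    (hX : SmoothSection I F X) {W : Type*} [NormedAddCommGroup W]
    [NormedSpace ℝ W] {f : M → W} (hf : ContMDiff I 𝓘(ℝ, W) ∞ f) :
    ContMDiff I 𝓘(ℝ, W) ∞ (anchorDeriv A X f) :=
  contMDiff_dirDeriv hf (smoothSection_anchor A hX)

theorem SmoothDualSection.apply {α : ∀ x, E x →L[ℝ] ℝ} (hα : SmoothDualSection I F α)
    {X : ∀ x, E x} (hX : SmoothSection I F X) : ContMDiff I 𝓘(ℝ, ℝ) ∞ (fun x => α x (X x)) := by
  have h := ContMDiff.clm_bundle_apply (F₂ := ℝ) (E₂ := Bundle.Trivial M ℝ) (ϕ := α) hα hX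
  intro x
  exact (contMDiffAt_section (F := ℝ) (E := Bundle.Trivial M ℝ) x).1 (h x)

end Anchor

theorem mdifferentiableAt_of_smooth {W : Type*} [NormedAddCommGroup W]
    [NormedSpace ℝ W] {f : M → W} (hf : ContMDiff I 𝓘(ℝ, W) ∞ f) (x : M) :
    MDifferentiableAt I 𝓘(ℝ, W) f x := (hf x).mdifferentiableAt (by simp)

namespace IsSkewAlgebroid

variable (h : IsSkewAlgebroid A)
include h

theorem add_left {X Y Z : ∀ x, E x} (hX : SmoothSection I F X) (hY : SmoothSection I F Y)
    (hZ : SmoothSection I F Z) : A.bracket (X + Y) Z = A.bracket X Z + A.bracket Y Z := by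
  rw [h.skew _ _ (hX.add hY) hZ, h.add_right _ _ _ hZ hX hY, h.skew _ _ hX hZ, h.skew _ _ hY hZ]
  abel

theorem leibniz_left {f : M → ℝ} {X Y : ∀ x, E x} (hf : ContMDiff I 𝓘(ℝ, ℝ) ∞ f)
    (hX : SmoothSection I F X) (hY : SmoothSection I F Y) (x : M) :
    A.bracket (fun y => f y • X y) Y x =
      f x • A.bracket X Y x - anchorDeriv A Y f x • X x := by
  rw [h.skew _ _ (hX.smul hf) hY, Pi.neg_apply, h.leibniz _ _ _ hf hY hX, h.skew _ _ hX hY,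
    Pi.neg_apply, smul_neg, neg_add, sub_eq_add_neg]
  rfl

theorem zero_right {X : ∀ x, E x} (hX : SmoothSection I F X) : A.bracket X 0 = 0 := by
  have := h.add_right X 0 0 hX smoothSection_zero smoothSection_zero
  simpa using this

theorem smul_right (c : ℝ) {X Y : ∀ x, E x} (hX : SmoothSection I F X)
    (hY : SmoothSection I F Y) : A.bracket X (c • Y) = c • A.bracket X Y := by
  ext x
  have := h.leibniz (fun _ => c) X Y contMDiff_const hX hY x
  rw [dirDeriv_const, zero_smul, add_zero] at this
  exact this

theorem neg_right {X Y : ∀ x, E x} (hX : SmoothSection I F X)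
    (hY : SmoothSection I F Y) : A.bracket X (-Y) = -A.bracket X Y := by
  have := h.smul_right (-1) hX hY
  simpa using this

variable [FiniteDimensional ℝ EM] [I.Boundaryless] [T2Space M] [ContMDiffVectorBundle ∞ F E I]

/-- The bracket is a local operator: by the Leibniz rule, multiplying the second argument by a
cut-off function equal to `1` near `x` does not change the bracket at `x`. -/
theorem congr_right {X Y Y' : ∀ x, E x} (hX : SmoothSection I F X)
    (hY : SmoothSection I F Y) (hY' : SmoothSection I F Y') {x : M}
    (hYY : ∀ᶠ y in 𝓝 x, Y y = Y' y) : A.bracket X Y x = A.bracket X Y' x := by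
  obtain ⟨χ, hχ, h1, h2⟩ := exists_cutoff (I := I) hYY
  have e : (fun y => χ y • Y y) = fun y => χ y • Y' y := by
    ext y
    by_cases hy : y ∈ tsupport χ
    · have : Y y = Y' y := h2 hy
      rw [this]
    · rw [image_eq_zero_of_notMem_tsupport hy, zero_smul, zero_smul]
  have h3 : ∀ Z, SmoothSection I F Z → A.bracket X (fun y => χ y • Z y) x = A.bracket X Z x := by
    intro Z hZ
    rw [h.leibniz _ _ _ hχ hX hZ, h1.self_of_nhds, dirDeriv_congr h1]
    have : dirDeriv I (1 : M → ℝ) x (A.anchor x (X x)) = 0 := dirDeriv_const 1 x _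
    rw [this]
    simp
  rw [← h3 Y hY, e, h3 Y' hY']

variable [FiniteDimensional ℝ F]

/-- The difference of `⟦X, Y⟧` and the derivative of the coordinates of `Y` along `ρ(X)` is tensorial
in `Y`, so `Y` may be replaced in it by the section with constant coordinates. -/
theorem bracket_eq_right {X Y : ∀ x, E x} (hX : SmoothSection I F X)
    (hY : SmoothSection I F Y) (x : M) :
    A.bracket X Y x = A.bracket X (localExt I F (Y x)) x +
      (trivializationAt F E x).symmL ℝ x (anchorDeriv A X (coordAt F x Y) x) := by
  have hx := FiberBundle.mem_baseSet_trivializationAt F E x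
  have key := eq_of_tensorial (I := I) (F := F) (x := x) (Φ := fun Z => A.bracket X Z x -
    (trivializationAt F E x).symmL ℝ x (anchorDeriv A X (coordAt F x Z) x)) ?_ ?_ hY
    (smooth_localExt (Y x)) (localExt_self (Y x)).symm
  · simp only [anchorDeriv, dirDeriv_coordAt_localExt, map_zero, sub_zero] at key
    rw [← key]
    simp [anchorDeriv]
  · intro Z Z' hZ hZ'
    have : coordAt F x (Z + Z') =ᶠ[𝓝 x] fun y => coordAt F x Z y + coordAt F x Z' y := by
      filter_upwards [baseSet_mem_nhds (F := F) (E := E) x] with y hy using coordAt_add Z Z' hy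
    simp only [anchorDeriv]
    rw [dirDeriv_congr this, dirDeriv_add (hZ.mdifferentiableAt_coordAt hx)
      (hZ'.mdifferentiableAt_coordAt hx), map_add, h.add_right _ _ _ hX hZ hZ', Pi.add_apply]
    abel
  · intro f Z hf hZ
    have : coordAt F x (fun y => f y • Z y) =ᶠ[𝓝 x] fun y => f y • coordAt F x Z y := by
      filter_upwards [baseSet_mem_nhds (F := F) (E := E) x] with y hy using coordAt_smul f Z hy
    simp only [anchorDeriv]
    rw [dirDeriv_congr this, dirDeriv_smul (mdifferentiableAt_of_smooth hf x)
      (hZ.mdifferentiableAt_coordAt hx), map_add, h.leibniz _ _ _ hf hX hZ, map_smul, map_smul,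
      Trivialization.symmL_apply (R := ℝ) _ hx (coordAt F x Z x), symm_coordAt Z hx, smul_sub]
    abel

/-- The bracket in terms of the brackets of sections with constant coordinates. This is the formula
by which the first component of the bracket of the prolongation is defined. -/
theorem bracket_eq {X Y : ∀ x, E x} (hX : SmoothSection I F X)
    (hY : SmoothSection I F Y) (x : M) :
    A.bracket X Y x = A.bracket (localExt I F (X x)) (localExt I F (Y x)) x +
      (trivializationAt F E x).symmL ℝ x
        (anchorDeriv A X (coordAt F x Y) x - anchorDeriv A Y (coordAt F x X) x) := by
  have hl := smooth_localExt (I := I) (F := F) (Y x)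
  rw [h.bracket_eq_right hX hY, h.skew _ _ hX hl, Pi.neg_apply, h.bracket_eq_right hl hX,
    h.skew _ _ hl (smooth_localExt (X x)), map_sub, Pi.neg_apply]
  simp only [anchorDeriv, localExt_self]
  abel

/-- By the Leibniz rule, `⟦X, Y⟧` is near `x` a combination with smooth coefficients of sections
with constant coordinates and of their brackets with `X`. -/
theorem contMDiffAt_bracket_right {X : ∀ x, E x} (hX : SmoothSection I F X) {x : M}
    (hb : ∀ v : E x, ContMDiffAt I (I.prod 𝓘(ℝ, F)) ∞
      (fun y => TotalSpace.mk' F y (A.bracket X (localExt I F v) y)) x)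
    {Y : ∀ x, E x} (hY : SmoothSection I F Y) :
    ContMDiffAt I (I.prod 𝓘(ℝ, F)) ∞ (fun y => TotalSpace.mk' F y (A.bracket X Y y)) x := by
  classical
  obtain ⟨f, u, hf, hfu, -⟩ := exists_eventually_eq_sum hY x
  have hs : ∀ s : Finset (Fin (Module.finrank ℝ F)),
      SmoothSection I F (fun y => ∑ i ∈ s, f i y • localExt I F (u i) y) ∧
      ContMDiffAt I (I.prod 𝓘(ℝ, F)) ∞ (fun y => TotalSpace.mk' F y
        (A.bracket X (fun y => ∑ i ∈ s, f i y • localExt I F (u i) y) y)) x := by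
    intro s
    induction s using Finset.induction_on with
    | empty =>
      simp only [Finset.sum_empty]
      refine ⟨smoothSection_zero, ?_⟩
      have e : A.bracket X (fun _ => 0) = 0 := h.zero_right hX
      rw [e]
      exact smoothSection_zero x
    | insert a s ha ih =>
      have hsa : SmoothSection I F (fun y => f a y • localExt I F (u a) y) :=
        (smooth_localExt _).smul (hf a)
      simp only [Finset.sum_insert ha]
      refine ⟨hsa.add ih.1, ?_⟩
      have e : A.bracket X (fun y => f a y • localExt I F (u a) y +
          ∑ i ∈ s, f i y • localExt I F (u i) y) =
          (f a • A.bracket X (localExt I F (u a)) + anchorDeriv A X (f a) • localExt I F (u a)) +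
          A.bracket X (fun y => ∑ i ∈ s, f i y • localExt I F (u i) y) := by
        refine (h.add_right _ _ _ hX hsa ih.1).trans ?_
        congr 1
        ext y
        exact h.leibniz _ _ _ (hf a) hX (smooth_localExt _) y
      rw [e]
      exact (((hf a x).smul_section (hb (u a))).add_section
        ((contMDiff_anchorDeriv A hX (hf a) x).smul_section (smooth_localExt (u a) x))).add_section
          ih.2
  obtain ⟨h1, h2⟩ := hs Finset.univ
  refine h2.congr_of_eventuallyEq ?_
  filter_upwards [hfu.eventually_nhds] with y hy
  exact congrArg _ (h.congr_right hX hY h1 hy)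

/-- Brackets of smooth sections are smooth if this is so for sections with constant coordinates. -/
theorem smooth_bracket_of_localExt
    (hb : ∀ (x : M) (u v : E x), ContMDiffAt I (I.prod 𝓘(ℝ, F)) ∞
      (fun y => TotalSpace.mk' F y (A.bracket (localExt I F u) (localExt I F v) y)) x)
    {X Y : ∀ x, E x} (hX : SmoothSection I F X) (hY : SmoothSection I F Y) :
    SmoothSection I F (A.bracket X Y) := by
  intro x
  refine h.contMDiffAt_bracket_right hX (fun v => ?_) hY
  have h1 := h.contMDiffAt_bracket_right (smooth_localExt v) (fun u => hb x v u) hX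
  rw [h.skew _ _ hX (smooth_localExt v)]
  exact h1.neg_section

end IsSkewAlgebroid

end Skew

/-! ### The anchor as a homomorphism and the Jacobi identity -/

section Jacobi

variable {EM : Type*} [NormedAddCommGroup EM] [NormedSpace ℝ EM]
  {HM : Type*} [TopologicalSpace HM] {I : ModelWithCorners ℝ EM HM}
  {M : Type*} [TopologicalSpace M] [ChartedSpace HM M] [IsManifold I ∞ M]
  {F : Type*} [NormedAddCommGroup F] [NormedSpace ℝ F]
  {E : M → Type*} [TopologicalSpace (TotalSpace F E)] [∀ x, TopologicalSpace (E x)]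
  [∀ x, AddCommGroup (E x)] [∀ x, Module ℝ (E x)]
  [FiberBundle F E] [VectorBundle ℝ F E] [ContMDiffVectorBundle ∞ F E I]
  {A : AlgebroidData I F E}

/-- The Jacobiator of a bracket, in the Leibniz form; for a skew-symmetric bracket it is the cyclic
sum. -/
def jacobiator (A : AlgebroidData I F E) (X Y Z : ∀ x, E x) : ∀ x, E x :=
  A.bracket X (A.bracket Y Z) - A.bracket Y (A.bracket X Z) - A.bracket (A.bracket X Y) Z

namespace IsSkewAlgebroid

variable (h : IsSkewAlgebroid A)
  (hs : ∀ X Y, SmoothSection I F X → SmoothSection I F Y → SmoothSection I F (A.bracket X Y))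
include h hs

theorem cyclic_sum_eq_jacobiator {X Y Z : ∀ x, E x} (hX : SmoothSection I F X)
    (hY : SmoothSection I F Y) (hZ : SmoothSection I F Z) :
    A.bracket X (A.bracket Y Z) + A.bracket Y (A.bracket Z X) + A.bracket Z (A.bracket X Y) =
      jacobiator A X Y Z := by
  rw [h.skew Z X hZ hX, h.neg_right hY (hs _ _ hX hZ), h.skew Z _ hZ (hs _ _ hX hY), jacobiator]
  abel

theorem jacobiator_rotate {X Y Z : ∀ x, E x} (hX : SmoothSection I F X)
    (hY : SmoothSection I F Y) (hZ : SmoothSection I F Z) :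
    jacobiator A X Y Z = jacobiator A Y Z X := by
  rw [← h.cyclic_sum_eq_jacobiator hs hX hY hZ, ← h.cyclic_sum_eq_jacobiator hs hY hZ hX]
  abel

theorem jacobiator_add {X Y Z Z' : ∀ x, E x} (hX : SmoothSection I F X)
    (hY : SmoothSection I F Y) (hZ : SmoothSection I F Z) (hZ' : SmoothSection I F Z') :
    jacobiator A X Y (Z + Z') = jacobiator A X Y Z + jacobiator A X Y Z' := by
  simp only [jacobiator]
  rw [h.add_right _ _ _ hY hZ hZ', h.add_right _ _ _ hX hZ hZ',
    h.add_right _ _ _ hX (hs _ _ hY hZ) (hs _ _ hY hZ'),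
    h.add_right _ _ _ hY (hs _ _ hX hZ) (hs _ _ hX hZ'),
    h.add_right _ _ _ (hs _ _ hX hY) hZ hZ']
  abel

/-- The failure of the Jacobiator to be tensorial is the failure of the anchor to be a
homomorphism. -/
theorem jacobiator_smul {X Y Z : ∀ x, E x} {f : M → ℝ} (hX : SmoothSection I F X)
    (hY : SmoothSection I F Y) (hZ : SmoothSection I F Z) (hf : ContMDiff I 𝓘(ℝ, ℝ) ∞ f) (x : M) :
    jacobiator A X Y (fun y => f y • Z y) x = f x • jacobiator A X Y Z x +
      (anchorDeriv A X (anchorDeriv A Y f) x - anchorDeriv A Y (anchorDeriv A X f) x -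
        anchorDeriv A (A.bracket X Y) f x) • Z x := by
  have h1 : ∀ X Y, SmoothSection I F X → SmoothSection I F Y →
      A.bracket X (A.bracket Y (fun y => f y • Z y)) x =
      f x • A.bracket X (A.bracket Y Z) x + anchorDeriv A X f x • A.bracket Y Z x +
      (anchorDeriv A Y f x • A.bracket X Z x + anchorDeriv A X (anchorDeriv A Y f) x • Z x) := by
    intro X Y hX hY
    have hYf := contMDiff_anchorDeriv A hY hf
    have e : A.bracket Y (fun y => f y • Z y) =
        (fun y => f y • A.bracket Y Z y) + fun y => anchorDeriv A Y f y • Z y :=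
      funext fun y => h.leibniz _ _ _ hf hY hZ y
    rw [e, h.add_right _ _ _ hX ((hs _ _ hY hZ).smul hf) (hZ.smul hYf), Pi.add_apply,
      h.leibniz _ _ _ hf hX (hs _ _ hY hZ), h.leibniz _ _ _ hYf hX hZ]
    rfl
  simp only [jacobiator, Pi.sub_apply]
  rw [h1 X Y hX hY, h1 Y X hY hX, h.leibniz _ _ _ hf (hs _ _ hX hY) hZ]
  simp only [anchorDeriv]
  module

end IsSkewAlgebroid

variable [FiniteDimensional ℝ EM] [I.Boundaryless] [T2Space M]

/-- The anchor of a Lie algebroid is a homomorphism of Lie algebras, for the action on functions: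
by `IsSkewAlgebroid.jacobiator_smul` the defect is annihilated by multiplication with every vector
of the fibre. Over a point with zero fibre both sides vanish. -/
theorem IsLieAlgebroid.anchorDeriv_bracket (h : IsLieAlgebroid A) {X Y : ∀ x, E x}
    (hX : SmoothSection I F X) (hY : SmoothSection I F Y) {f : M → ℝ}
    (hf : ContMDiff I 𝓘(ℝ, ℝ) ∞ f) (x : M) :
    anchorDeriv A (A.bracket X Y) f x =
      anchorDeriv A X (anchorDeriv A Y f) x - anchorDeriv A Y (anchorDeriv A X f) x := by
  by_cases hx : ∃ u : E x, u ≠ 0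
  · obtain ⟨u, hu⟩ := hx
    have h0 : ∀ Z, SmoothSection I F Z → jacobiator A X Y Z = 0 := fun Z hZ => by
      rw [← h.isSkewAlgebroid.cyclic_sum_eq_jacobiator h.smooth hX hY hZ, h.jacobi _ _ _ hX hY hZ]
    have hu' := smooth_localExt (I := I) (F := F) u
    have := h.isSkewAlgebroid.jacobiator_smul h.smooth hX hY hu' hf x
    rw [h0 _ hu', h0 _ (hu'.smul hf), localExt_self, Pi.zero_apply, smul_zero, zero_add] at this
    have := (smul_eq_zero.1 this.symm).resolve_right hu
    linarith
  · have hx : ∀ u : E x, u = 0 := by simpa using hx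
    simp only [anchorDeriv]
    rw [hx (A.bracket X Y x), hx (X x), hx (Y x)]
    simp only [map_zero, dirDeriv_vec_zero, sub_zero]

variable [FiniteDimensional ℝ F]

/-- If the anchor is a homomorphism, the Jacobiator at `x` depends only on the values of the sections
at `x`: it is tensorial in the last argument, and invariant under cyclic permutations. -/
theorem IsSkewAlgebroid.jacobiator_congr (h : IsSkewAlgebroid A)
    (hs : ∀ X Y, SmoothSection I F X → SmoothSection I F Y → SmoothSection I F (A.bracket X Y))
    (ha : ∀ X Y, SmoothSection I F X → SmoothSection I F Y → ∀ f : M → ℝ,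
      ContMDiff I 𝓘(ℝ, ℝ) ∞ f → ∀ x, anchorDeriv A (A.bracket X Y) f x =
      anchorDeriv A X (anchorDeriv A Y f) x - anchorDeriv A Y (anchorDeriv A X f) x)
    {X X' Y Y' Z Z' : ∀ x, E x} (hX : SmoothSection I F X) (hX' : SmoothSection I F X')
    (hY : SmoothSection I F Y) (hY' : SmoothSection I F Y') (hZ : SmoothSection I F Z)
    (hZ' : SmoothSection I F Z') {x : M} (hXX : X x = X' x) (hYY : Y x = Y' x)
    (hZZ : Z x = Z' x) : jacobiator A X Y Z x = jacobiator A X' Y' Z' x := by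
  have key : ∀ X Y Z Z', SmoothSection I F X → SmoothSection I F Y → SmoothSection I F Z →
      SmoothSection I F Z' → Z x = Z' x → jacobiator A X Y Z x = jacobiator A X Y Z' x := by
    intro X Y Z Z' hX hY hZ hZ' hZZ
    refine eq_of_tensorial (I := I) (F := F) (Φ := fun Z => jacobiator A X Y Z x) ?_ ?_ hZ hZ' hZZ
    · intro Z Z' hZ hZ'
      simp only [h.jacobiator_add hs hX hY hZ hZ', Pi.add_apply]
    · intro f Z hf hZ
      simp only [h.jacobiator_smul hs hX hY hZ hf, ha X Y hX hY f hf, sub_self, zero_smul,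
        add_zero]
  rw [key X Y Z Z' hX hY hZ hZ' hZZ, h.jacobiator_rotate hs hX hY hZ',
    key Y Z' X X' hY hZ' hX hX' hXX, h.jacobiator_rotate hs hY hZ' hX',
    key Z' X' Y Y' hZ' hX' hY hY' hYY, h.jacobiator_rotate hs hZ' hX' hY']

end Jacobi

/-! ### The differential of a `1`-section -/

section Differential

variable {EM : Type*} [NormedAddCommGroup EM] [NormedSpace ℝ EM]
  {HM : Type*} [TopologicalSpace HM] {I : ModelWithCorners ℝ EM HM}
  {M : Type*} [TopologicalSpace M] [ChartedSpace HM M] [IsManifold I ∞ M]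
  {F : Type*} [NormedAddCommGroup F] [NormedSpace ℝ F]
  {E : M → Type*} [TopologicalSpace (TotalSpace F E)] [∀ x, TopologicalSpace (E x)]
  [∀ x, AddCommGroup (E x)] [∀ x, Module ℝ (E x)]
  [FiberBundle F E] [VectorBundle ℝ F E] [ContMDiffVectorBundle ∞ F E I]
  {A : AlgebroidData I F E}
  [FiniteDimensional ℝ EM] [I.Boundaryless] [T2Space M] [FiniteDimensional ℝ F]

namespace IsSkewAlgebroid

variable (h : IsSkewAlgebroid A) {α : ∀ x, E x →L[ℝ] ℝ} (hα : SmoothDualSection I F α)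
include h hα

/-- The differential can be computed with arbitrary sections through the given vectors, because the
right-hand side is tensorial in both arguments. -/
theorem d1_apply {X Y : ∀ x, E x} (hX : SmoothSection I F X) (hY : SmoothSection I F Y) (x : M) :
    d1 A α x (X x) (Y x) =
      anchorDeriv A X (fun y => α y (Y y)) x - anchorDeriv A Y (fun y => α y (X y)) x -
        α x (A.bracket X Y x) := by
  have key : ∀ X, SmoothSection I F X → ∀ Y Y', SmoothSection I F Y → SmoothSection I F Y' →
      Y x = Y' x →
      anchorDeriv A X (fun y => α y (Y y)) x - anchorDeriv A Y (fun y => α y (X y)) x -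
        α x (A.bracket X Y x) =
      anchorDeriv A X (fun y => α y (Y' y)) x - anchorDeriv A Y' (fun y => α y (X y)) x -
        α x (A.bracket X Y' x) := by
    intro X hX Y Y' hY hY' hYY
    refine eq_of_tensorial (I := I) (F := F) (Φ := fun Y => anchorDeriv A X (fun y => α y (Y y)) x -
      anchorDeriv A Y (fun y => α y (X y)) x - α x (A.bracket X Y x)) ?_ ?_ hY hY' hYY
    · intro Z Z' hZ hZ'
      simp only [anchorDeriv, Pi.add_apply, map_add, dirDeriv_vec_add, h.add_right _ _ _ hX hZ hZ']
      rw [dirDeriv_add (mdifferentiableAt_of_smooth (hα.apply hZ) x)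
        (mdifferentiableAt_of_smooth (hα.apply hZ') x)]
      ring
    · intro f Z hf hZ
      simp only [anchorDeriv, map_smul, dirDeriv_vec_smul]
      rw [dirDeriv_smul (mdifferentiableAt_of_smooth hf x)
        (mdifferentiableAt_of_smooth (hα.apply hZ) x), h.leibniz _ _ _ hf hX hZ]
      simp only [map_add, map_smul, smul_eq_mul]
      ring
  have hlX := smooth_localExt (I := I) (F := F) (X x)
  have hlY := smooth_localExt (I := I) (F := F) (Y x)
  have e : d1 A α x (X x) (Y x) = anchorDeriv A (localExt I F (X x))
      (fun y => α y (localExt I F (Y x) y)) x - anchorDeriv A (localExt I F (Y x))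
      (fun y => α y (localExt I F (X x) y)) x -
        α x (A.bracket (localExt I F (X x)) (localExt I F (Y x)) x) := by
    simp only [anchorDeriv, localExt_self]
    rfl
  rw [e, key _ hlX _ Y hlY hY (localExt_self _)]
  have h1 := key Y hY _ X hlX hX (localExt_self _)
  rw [h.skew _ _ hY hlX, h.skew _ _ hY hX] at h1
  simp only [Pi.neg_apply, map_neg] at h1
  linarith

theorem d1_add_left (x : M) (u u' v : E x) :
    d1 A α x (u + u') v = d1 A α x u v + d1 A α x u' v := by
  have hu := smooth_localExt (I := I) (F := F) u
  have hu' := smooth_localExt (I := I) (F := F) u'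
  have hv := smooth_localExt (I := I) (F := F) v
  have e1 := h.d1_apply hα (hu.add hu') hv x
  have e2 := h.d1_apply hα hu hv x
  have e3 := h.d1_apply hα hu' hv x
  simp only [localExt_self, Pi.add_apply, h.add_left hu hu' hv, map_add, anchorDeriv,
    dirDeriv_vec_add] at e1 e2 e3
  rw [dirDeriv_add (mdifferentiableAt_of_smooth (hα.apply hu) x)
        (mdifferentiableAt_of_smooth (hα.apply hu') x)] at e1
  linarith

theorem d1_skew (x : M) (u v : E x) : d1 A α x u v = -d1 A α x v u := by
  have hu := smooth_localExt (I := I) (F := F) u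
  have hv := smooth_localExt (I := I) (F := F) v
  have e1 := h.d1_apply hα hu hv x
  have e2 := h.d1_apply hα hv hu x
  rw [h.skew _ _ hv hu] at e2
  simp only [localExt_self, Pi.neg_apply, map_neg] at e1 e2
  linarith

theorem d1_smul_left (x : M) (c : ℝ) (u v : E x) : d1 A α x (c • u) v = c * d1 A α x u v := by
  have hu := smooth_localExt (I := I) (F := F) u
  have hv := smooth_localExt (I := I) (F := F) v
  have e1 := h.d1_apply hα hv (hu.const_smul c) x
  have e2 := h.d1_apply hα hv hu x
  simp only [localExt_self, Pi.smul_apply, h.smul_right c hv hu, map_smul, anchorDeriv,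
    dirDeriv_vec_smul] at e1 e2
  rw [dirDeriv_smul mdifferentiableAt_const
        (mdifferentiableAt_of_smooth (hα.apply hu) x), dirDeriv_const] at e1
  rw [h.d1_skew hα, e1, h.d1_skew hα x u, e2]
  simp only [smul_eq_mul]
  ring

end IsSkewAlgebroid

namespace IsLieAlgebroid

variable (h : IsLieAlgebroid A) {α : ∀ x, E x →L[ℝ] ℝ} (hα : SmoothDualSection I F α)
include h hα

theorem isTwoSection_neg_d1 : IsTwoSection I F (fun x u v => -d1 A α x u v) where
  add_left x u u' v := by rw [h.isSkewAlgebroid.d1_add_left hα]; ring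
  smul_left x c u v := by rw [h.isSkewAlgebroid.d1_smul_left hα]; ring
  skew x u v := by rw [h.isSkewAlgebroid.d1_skew hα]
  smooth X Y hX hY := by
    simp only [h.isSkewAlgebroid.d1_apply hα hX hY]
    exact (((contMDiff_anchorDeriv A hX (hα.apply hY)).sub
      (contMDiff_anchorDeriv A hY (hα.apply hX))).sub (hα.apply (h.smooth _ _ hX hY))).neg

/-- Exact `2`-sections are closed. The second derivatives cancel because the anchor is a
homomorphism, and the remaining terms add up to `α` of the Jacobiator. -/
theorem neg_d1_closed {X Y Z : ∀ x, E x} (hX : SmoothSection I F X) (hY : SmoothSection I F Y)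
    (hZ : SmoothSection I F Z) (x : M) :
    dirDeriv I (fun y => -d1 A α y (Y y) (Z y)) x (A.anchor x (X x)) -
      dirDeriv I (fun y => -d1 A α y (X y) (Z y)) x (A.anchor x (Y x)) +
      dirDeriv I (fun y => -d1 A α y (X y) (Y y)) x (A.anchor x (Z x)) -
      (-d1 A α x (A.bracket X Y x) (Z x)) + (-d1 A α x (A.bracket X Z x) (Y x)) -
      (-d1 A α x (A.bracket Y Z x) (X x)) = 0 := by
  have hsk := h.isSkewAlgebroid
  have key : ∀ X Y Z, SmoothSection I F X → SmoothSection I F Y → SmoothSection I F Z →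
      dirDeriv I (fun y => -d1 A α y (Y y) (Z y)) x (A.anchor x (X x)) =
      -(anchorDeriv A X (anchorDeriv A Y (fun y => α y (Z y))) x -
        anchorDeriv A X (anchorDeriv A Z (fun y => α y (Y y))) x -
        anchorDeriv A X (fun y => α y (A.bracket Y Z y)) x) := by
    intro X Y Z hX hY hZ
    simp only [hsk.d1_apply hα hY hZ]
    have m1 := mdifferentiableAt_of_smooth (contMDiff_anchorDeriv A hY (hα.apply hZ)) x
    have m2 := mdifferentiableAt_of_smooth (contMDiff_anchorDeriv A hZ (hα.apply hY)) x
    have m3 := mdifferentiableAt_of_smooth (hα.apply (h.smooth _ _ hY hZ)) x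
    exact (dirDeriv_neg _ ((m1.sub m2).sub m3)).trans (congrArg Neg.neg
      ((dirDeriv_sub (m1.sub m2) m3 _).trans (congrArg (· - _) (dirDeriv_sub m1 m2 _))))
  rw [key X Y Z hX hY hZ, key Y X Z hY hX hZ, key Z X Y hZ hX hY,
    hsk.d1_apply hα (h.smooth _ _ hX hY) hZ, hsk.d1_apply hα (h.smooth _ _ hX hZ) hY,
    hsk.d1_apply hα (h.smooth _ _ hY hZ) hX,
    h.anchorDeriv_bracket hX hY (hα.apply hZ), h.anchorDeriv_bracket hX hZ (hα.apply hY),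
    h.anchorDeriv_bracket hY hZ (hα.apply hX)]
  have hj := congrFun (h.jacobi X Y Z hX hY hZ) x
  have e1 := congrFun (hsk.skew X _ hX (h.smooth _ _ hY hZ)) x
  have e2 : A.bracket Y (A.bracket Z X) x = A.bracket (A.bracket X Z) Y x := by
    rw [hsk.skew _ _ hY (h.smooth _ _ hZ hX), hsk.skew _ _ hX hZ,
      hsk.skew (-A.bracket Z X) Y (h.smooth _ _ hZ hX).neg hY,
      hsk.neg_right hY (h.smooth _ _ hZ hX), hsk.skew _ _ hY (h.smooth _ _ hZ hX)]
    simp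
  have e3 := congrFun (hsk.skew Z _ hZ (h.smooth _ _ hX hY)) x
  simp only [Pi.add_apply, Pi.neg_apply, Pi.zero_apply] at hj e1 e3
  rw [e1, e2, e3] at hj
  have hj' := congrArg (α x) hj
  simp only [map_add, map_neg, map_zero] at hj'
  linarith

end IsLieAlgebroid

end Differential

/-! ### Nondegenerate `2`-sections -/

section Nondegenerate

variable {EM : Type*} [NormedAddCommGroup EM] [NormedSpace ℝ EM]
  {HM : Type*} [TopologicalSpace HM] {I : ModelWithCorners ℝ EM HM}
  {M : Type*} [TopologicalSpace M] [ChartedSpace HM M] [IsManifold I ∞ M]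
  {F : Type*} [NormedAddCommGroup F] [NormedSpace ℝ F]
  {E : M → Type*} [TopologicalSpace (TotalSpace F E)] [∀ x, TopologicalSpace (E x)]
  [∀ x, AddCommGroup (E x)] [∀ x, Module ℝ (E x)]
  [FiberBundle F E] [VectorBundle ℝ F E]
  {Ω : ∀ x, E x → E x → ℝ}

namespace IsTwoSection

theorem add_right (h : IsTwoSection I F Ω) (x : M) (u v v' : E x) :
    Ω x u (v + v') = Ω x u v + Ω x u v' := by
  rw [h.skew, h.add_left, h.skew x v, h.skew x v']
  ring

theorem smul_right (h : IsTwoSection I F Ω) (x : M) (c : ℝ) (u v : E x) :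
    Ω x u (c • v) = c * Ω x u v := by
  rw [h.skew, h.smul_left, h.skew x v]
  ring

theorem neg_left (h : IsTwoSection I F Ω) (x : M) (u v : E x) : Ω x (-u) v = -Ω x u v := by
  have := h.smul_left x (-1) u v
  simpa using this

/-- A `2`-section as a bilinear form on each fibre. -/
def toBilin (h : IsTwoSection I F Ω) (x : M) : E x →ₗ[ℝ] E x →ₗ[ℝ] ℝ :=
  LinearMap.mk₂ ℝ (Ω x) (h.add_left x) (h.smul_left x) (h.add_right x) (h.smul_right x)

/-- Smooth linear forms have unique representatives with respect to a nondegenerate `2`-section, and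
these are smooth: in a trivialization the representative is obtained by applying the inverse of the
smooth matrix of `Ω`, and inversion of matrices is smooth. -/
theorem existsUnique_smooth_of_nondegenerate
    [FiniteDimensional ℝ EM] [I.Boundaryless] [T2Space M] [FiniteDimensional ℝ F]
    [ContMDiffVectorBundle ∞ F E I]
    (h : IsTwoSection I F Ω) (hnd : ∀ x u, (∀ v, Ω x u v = 0) → u = 0)
    (θ : ∀ x, E x →ₗ[ℝ] ℝ)
    (hθ : ∀ X, SmoothSection I F X → ContMDiff I 𝓘(ℝ, ℝ) ∞ fun x => θ x (X x)) :
    ∃ ξ : ∀ x, E x, SmoothSection I F ξ ∧ (∀ x v, Ω x (ξ x) v = θ x v) ∧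
      ∀ η : ∀ x, E x, (∀ x v, Ω x (η x) v = θ x v) → η = ξ := by
  have hfin : ∀ x, FiniteDimensional ℝ (E x) := fun x => VectorBundle.finiteDimensional ℝ F E x
  have hinj : ∀ x, Function.Injective (h.toBilin x) := fun x => by
    rw [← LinearMap.ker_eq_bot, LinearMap.ker_eq_bot']
    exact fun u hu => hnd x u fun v => congrArg (fun L : E x →ₗ[ℝ] ℝ => L v) hu
  have hsurj : ∀ x, ∃ u, h.toBilin x u = θ x := fun x => by
    have hd : Module.finrank ℝ (E x) = Module.finrank ℝ (Module.Dual ℝ (E x)) :=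
      (Subspace.dual_finrank_eq).symm
    exact (LinearMap.injective_iff_surjective_of_finrank_eq_finrank hd).1 (hinj x) (θ x)
  choose ξ hξ using hsurj
  have hξ' : ∀ x v, Ω x (ξ x) v = θ x v := fun x v =>
    congrArg (fun L : E x →ₗ[ℝ] ℝ => L v) (hξ x)
  refine ⟨ξ, ?_, hξ', fun η hη => funext fun x => hinj x ?_⟩
  swap
  · rw [hξ]
    exact LinearMap.ext fun v => hη x v
  intro x
  have hx := FiberBundle.mem_baseSet_trivializationAt F E x
  let e := trivializationAt F E x
  let b := Module.finBasis ℝ F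
  let s : Fin (Module.finrank ℝ F) → ∀ y, E y := fun i => localExt I F (e.symm x (b i))
  have hsm : ∀ i, SmoothSection I F (s i) := fun i => smooth_localExt _
  have hse : ∀ᶠ y in 𝓝 x, ∀ i, s i y = e.symmL ℝ y (b i) := by
    refine Filter.eventually_all.2 fun i => ?_
    filter_upwards [coordAt_localExt (I := I) (F := F) (e.symm x (b i)),
      baseSet_mem_nhds (F := F) (E := E) x] with y h1 hy
    have h2 := congrArg Prod.snd (e.apply_mk_symm hx (b i))
    have h3 : coordAt F x (s i) y = b i := h1.trans h2
    rw [← symm_coordAt (s i) hy, h3, ← Trivialization.symmL_apply (R := ℝ) _ hy]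
  -- the coordinate expression of `u ↦ Ω(u, ·)`
  let dualB : Fin (Module.finrank ℝ F) → F →L[ℝ] ℝ := fun i => LinearMap.toContinuousLinearMap (b.coord i)
  let B : M → F →L[ℝ] (F →L[ℝ] ℝ) := fun y =>
    ∑ i, ∑ j, Ω y (s i y) (s j y) • (dualB i).smulRight (dualB j)
  let T : M → F →L[ℝ] ℝ := fun y => ∑ j, θ y (s j y) • dualB j
  have hB : ContMDiff I 𝓘(ℝ, F →L[ℝ] (F →L[ℝ] ℝ)) ∞ B :=
    contMDiff_finsetSum fun i _ => contMDiff_finsetSum fun j _ =>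
      (h.smooth _ _ (hsm i) (hsm j)).smul contMDiff_const
  have hT : ContMDiff I 𝓘(ℝ, F →L[ℝ] ℝ) ∞ T :=
    contMDiff_finsetSum fun j _ => (hθ _ (hsm j)).smul contMDiff_const
  have hBe : ∀ᶠ y in 𝓝 x, ∀ z z', B y z z' = Ω y (e.symmL ℝ y z) (e.symmL ℝ y z') := by
    filter_upwards [hse] with y hy z z'
    have e1 : Ω y (e.symmL ℝ y z) (e.symmL ℝ y z') =
        h.toBilin y (e.symmL ℝ y z) (e.symmL ℝ y z') := rfl
    rw [e1]
    conv_rhs => rw [← b.sum_repr z, ← b.sum_repr z']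
    simp only [map_sum, map_smul, LinearMap.sum_apply, LinearMap.smul_apply, ← hy, B,
      FunLike.coe_sum, Finset.sum_apply, FunLike.coe_smul, Pi.smul_apply,
      ContinuousLinearMap.smulRight_apply, smul_eq_mul, Finset.mul_sum]
    rw [Finset.sum_comm]
    refine Finset.sum_congr rfl fun j _ => Finset.sum_congr rfl fun i _ => ?_
    change Ω y (s i y) (s j y) * (b.repr z i * b.repr z' j) =
      b.repr z' j * (b.repr z i * Ω y (s i y) (s j y))
    ring
  have hTe : ∀ᶠ y in 𝓝 x, ∀ z, T y z = θ y (e.symmL ℝ y z) := by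
    filter_upwards [hse] with y hy z
    conv_rhs => rw [← b.sum_repr z]
    simp only [map_sum, map_smul, ← hy, T,
      FunLike.coe_sum, Finset.sum_apply, FunLike.coe_smul, Pi.smul_apply,
      smul_eq_mul]
    refine Finset.sum_congr rfl fun i _ => ?_
    change _ * b.repr z i = b.repr z i * _
    ring
  have hBinv : ∀ᶠ y in 𝓝 x, (B y).IsInvertible := by
    filter_upwards [hBe, baseSet_mem_nhds (F := F) (E := E) x] with y hy hyb
    have hi : Function.Injective (B y : F →ₗ[ℝ] (F →L[ℝ] ℝ)) := by
      rw [← LinearMap.ker_eq_bot, LinearMap.ker_eq_bot']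
      intro z hz
      have h0 : e.symmL ℝ y z = 0 := hnd y _ fun v => by
        have h1 := hy z (e.continuousLinearMapAt ℝ y v)
        rw [Trivialization.symmL_continuousLinearMapAt _ hyb] at h1
        rw [← h1]
        exact congrArg (fun L : F →L[ℝ] ℝ => L (e.continuousLinearMapAt ℝ y v)) hz
      rw [← Trivialization.continuousLinearMapAt_symmL (R := ℝ) e hyb z, h0, map_zero]
    have hd : Module.finrank ℝ F = Module.finrank ℝ (F →L[ℝ] ℝ) := by
      rw [← (LinearMap.toContinuousLinearMap (𝕜 := ℝ) (E := F) (F' := ℝ)).finrank_eq]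
      exact (Subspace.dual_finrank_eq (K := ℝ) (V := F)).symm
    exact ⟨(LinearEquiv.ofInjectiveOfFinrankEq (B y : F →ₗ[ℝ] (F →L[ℝ] ℝ)) hi
      hd).toContinuousLinearEquiv, rfl⟩
  -- near `x` the coordinates of `ξ` solve a linear system with the smooth invertible matrix `B`
  have hc : coordAt F x ξ =ᶠ[𝓝 x] fun y => (B y).inverse (T y) := by
    filter_upwards [hBe, hTe, hBinv, baseSet_mem_nhds (F := F) (E := E) x] with y h1 h2 h3 hyb
    have h4 : B y (coordAt F x ξ y) = T y := by
      refine ContinuousLinearMap.ext fun z => ?_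
      rw [h1, h2, Trivialization.symmL_apply (R := ℝ) _ hyb (coordAt F x ξ y), symm_coordAt ξ hyb, hξ']
    obtain ⟨L, hL⟩ := h3
    rw [← h4, ← hL, ContinuousLinearMap.inverse_equiv]
    exact (L.symm_apply_apply _).symm
  refine contMDiffAt_of_coordAt hx (ContMDiffAt.congr_of_eventuallyEq ?_ hc)
  obtain ⟨L, hL⟩ := hBinv.self_of_nhds
  have hinv : ContMDiffAt I 𝓘(ℝ, (F →L[ℝ] ℝ) →L[ℝ] F) ∞ (fun y => (B y).inverse) x := by
    have : ContDiffAt ℝ ∞ ContinuousLinearMap.inverse (B x) := by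
      rw [← hL]
      have : CompleteSpace F := FiniteDimensional.complete ℝ F
      exact contDiffAt_map_inverse L
    exact this.contMDiffAt.comp x (hB x)
  exact hinv.clm_apply (hT x)

end IsTwoSection

end Nondegenerate

/-! ### The prolongation as a Lie algebroid -/

theorem t2Space_totalSpace {M : Type*} [TopologicalSpace M] [T2Space M] {G : Type*}
    [TopologicalSpace G] [T2Space G] {V : M → Type*} [TopologicalSpace (TotalSpace G V)]
    [∀ x, TopologicalSpace (V x)] [FiberBundle G V] : T2Space (TotalSpace G V) where
  t2 p q hpq := by
    by_cases hx : p.proj = q.proj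
    · let e := trivializationAt G V p.proj
      have hp : p ∈ e.source := e.mem_source.2 (FiberBundle.mem_baseSet_trivializationAt G V p.proj)
      have hq : q ∈ e.source :=
        e.mem_source.2 (hx ▸ FiberBundle.mem_baseSet_trivializationAt G V p.proj)
      obtain ⟨u, v, hu, hv, hpu, hqv, huv⟩ :=
        t2_separation (e.toOpenPartialHomeomorph.injOn.ne hp hq hpq)
      exact ⟨_, _, e.toOpenPartialHomeomorph.isOpen_inter_preimage hu,
        e.toOpenPartialHomeomorph.isOpen_inter_preimage hv, ⟨hp, hpu⟩, ⟨hq, hqv⟩,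
        (huv.preimage e.toOpenPartialHomeomorph).mono inter_subset_right inter_subset_right⟩
    · obtain ⟨u, v, hu, hv, hpu, hqv, huv⟩ := t2_separation hx
      have hc := FiberBundle.continuous_proj G V
      exact ⟨_, _, hu.preimage hc, hv.preimage hc, hpu, hqv, huv.preimage _⟩

section Prolongation

variable {EM : Type*} [NormedAddCommGroup EM] [NormedSpace ℝ EM]
  {HM : Type*} [TopologicalSpace HM] {I : ModelWithCorners ℝ EM HM}
  {M : Type*} [TopologicalSpace M] [ChartedSpace HM M] [IsManifold I ∞ M]
  {F : Type*} [NormedAddCommGroup F] [NormedSpace ℝ F]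
  {E : M → Type*} [TopologicalSpace (TotalSpace F E)] [∀ x, TopologicalSpace (E x)]
  [∀ x, AddCommGroup (E x)] [∀ x, Module ℝ (E x)]
  [FiberBundle F E] [VectorBundle ℝ F E] [ContMDiffVectorBundle ∞ F E I]
  {G : Type*} [NormedAddCommGroup G] [NormedSpace ℝ G]
  {V : M → Type*} [TopologicalSpace (TotalSpace G V)] [∀ x, TopologicalSpace (V x)]
  [∀ x, AddCommGroup (V x)] [∀ x, Module ℝ (V x)]
  [FiberBundle G V] [VectorBundle ℝ G V] [ContMDiffVectorBundle ∞ G V I]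
  {A : AlgebroidData I F E}

theorem mdifferentiableAt_proj (p : TotalSpace G V) :
    MDifferentiableAt (I.prod 𝓘(ℝ, G)) I (π G V) p :=
  (Bundle.contMDiff_proj V (n := ∞)).mdifferentiableAt (by simp)

/-- The section `S` of the prolongation projects to the section `X` near `p`: its first component
is `X ∘ π` there. -/
def ProjectsAt (S : ∀ p, Prol G V A p) (X : ∀ x, E x) (p : TotalSpace G V) : Prop :=
  ∀ᶠ q in 𝓝 p, (S q).1.1 = X q.proj

theorem Prol.anchor_fst {p : TotalSpace G V} (w : Prol G V A p) :
    mfderiv (I.prod 𝓘(ℝ, G)) I (π G V) p w.1.2 = A.anchor p.proj w.1.1 := w.2.symm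

theorem coordAt_prol (S : ∀ p, Prol G V A p) (p q : TotalSpace G V) :
    coordAt (F × G) p S q = prolCoord G V A p q (S q) := rfl

theorem mem_prolBase_nhds (p : TotalSpace G V) : prolBase G V A p ∈ 𝓝 p :=
  baseSet_mem_nhds (F := F × G) (E := Prol G V A) p

theorem fstCoord_eventuallyEq (S : ∀ p, Prol G V A p) (p : TotalSpace G V) :
    fstCoord S p.proj =ᶠ[𝓝 p] fun q => (coordAt (F × G) p S q).1 := by
  filter_upwards [mem_prolBase_nhds (A := A) p] with q hq
  have h := hq.2
  rw [coordAt_prol]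
  change _ = (trivializationAt F E p.proj).continuousLinearMapAt ℝ q.proj (S q).1.1
  rw [Trivialization.continuousLinearMapAt_apply, Trivialization.coe_linearMapAt_of_mem _ h]
  rfl

theorem contMDiffAt_fstCoord {S : ∀ p, Prol G V A p}
    (hS : SmoothSection (I.prod 𝓘(ℝ, G)) (F × G) S) (p : TotalSpace G V) :
    ContMDiffAt (I.prod 𝓘(ℝ, G)) 𝓘(ℝ, F) ∞ (fstCoord S p.proj) p := by
  have h := contMDiffAt_coordAt (hS p) (FiberBundle.mem_baseSet_trivializationAt (F × G) _ p)
  have h1 : ContMDiffAt (I.prod 𝓘(ℝ, G)) 𝓘(ℝ, F) ∞ (fun q => (coordAt (F × G) p S q).1) p :=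
    contDiff_fst.contMDiff.contMDiffAt.comp p h
  exact h1.congr_of_eventuallyEq (fstCoord_eventuallyEq S p)

theorem mdifferentiableAt_fstCoord {S : ∀ p, Prol G V A p}
    (hS : SmoothSection (I.prod 𝓘(ℝ, G)) (F × G) S) (p : TotalSpace G V) :
    MDifferentiableAt (I.prod 𝓘(ℝ, G)) 𝓘(ℝ, F) (fstCoord S p.proj) p :=
  (contMDiffAt_fstCoord hS p).mdifferentiableAt (by simp)

theorem smoothSection_snd {S : ∀ p, Prol G V A p}
    (hS : SmoothSection (I.prod 𝓘(ℝ, G)) (F × G) S) :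
    SmoothSection (I.prod 𝓘(ℝ, G)) (EM × G)
      (fun q => ((S q).1.2 : TangentSpace (I.prod 𝓘(ℝ, G)) q)) :=
  smoothSection_anchor (prolong G V A) hS

/-- A section of the prolongation is smooth if both of its components are. -/
theorem contMDiffAt_prol {S : ∀ p, Prol G V A p} {p : TotalSpace G V}
    (h1 : ContMDiffAt (I.prod 𝓘(ℝ, G)) 𝓘(ℝ, F) ∞ (fstCoord S p.proj) p)
    (h2 : ContMDiffAt (I.prod 𝓘(ℝ, G)) ((I.prod 𝓘(ℝ, G)).prod 𝓘(ℝ, EM × G)) ∞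
      (fun q => TotalSpace.mk' (EM × G) q ((S q).1.2 : TangentSpace (I.prod 𝓘(ℝ, G)) q)) p) :
    ContMDiffAt (I.prod 𝓘(ℝ, G)) ((I.prod 𝓘(ℝ, G)).prod 𝓘(ℝ, F × G)) ∞
      (fun q => TotalSpace.mk' (F × G) q (S q)) p := by
  refine contMDiffAt_of_coordAt (FiberBundle.mem_baseSet_trivializationAt (F × G) _ p) ?_
  have hT := FiberBundle.mem_baseSet_trivializationAt (EM × G)
    (TangentSpace (I.prod 𝓘(ℝ, G)) : TotalSpace G V → Type _) p
  have h3 : ContMDiffAt (I.prod 𝓘(ℝ, G)) 𝓘(ℝ, G) ∞ (fun q => (coordAt (EM × G) p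
      (fun q => ((S q).1.2 : TangentSpace (I.prod 𝓘(ℝ, G)) q)) q).2) p :=
    contDiff_snd.contMDiff.contMDiffAt.comp p (contMDiffAt_coordAt h2 hT)
  refine (h1.prodMk_space h3).congr_of_eventuallyEq ?_
  filter_upwards [fstCoord_eventuallyEq S p, baseSet_mem_nhds (F := EM × G)
    (E := (TangentSpace (I.prod 𝓘(ℝ, G)) : TotalSpace G V → Type _)) p] with q e1 hq
  rw [e1, coordAt_eq_continuousLinearMapAt (E := (TangentSpace (I.prod 𝓘(ℝ, G)) :
    TotalSpace G V → Type _)) _ hq]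
  rfl

theorem fstCoord_add (S T : ∀ p, Prol G V A p) (p : TotalSpace G V) :
    fstCoord (S + T) p.proj =ᶠ[𝓝 p] fun q => fstCoord S p.proj q + fstCoord T p.proj q := by
  filter_upwards [fstCoord_eventuallyEq S p, fstCoord_eventuallyEq T p,
    fstCoord_eventuallyEq (S + T) p, mem_prolBase_nhds (A := A) p] with q h1 h2 h3 hq
  rw [h1, h2, h3, coordAt_add S T hq]
  rfl

theorem fstCoord_smul (f : TotalSpace G V → ℝ) (S : ∀ p, Prol G V A p) (p : TotalSpace G V) :
    fstCoord (fun q => f q • S q) p.proj =ᶠ[𝓝 p] fun q => f q • fstCoord S p.proj q := by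
  filter_upwards [fstCoord_eventuallyEq S p,
    fstCoord_eventuallyEq (fun q => f q • S q) p, mem_prolBase_nhds (A := A) p] with q h1 h3 hq
  rw [h1, h3, coordAt_smul f S hq]
  rfl

variable [FiniteDimensional ℝ EM] [I.Boundaryless] [T2Space M] [FiniteDimensional ℝ F]
  [FiniteDimensional ℝ G] [T2Space (TotalSpace G V)]

/-- Through every vector of the prolongation there is a section that projects to a section of `E`:
a section with constant coordinates has a first component with constant coordinates. -/
theorem projectsAt_localExt {p : TotalSpace G V} (u : Prol G V A p) :
    ProjectsAt (localExt (I.prod 𝓘(ℝ, G)) (F × G) u) (localExt I F (x := p.proj) u.1.1) p := by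
  have hπ : Filter.Tendsto (π G V) (𝓝 p) (𝓝 p.proj) :=
    (FiberBundle.continuous_proj G V).continuousAt
  filter_upwards [coordAt_localExt (I := I.prod 𝓘(ℝ, G)) (F := F × G) u,
    hπ.eventually (coordAt_localExt (I := I) (F := F) (x := p.proj) u.1.1),
    mem_prolBase_nhds (A := A) p, fstCoord_eventuallyEq (localExt (I.prod 𝓘(ℝ, G)) (F × G) u) p]
    with q h1 h2 hq h3
  have hp := FiberBundle.mem_baseSet_trivializationAt F E p.proj
  have e1 : fstCoord (localExt (I.prod 𝓘(ℝ, G)) (F × G) u) p.proj q =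
      (trivializationAt F E p.proj ⟨p.proj, u.1.1⟩).2 := by
    rw [h3, h1]
    change (trivializationAt F E p.proj).continuousLinearMapAt ℝ p.proj u.1.1 = _
    rw [Trivialization.continuousLinearMapAt_apply, Trivialization.coe_linearMapAt_of_mem _ hp]
  change coordAt F p.proj (localExt I F (x := p.proj) u.1.1) q.proj = _ at h2
  change _ = localExt I F (x := p.proj) u.1.1 q.proj
  have h4 := symm_coordAt (localExt I F (x := p.proj) u.1.1) (y := q.proj) hq.2
  rw [h2, ← e1] at h4
  rw [← h4]
  exact ((trivializationAt F E p.proj).symm_apply_apply_mk hq.2 _).symm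

theorem ProjectsAt.eventually {S : ∀ p, Prol G V A p} {X : ∀ x, E x} {p : TotalSpace G V}
    (h : ProjectsAt S X p) : ∀ᶠ q in 𝓝 p, ProjectsAt S X q :=
  Filter.Eventually.eventually_nhds h

theorem ProjectsAt.self {S : ∀ p, Prol G V A p} {X : ∀ x, E x} {p : TotalSpace G V}
    (h : ProjectsAt S X p) : (S p).1.1 = X p.proj := h.self_of_nhds

theorem ProjectsAt.dirDeriv_fstCoord {S : ∀ p, Prol G V A p} {X : ∀ x, E x} {p : TotalSpace G V}
    (h : ProjectsAt S X p) (hX : SmoothSection I F X) (w : Prol G V A p) :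
    dirDeriv (I.prod 𝓘(ℝ, G)) (fstCoord S p.proj) p w.1.2 =
      dirDeriv I (coordAt F p.proj X) p.proj (A.anchor p.proj w.1.1) := by
  have e : fstCoord S p.proj =ᶠ[𝓝 p] fun q => coordAt F p.proj X (π G V q) := by
    filter_upwards [h] with q hq
    simp only [fstCoord, hq]
    rfl
  rw [dirDeriv_congr e, dirDeriv_comp (J := I) (hX.mdifferentiableAt_coordAt
    (FiberBundle.mem_baseSet_trivializationAt F E p.proj)) (mdifferentiableAt_proj p),
    Prol.anchor_fst]

namespace IsSkewAlgebroid

variable (h : IsSkewAlgebroid A)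
include h

/-- The bracket of sections that project to `X` and `Y` projects to the bracket of `X` and `Y`. -/
theorem prolBracketFst_of_projectsAt {S T : ∀ p, Prol G V A p} {X Y : ∀ x, E x}
    {p : TotalSpace G V} (hX : SmoothSection I F X) (hY : SmoothSection I F Y)
    (hSX : ProjectsAt S X p) (hTY : ProjectsAt T Y p) :
    prolBracketFst G V A S T p = A.bracket X Y p.proj := by
  rw [prolBracketFst, hSX.dirDeriv_fstCoord hX, hTY.dirDeriv_fstCoord hY, hSX.self, hTY.self,
    h.bracket_eq hX hY, add_comm,
    Trivialization.symmL_apply (R := ℝ) _ (FiberBundle.mem_baseSet_trivializationAt F E p.proj)]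
  rfl

theorem bracket_localExt_skew {x : M} (u v : E x) :
    A.bracket (localExt I F u) (localExt I F v) x = -A.bracket (localExt I F v) (localExt I F u) x :=
  congrFun (h.skew _ _ (smooth_localExt u) (smooth_localExt v)) x

theorem bracket_localExt_add_right {x : M} (u v w : E x) :
    A.bracket (localExt I F u) (localExt I F (v + w)) x =
      A.bracket (localExt I F u) (localExt I F v) x +
        A.bracket (localExt I F u) (localExt I F w) x := by
  have hu := smooth_localExt (I := I) (F := F) u
  have hv := smooth_localExt (I := I) (F := F) v
  have hw := smooth_localExt (I := I) (F := F) w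
  rw [h.congr_right hu (smooth_localExt (v + w)) (hv.add hw) (localExt_add v w),
    h.add_right _ _ _ hu hv hw]
  rfl

theorem bracket_localExt_smul_right {x : M} (c : ℝ) (u v : E x) :
    A.bracket (localExt I F u) (localExt I F (c • v)) x =
      c • A.bracket (localExt I F u) (localExt I F v) x := by
  have hu := smooth_localExt (I := I) (F := F) u
  have hv := smooth_localExt (I := I) (F := F) v
  rw [h.congr_right hu (smooth_localExt (c • v)) (hv.const_smul c) (localExt_smul c v),
    h.smul_right c hu hv]
  rfl

theorem prolBracketFst_skew (S T : ∀ p, Prol G V A p) (p : TotalSpace G V) :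
    prolBracketFst G V A S T p = -prolBracketFst G V A T S p := by
  have hp := FiberBundle.mem_baseSet_trivializationAt F E p.proj
  rw [prolBracketFst, prolBracketFst, h.bracket_localExt_skew (x := p.proj) (S p).1.1,
    ← Trivialization.symmL_apply (R := ℝ) _ hp, ← Trivialization.symmL_apply (R := ℝ) _ hp,
    map_sub, map_sub]
  abel

theorem prolBracketFst_add_right {S T T' : ∀ p, Prol G V A p}
    (hT : SmoothSection (I.prod 𝓘(ℝ, G)) (F × G) T)
    (hT' : SmoothSection (I.prod 𝓘(ℝ, G)) (F × G) T') (p : TotalSpace G V) :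
    prolBracketFst G V A S (T + T') p =
      prolBracketFst G V A S T p + prolBracketFst G V A S T' p := by
  have hp := FiberBundle.mem_baseSet_trivializationAt F E p.proj
  have e1 : ((T + T') p).1.1 = (T p).1.1 + (T' p).1.1 := rfl
  have e2 : ((T + T') p).1.2 = (T p).1.2 + (T' p).1.2 := rfl
  simp only [prolBracketFst, e1, e2]
  rw [h.bracket_localExt_add_right (x := p.proj), dirDeriv_congr (fstCoord_add T T' p),
    dirDeriv_add (mdifferentiableAt_fstCoord hT p) (mdifferentiableAt_fstCoord hT' p),
    dirDeriv_vec_add]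
  simp only [← Trivialization.symmL_apply (R := ℝ) _ hp, map_sub, map_add]
  abel

theorem prolBracketFst_leibniz {S T : ∀ p, Prol G V A p} {f : TotalSpace G V → ℝ}
    (hT : SmoothSection (I.prod 𝓘(ℝ, G)) (F × G) T)
    (hf : ContMDiff (I.prod 𝓘(ℝ, G)) 𝓘(ℝ, ℝ) ∞ f) (p : TotalSpace G V) :
    prolBracketFst G V A S (fun q => f q • T q) p =
      f p • prolBracketFst G V A S T p +
        dirDeriv (I.prod 𝓘(ℝ, G)) f p (S p).1.2 • (T p).1.1 := by
  have hp := FiberBundle.mem_baseSet_trivializationAt F E p.proj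
  have e1 : (f p • T p).1.1 = f p • (T p).1.1 := rfl
  have e2 : (f p • T p).1.2 = f p • (T p).1.2 := rfl
  have e3 : (trivializationAt F E p.proj).symm p.proj (fstCoord T p.proj p) = (T p).1.1 :=
    (trivializationAt F E p.proj).symm_apply_apply_mk hp _
  simp only [prolBracketFst, e1, e2]
  rw [h.bracket_localExt_smul_right (x := p.proj), dirDeriv_congr (fstCoord_smul f T p),
    dirDeriv_smul (mdifferentiableAt_of_smooth hf p) (mdifferentiableAt_fstCoord hT p),
    dirDeriv_vec_smul]
  rw [← Trivialization.symmL_apply (R := ℝ) _ hp] at e3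
  simp only [← Trivialization.symmL_apply (R := ℝ) _ hp, map_sub, map_add, map_smul, e3]
  module

end IsSkewAlgebroid

namespace IsLieAlgebroid

variable (h : IsLieAlgebroid A)
include h

theorem dirDeriv_comp_proj {S : ∀ p, Prol G V A p} {X : ∀ x, E x} {p : TotalSpace G V}
    (hSX : ProjectsAt S X p) {f : M → ℝ} (hf : ContMDiff I 𝓘(ℝ, ℝ) ∞ f) :
    dirDeriv (I.prod 𝓘(ℝ, G)) (fun q => f (π G V q)) p (S p).1.2 =
      anchorDeriv A X f p.proj := by
  rw [dirDeriv_comp (J := I) (mdifferentiableAt_of_smooth hf _) (mdifferentiableAt_proj p),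
    Prol.anchor_fst, hSX.self]
  rfl

/-- The pair of the two components of the bracket lies in the prolongation. Consequently the bracket
of smooth sections of the prolongation is given by its formula and never by the default value. -/
theorem prolBracket_mem {S T : ∀ p, Prol G V A p}
    (hS : SmoothSection (I.prod 𝓘(ℝ, G)) (F × G) S)
    (hT : SmoothSection (I.prod 𝓘(ℝ, G)) (F × G) T) (p : TotalSpace G V) :
    A.anchor p.proj (prolBracketFst G V A S T p) =
      mfderiv (I.prod 𝓘(ℝ, G)) I (π G V) p
        (VectorField.mlieBracket (I.prod 𝓘(ℝ, G)) (fun q => (S q).1.2) (fun q => (T q).1.2) p) := by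
  have hc : CompleteSpace (EM × G) := FiniteDimensional.complete ℝ (EM × G)
  -- the defect `Φ` is tensorial in both arguments, which reduces the claim to projectable sections;
  -- for these it says that the anchor of `E` is a homomorphism
  let Φ : (∀ p, Prol G V A p) → (∀ p, Prol G V A p) → TangentSpace I p.proj := fun S T =>
    A.anchor p.proj (prolBracketFst G V A S T p) - mfderiv (I.prod 𝓘(ℝ, G)) I (π G V) p
      (VectorField.mlieBracket (I.prod 𝓘(ℝ, G)) (fun q => (S q).1.2) (fun q => (T q).1.2) p)
  have hskew : ∀ S T, Φ S T = -Φ T S := fun S T => by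
    simp only [Φ]
    rw [h.isSkewAlgebroid.prolBracketFst_skew, VectorField.mlieBracket_swap_apply, map_neg, map_neg]
    abel
  have hright : ∀ S T T', SmoothSection (I.prod 𝓘(ℝ, G)) (F × G) S →
      SmoothSection (I.prod 𝓘(ℝ, G)) (F × G) T → SmoothSection (I.prod 𝓘(ℝ, G)) (F × G) T' →
      T p = T' p → Φ S T = Φ S T' := by
    intro S T T' hS hT hT' hTT
    refine eq_of_tensorial (I := I.prod 𝓘(ℝ, G)) (F := F × G) (Φ := Φ S) ?_ ?_ hT hT' hTT
    · intro T T' hT hT'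
      have e : VectorField.mlieBracket (I.prod 𝓘(ℝ, G)) (fun q => (S q).1.2)
          (fun q => ((T + T') q).1.2) p = VectorField.mlieBracket (I.prod 𝓘(ℝ, G))
          (fun q => (S q).1.2) (fun q => (T q).1.2) p + VectorField.mlieBracket (I.prod 𝓘(ℝ, G))
          (fun q => (S q).1.2) (fun q => (T' q).1.2) p :=
        VectorField.mlieBracket_add_right
          ((smoothSection_snd hT p).mdifferentiableAt (by simp))
          ((smoothSection_snd hT' p).mdifferentiableAt (by simp))
      simp only [Φ]
      rw [h.isSkewAlgebroid.prolBracketFst_add_right hT hT', e, map_add, map_add]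
      abel
    · intro f T hf hT
      have e : VectorField.mlieBracket (I.prod 𝓘(ℝ, G)) (fun q => (S q).1.2)
          (fun q => (f q • T q).1.2) p = dirDeriv (I.prod 𝓘(ℝ, G)) f p (S p).1.2 • (T p).1.2 +
          f p • VectorField.mlieBracket (I.prod 𝓘(ℝ, G))
          (fun q => (S q).1.2) (fun q => (T q).1.2) p :=
        VectorField.mlieBracket_smul_right (mdifferentiableAt_of_smooth hf p)
          ((smoothSection_snd hT p).mdifferentiableAt (by simp))
      simp only [Φ]
      rw [h.isSkewAlgebroid.prolBracketFst_leibniz hT hf, e, map_add, map_add, map_smul, map_smul,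
        map_smul, map_smul, Prol.anchor_fst, smul_sub]
      abel
  have hproj : ∀ S T X Y, SmoothSection (I.prod 𝓘(ℝ, G)) (F × G) S →
      SmoothSection (I.prod 𝓘(ℝ, G)) (F × G) T → SmoothSection I F X → SmoothSection I F Y →
      ProjectsAt S X p → ProjectsAt T Y p → Φ S T = 0 := by
    intro S T X Y hS hT hX hY hSX hTY
    refine sub_eq_zero.2 (eq_of_dirDeriv_eq fun f hf => ?_)
    rw [h.isSkewAlgebroid.prolBracketFst_of_projectsAt hX hY hSX hTY]
    have hfπ : ContMDiff (I.prod 𝓘(ℝ, G)) 𝓘(ℝ, ℝ) ∞ (fun q => f (π G V q)) :=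
      hf.comp (Bundle.contMDiff_proj V)
    have e1 := dirDeriv_comp (I := I.prod 𝓘(ℝ, G)) (J := I) (g := π G V)
      (mdifferentiableAt_of_smooth hf _) (mdifferentiableAt_proj p)
      (VectorField.mlieBracket (I.prod 𝓘(ℝ, G)) (fun q => (S q).1.2) (fun q => (T q).1.2) p)
    refine Eq.trans ?_ e1
    rw [dirDeriv_mlieBracket hfπ (smoothSection_snd hS) (smoothSection_snd hT)]
    have e2 : ∀ (S T : ∀ p, Prol G V A p) (X Y : ∀ x, E x), SmoothSection I F Y →
        ProjectsAt S X p → ProjectsAt T Y p →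
        dirDeriv (I.prod 𝓘(ℝ, G)) (fun q => dirDeriv (I.prod 𝓘(ℝ, G)) (fun q => f (π G V q)) q
          (T q).1.2) p (S p).1.2 = anchorDeriv A X (anchorDeriv A Y f) p.proj := by
      intro S T X Y hY hSX hTY
      rw [← h.dirDeriv_comp_proj hSX (contMDiff_anchorDeriv A hY hf)]
      refine dirDeriv_congr ?_ _
      filter_upwards [hTY.eventually] with q hq using h.dirDeriv_comp_proj hq hf
    rw [e2 S T X Y hY hSX hTY, e2 T S Y X hX hTY hSX]
    exact h.anchorDeriv_bracket hX hY hf _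
  have hlS := smooth_localExt (I := I.prod 𝓘(ℝ, G)) (F := F × G) (S p)
  have hlT := smooth_localExt (I := I.prod 𝓘(ℝ, G)) (F := F × G) (T p)
  have h0 : Φ S T = 0 := by
    rw [hright S T _ hS hT hlT (localExt_self _).symm, hskew,
      hright _ S _ hlT hS hlS (localExt_self _).symm, hskew, neg_neg]
    exact hproj _ _ _ _ hlS hlT (smooth_localExt _) (smooth_localExt _) (projectsAt_localExt _)
      (projectsAt_localExt _)
  exact sub_eq_zero.1 h0

theorem prolBracket_val {S T : ∀ p, Prol G V A p}
    (hS : SmoothSection (I.prod 𝓘(ℝ, G)) (F × G) S)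
    (hT : SmoothSection (I.prod 𝓘(ℝ, G)) (F × G) T) (p : TotalSpace G V) :
    ((prolong G V A).bracket S T p).1 = (prolBracketFst G V A S T p,
      VectorField.mlieBracket (I.prod 𝓘(ℝ, G)) (fun q => (S q).1.2) (fun q => (T q).1.2) p) := by
  have hm := h.prolBracket_mem hS hT p
  have : (prolong G V A).bracket S T p = ⟨_, hm⟩ := dif_pos hm
  rw [this]

theorem isSkewAlgebroid_prolong : IsSkewAlgebroid (prolong G V A) where
  add_right S T T' hS hT hT' := by
    have hc : CompleteSpace (EM × G) := FiniteDimensional.complete ℝ (EM × G)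
    funext p
    refine Subtype.ext ?_
    rw [h.prolBracket_val hS (hT.add hT')]
    change _ = ((prolong G V A).bracket S T p).1 + ((prolong G V A).bracket S T' p).1
    rw [h.prolBracket_val hS hT, h.prolBracket_val hS hT']
    exact Prod.ext (h.isSkewAlgebroid.prolBracketFst_add_right hT hT' p)
      (VectorField.mlieBracket_add_right
          ((smoothSection_snd hT p).mdifferentiableAt (by simp))
          ((smoothSection_snd hT' p).mdifferentiableAt (by simp)))
  skew S T hS hT := by
    funext p
    refine Subtype.ext ?_
    rw [h.prolBracket_val hS hT]
    change _ = -((prolong G V A).bracket T S p).1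
    rw [h.prolBracket_val hT hS]
    exact Prod.ext (h.isSkewAlgebroid.prolBracketFst_skew S T p)
      VectorField.mlieBracket_swap_apply
  leibniz f S T hf hS hT p := by
    have hc : CompleteSpace (EM × G) := FiniteDimensional.complete ℝ (EM × G)
    refine Subtype.ext ?_
    rw [h.prolBracket_val hS (hT.smul hf)]
    change _ = f p • ((prolong G V A).bracket S T p).1 +
      dirDeriv (I.prod 𝓘(ℝ, G)) f p (S p).1.2 • (T p).1
    rw [h.prolBracket_val hS hT]
    refine Prod.ext (h.isSkewAlgebroid.prolBracketFst_leibniz hT hf p) ?_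
    refine (VectorField.mlieBracket_smul_right (mdifferentiableAt_of_smooth hf p)
          ((smoothSection_snd hT p).mdifferentiableAt (by simp))).trans ?_
    exact add_comm _ _

theorem projectsAt_bracket {S T : ∀ p, Prol G V A p} {X Y : ∀ x, E x}
    {p : TotalSpace G V} (hS : SmoothSection (I.prod 𝓘(ℝ, G)) (F × G) S)
    (hT : SmoothSection (I.prod 𝓘(ℝ, G)) (F × G) T)
    (hX : SmoothSection I F X) (hY : SmoothSection I F Y)
    (hSX : ProjectsAt S X p) (hTY : ProjectsAt T Y p) :
    ProjectsAt ((prolong G V A).bracket S T) (A.bracket X Y) p := by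
  filter_upwards [hSX.eventually, hTY.eventually] with q h1 h2
  rw [h.prolBracket_val hS hT, h.isSkewAlgebroid.prolBracketFst_of_projectsAt hX hY h1 h2]

theorem smooth_bracket_prolong {S T : ∀ p, Prol G V A p}
    (hS : SmoothSection (I.prod 𝓘(ℝ, G)) (F × G) S)
    (hT : SmoothSection (I.prod 𝓘(ℝ, G)) (F × G) T) :
    SmoothSection (I.prod 𝓘(ℝ, G)) (F × G) ((prolong G V A).bracket S T) := by
  have hc : CompleteSpace (EM × G) := FiniteDimensional.complete ℝ (EM × G)
  refine h.isSkewAlgebroid_prolong.smooth_bracket_of_localExt (fun p u v => ?_) hS hT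
  have hu := smooth_localExt (I := I.prod 𝓘(ℝ, G)) (F := F × G) u
  have hv := smooth_localExt (I := I.prod 𝓘(ℝ, G)) (F := F × G) v
  have hX := smooth_localExt (I := I) (F := F) (x := p.proj) u.1.1
  have hY := smooth_localExt (I := I) (F := F) (x := p.proj) v.1.1
  refine contMDiffAt_prol ?_ ?_
  · have h1 : ContMDiffAt (I.prod 𝓘(ℝ, G)) 𝓘(ℝ, F) ∞
        (fun q : TotalSpace G V => coordAt F p.proj (A.bracket (localExt I F (x := p.proj) u.1.1)
          (localExt I F (x := p.proj) v.1.1)) (π G V q)) p :=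
      (contMDiffAt_coordAt (h.smooth _ _ hX hY p.proj)
        (FiberBundle.mem_baseSet_trivializationAt F E p.proj)).comp p
        (Bundle.contMDiff_proj V).contMDiffAt
    refine h1.congr_of_eventuallyEq ?_
    filter_upwards [h.projectsAt_bracket hu hv hX hY (projectsAt_localExt u)
      (projectsAt_localExt v)] with q hq
    simp only [fstCoord, hq]
    rfl
  · have hm : IsManifold (I.prod 𝓘(ℝ, G)) (minSmoothness ℝ 2) (TotalSpace G V) :=
      IsManifold.of_le (n := ∞) (by simpa using ENat.LEInfty.out)
    have hm' : IsManifold (I.prod 𝓘(ℝ, G)) (((⊤ : ℕ∞) : WithTop ℕ∞) + 1) (TotalSpace G V) :=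
      IsManifold.of_le (n := ∞) le_rfl
    have h2 := ContMDiffAt.mlieBracket_vectorField (m := ⊤) (n := ⊤) (smoothSection_snd hu p)
      (smoothSection_snd hv p) (by simp)
    refine h2.congr_of_eventuallyEq (Filter.Eventually.of_forall fun q => ?_)
    exact congrArg (fun w : E q.proj × TangentSpace (I.prod 𝓘(ℝ, G)) q =>
      TotalSpace.mk' (EM × G) q w.2) (h.prolBracket_val hu hv q)

/-- For the prolongation, the anchor is a homomorphism by the definition of the bracket, whose second
component is the Lie bracket of vector fields. The Jacobi identity is not used. -/
theorem prolong_anchorDeriv_bracket {S T : ∀ p, Prol G V A p}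
    (hS : SmoothSection (I.prod 𝓘(ℝ, G)) (F × G) S)
    (hT : SmoothSection (I.prod 𝓘(ℝ, G)) (F × G) T) {f : TotalSpace G V → ℝ}
    (hf : ContMDiff (I.prod 𝓘(ℝ, G)) 𝓘(ℝ, ℝ) ∞ f) (p : TotalSpace G V) :
    anchorDeriv (prolong G V A) ((prolong G V A).bracket S T) f p =
      anchorDeriv (prolong G V A) S (anchorDeriv (prolong G V A) T f) p -
        anchorDeriv (prolong G V A) T (anchorDeriv (prolong G V A) S f) p := by
  refine Eq.trans ?_ (dirDeriv_mlieBracket hf (smoothSection_snd hS) (smoothSection_snd hT) p)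
  exact congrArg (fun w : E p.proj × TangentSpace (I.prod 𝓘(ℝ, G)) p =>
      dirDeriv (I.prod 𝓘(ℝ, G)) f p w.2) (h.prolBracket_val hS hT p)

/-- The anchor of the prolongation is a homomorphism, so its Jacobiator is tensorial; on projectable
sections the two components of the Jacobiator are those of `E` and of the vector fields. -/
theorem jacobiator_prolong {S T U : ∀ p, Prol G V A p}
    (hS : SmoothSection (I.prod 𝓘(ℝ, G)) (F × G) S)
    (hT : SmoothSection (I.prod 𝓘(ℝ, G)) (F × G) T)
    (hU : SmoothSection (I.prod 𝓘(ℝ, G)) (F × G) U) (p : TotalSpace G V) :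
    jacobiator (prolong G V A) S T U p = 0 := by
  have hc : CompleteSpace (EM × G) := FiniteDimensional.complete ℝ (EM × G)
  -- it suffices to consider sections that project to sections of `E`
  suffices key : ∀ (S T U : ∀ p, Prol G V A p) (X Y Z : ∀ x, E x),
      SmoothSection (I.prod 𝓘(ℝ, G)) (F × G) S → SmoothSection (I.prod 𝓘(ℝ, G)) (F × G) T →
      SmoothSection (I.prod 𝓘(ℝ, G)) (F × G) U → SmoothSection I F X → SmoothSection I F Y →
      SmoothSection I F Z → ProjectsAt S X p → ProjectsAt T Y p → ProjectsAt U Z p →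
      jacobiator (prolong G V A) S T U p = 0 by
    rw [h.isSkewAlgebroid_prolong.jacobiator_congr (fun S T hS hT => h.smooth_bracket_prolong hS hT)
      (fun S T hS hT f hf p => h.prolong_anchorDeriv_bracket hS hT hf p) hS
      (smooth_localExt (S p)) hT (smooth_localExt (T p)) hU (smooth_localExt (U p))
      (localExt_self _).symm (localExt_self _).symm (localExt_self _).symm]
    exact key _ _ _ _ _ _ (smooth_localExt _) (smooth_localExt _) (smooth_localExt _)
      (smooth_localExt _) (smooth_localExt _) (smooth_localExt _) (projectsAt_localExt _)
      (projectsAt_localExt _) (projectsAt_localExt _)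
  intro S T U X Y Z hS hT hU hX hY hZ hSX hTY hUZ
  have hTU := h.smooth_bracket_prolong hT hU
  have hSU := h.smooth_bracket_prolong hS hU
  have hST := h.smooth_bracket_prolong hS hT
  have e : ∀ S T : ∀ p, Prol G V A p, SmoothSection (I.prod 𝓘(ℝ, G)) (F × G) S →
      SmoothSection (I.prod 𝓘(ℝ, G)) (F × G) T →
      (fun q => (((prolong G V A).bracket S T q).1.2 : TangentSpace (I.prod 𝓘(ℝ, G)) q)) =
      VectorField.mlieBracket (I.prod 𝓘(ℝ, G)) (fun q => (S q).1.2) (fun q => (T q).1.2) :=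
    fun S T hS hT => funext fun q => congrArg Prod.snd (h.prolBracket_val hS hT q)
  refine Subtype.ext (Prod.ext ?_ ?_)
  · change ((prolong G V A).bracket S ((prolong G V A).bracket T U) p).1.1 -
      ((prolong G V A).bracket T ((prolong G V A).bracket S U) p).1.1 -
      ((prolong G V A).bracket ((prolong G V A).bracket S T) U p).1.1 = 0
    rw [(h.projectsAt_bracket hS hTU hX (h.smooth _ _ hY hZ) hSX
        (h.projectsAt_bracket hT hU hY hZ hTY hUZ)).self,
      (h.projectsAt_bracket hT hSU hY (h.smooth _ _ hX hZ) hTY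
        (h.projectsAt_bracket hS hU hX hZ hSX hUZ)).self,
      (h.projectsAt_bracket hST hU (h.smooth _ _ hX hY) hZ
        (h.projectsAt_bracket hS hT hX hY hSX hTY) hUZ).self]
    change jacobiator A X Y Z p.proj = 0
    rw [← h.isSkewAlgebroid.cyclic_sum_eq_jacobiator h.smooth hX hY hZ, h.jacobi _ _ _ hX hY hZ]
    rfl
  · change ((prolong G V A).bracket S ((prolong G V A).bracket T U) p).1.2 -
      ((prolong G V A).bracket T ((prolong G V A).bracket S U) p).1.2 -
      ((prolong G V A).bracket ((prolong G V A).bracket S T) U p).1.2 = 0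
    rw [h.prolBracket_val hS hTU, h.prolBracket_val hT hSU, h.prolBracket_val hST hU]
    dsimp only
    rw [e T U hT hU, e S U hS hU, e S T hS hT]
    have hm : minSmoothness ℝ 2 ≤ ∞ := by simpa using ENat.LEInfty.out
    have hm' : IsManifold (I.prod 𝓘(ℝ, G)) (minSmoothness ℝ 3) (TotalSpace G V) :=
      IsManifold.of_le (n := ∞) (by simpa using ENat.LEInfty.out)
    have hj := VectorField.leibniz_identity_mlieBracket_apply
      ((smoothSection_snd hS p).of_le hm) ((smoothSection_snd hT p).of_le hm)
      ((smoothSection_snd hU p).of_le hm)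
    rw [hj]
    abel

theorem prolong_isLieAlgebroid : IsLieAlgebroid (prolong G V A) where
  smooth _ _ hS hT := h.smooth_bracket_prolong hS hT
  add_right := h.isSkewAlgebroid_prolong.add_right
  smul_right c _ _ hS hT := h.isSkewAlgebroid_prolong.smul_right c hS hT
  skew := h.isSkewAlgebroid_prolong.skew
  jacobi S T U hS hT hU := by
    rw [h.isSkewAlgebroid_prolong.cyclic_sum_eq_jacobiator
      (fun _ _ hS hT => h.smooth_bracket_prolong hS hT) hS hT hU]
    exact funext fun p => h.jacobiator_prolong hS hT hU p
  leibniz := h.isSkewAlgebroid_prolong.leibniz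

end IsLieAlgebroid

end Prolongation

/-! ### Tangent vectors to the total space of a vector bundle -/

section FiberComp

variable {EM : Type*} [NormedAddCommGroup EM] [NormedSpace ℝ EM]
  {HM : Type*} [TopologicalSpace HM] {I : ModelWithCorners ℝ EM HM}
  {M : Type*} [TopologicalSpace M] [ChartedSpace HM M] [IsManifold I ∞ M]
  {G : Type*} [NormedAddCommGroup G] [NormedSpace ℝ G]
  {V : M → Type*} [TopologicalSpace (TotalSpace G V)] [∀ x, TopologicalSpace (V x)]
  [∀ x, AddCommGroup (V x)] [∀ x, Module ℝ (V x)]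
  [FiberBundle G V] [VectorBundle ℝ G V] [ContMDiffVectorBundle ∞ G V I]

/-- The fibre component of a tangent vector at `p` to the total space of a vector bundle, in the
trivialization at the base point of `p`. -/
def fiberComp (p : TotalSpace G V) (v : TangentSpace (I.prod 𝓘(ℝ, G)) p) : G :=
  dirDeriv (I.prod 𝓘(ℝ, G)) (fun q : TotalSpace G V => (trivializationAt G V p.proj q).2) p v

theorem contMDiffAt_trivializationAt_snd (x : M) {p : TotalSpace G V}
    (hp : p.proj ∈ (trivializationAt G V x).baseSet) :
    ContMDiffAt (I.prod 𝓘(ℝ, G)) 𝓘(ℝ, G) ∞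
      (fun q : TotalSpace G V => (trivializationAt G V x q).2) p :=
  (((trivializationAt G V x).contMDiffAt_iff ((trivializationAt G V x).mem_source.2 hp)).1
    (contMDiffAt_id (I := I.prod 𝓘(ℝ, G)) (n := ∞))).2

theorem mdifferentiableAt_trivializationAt_snd (p : TotalSpace G V) :
    MDifferentiableAt (I.prod 𝓘(ℝ, G)) 𝓘(ℝ, G)
      (fun q : TotalSpace G V => (trivializationAt G V p.proj q).2) p :=
  (contMDiffAt_trivializationAt_snd p.proj
    (FiberBundle.mem_baseSet_trivializationAt G V p.proj)).mdifferentiableAt (by simp)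

theorem fiberComp_add (p : TotalSpace G V) (v w : TangentSpace (I.prod 𝓘(ℝ, G)) p) :
    fiberComp p (v + w) = fiberComp p v + fiberComp p w := dirDeriv_vec_add _ _ _ _

theorem fiberComp_smul (p : TotalSpace G V) (c : ℝ) (v : TangentSpace (I.prod 𝓘(ℝ, G)) p) :
    fiberComp p (c • v) = c • fiberComp p v := dirDeriv_vec_smul _ _ _ _

theorem snd_clmAt_tangent (p : TotalSpace G V) (v : TangentSpace (I.prod 𝓘(ℝ, G)) p) :
    ((trivializationAt (EM × G) (TangentSpace (I.prod 𝓘(ℝ, G))) p).continuousLinearMapAt ℝ p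
      v).2 = fiberComp p v := by
  have hp : p ∈ (chartAt (ModelProd HM G) p).source := mem_chart_source _ p
  rw [TangentBundle.continuousLinearMapAt_trivializationAt hp]
  have h1 : MDifferentiableAt (I.prod 𝓘(ℝ, G)) 𝓘(ℝ, EM × G)
    (extChartAt (I.prod 𝓘(ℝ, G)) p) p := mdifferentiableAt_extChartAt hp
  refine (dirDeriv_clm (ContinuousLinearMap.snd ℝ EM G) h1 v).symm.trans ?_
  refine dirDeriv_congr ?_ v
  filter_upwards [(chartAt (ModelProd HM G) p).open_source.mem_nhds hp] with q hq
  have hq' := (mem_chartAt_source_iff G V).1 hq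
  simp only [extChartAt, FiberBundle.chartedSpace_chartAt, mfld_simps]
  rfl

/-- A tangent vector to the total space is determined by its projection to the base and by its
fibre component. -/
theorem ext_of_fiberComp {p : TotalSpace G V} {v w : TangentSpace (I.prod 𝓘(ℝ, G)) p}
    (h1 : mfderiv (I.prod 𝓘(ℝ, G)) I (π G V) p v = mfderiv (I.prod 𝓘(ℝ, G)) I (π G V) p w)
    (h2 : fiberComp p v = fiberComp p w) : v = w := by
  have hp : p ∈ (chartAt (ModelProd HM G) p).source := mem_chart_source _ p
  have hT : p ∈ (trivializationAt (EM × G)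
    (TangentSpace (I.prod 𝓘(ℝ, G)) : TotalSpace G V → Type _) p).baseSet := hp
  have e : (trivializationAt (EM × G) (TangentSpace (I.prod 𝓘(ℝ, G))) p).continuousLinearMapAt ℝ p
      v = (trivializationAt (EM × G) (TangentSpace (I.prod 𝓘(ℝ, G))) p).continuousLinearMapAt ℝ p
      w := by
    refine Prod.ext ?_ ?_
    · rw [← fst_clmAt_tangent G V hp, ← fst_clmAt_tangent G V hp, h1]
    · rw [snd_clmAt_tangent, snd_clmAt_tangent, h2]
  rw [← Trivialization.symmL_continuousLinearMapAt (R := ℝ) _ hT v, e]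
  exact Trivialization.symmL_continuousLinearMapAt (R := ℝ) _ hT w

/-- The tangent vector to the total space with given projection and fibre component. -/
theorem exists_fiberComp_eq (p : TotalSpace G V) (t : TangentSpace I p.proj) (g : G) :
    ∃ v : TangentSpace (I.prod 𝓘(ℝ, G)) p,
      mfderiv (I.prod 𝓘(ℝ, G)) I (π G V) p v = t ∧ fiberComp p v = g := by
  have hp : p ∈ (chartAt (ModelProd HM G) p).source := mem_chart_source _ p
  have hT : p ∈ (trivializationAt (EM × G)
    (TangentSpace (I.prod 𝓘(ℝ, G)) : TotalSpace G V → Type _) p).baseSet := hp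
  have hM : p.proj ∈ (trivializationAt EM (TangentSpace I) p.proj).baseSet :=
    FiberBundle.mem_baseSet_trivializationAt EM (TangentSpace I) p.proj
  let z : EM × G := ((trivializationAt EM (TangentSpace I) p.proj).continuousLinearMapAt ℝ p.proj t,
    g)
  let v : TangentSpace (I.prod 𝓘(ℝ, G)) p :=
    (trivializationAt (EM × G) (TangentSpace (I.prod 𝓘(ℝ, G))) p).symmL ℝ p z
  have hv : (trivializationAt (EM × G) (TangentSpace (I.prod 𝓘(ℝ, G))) p).continuousLinearMapAt ℝ p
      v = z := Trivialization.continuousLinearMapAt_symmL (R := ℝ) _ hT z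
  refine ⟨v, ?_, by rw [← snd_clmAt_tangent, hv]⟩
  have h1 := fst_clmAt_tangent (I := I) G V hp v
  rw [hv] at h1
  have h2 := congrArg ((trivializationAt EM (TangentSpace I) p.proj).symmL ℝ p.proj) h1
  rw [Trivialization.symmL_continuousLinearMapAt _ hM] at h2
  rw [h2]
  exact Trivialization.symmL_continuousLinearMapAt _ hM t

end FiberComp

/-! ### The canonical symplectic section -/

section Canonical

variable {EM : Type*} [NormedAddCommGroup EM] [NormedSpace ℝ EM]
  {HM : Type*} [TopologicalSpace HM] {I : ModelWithCorners ℝ EM HM}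
  {M : Type*} [TopologicalSpace M] [ChartedSpace HM M] [IsManifold I ∞ M]
  {F : Type*} [NormedAddCommGroup F] [NormedSpace ℝ F]
  {E : M → Type*} [TopologicalSpace (TotalSpace F E)] [∀ x, TopologicalSpace (E x)]
  [∀ x, AddCommGroup (E x)] [∀ x, Module ℝ (E x)]
  [FiberBundle F E] [VectorBundle ℝ F E] [ContMDiffVectorBundle ∞ F E I]
  {A : AlgebroidData I F E}

/-- The fibrewise linear function on `E*` defined by a section of `E`. -/
def fiberLinear (X : ∀ x, E x) (p : DualSpace F E) : ℝ := p.2 (X p.proj)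

theorem contMDiff_fiberLinear {X : ∀ x, E x} (hX : SmoothSection I F X) :
    ContMDiff (dualModel I F) 𝓘(ℝ, ℝ) ∞ (fiberLinear (F := F) X) := by
  have h1 : ContMDiff (dualModel I F) (I.prod 𝓘(ℝ, F)) ∞
      (fun p : DualSpace F E => TotalSpace.mk' F (E := E) p.proj (X p.proj)) :=
    hX.comp (Bundle.contMDiff_proj (Dual E) (n := ∞) (IB := I))
  have h := ContMDiff.clm_bundle_apply (F₁ := F) (E₁ := E) (F₂ := ℝ) (E₂ := Bundle.Trivial M ℝ)
    (IM := dualModel I F) (M := DualSpace F E) (n := ∞)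
    (b := fun p => p.proj) (ϕ := fun p => p.2) contMDiff_id h1
  intro p
  have h2 := ((trivializationAt ℝ (Bundle.Trivial M ℝ) p.proj).contMDiffAt_iff
    ((trivializationAt ℝ (Bundle.Trivial M ℝ) p.proj).mem_source.2
      (FiberBundle.mem_baseSet_trivializationAt ℝ _ p.proj))).1 (h p)
  exact h2.2

theorem Trivial.continuousLinearMapAt_apply_self {B : Type*} [TopologicalSpace B] (x y : B)
    (r : ℝ) : (trivializationAt ℝ (Bundle.Trivial B ℝ) x).continuousLinearMapAt ℝ y r = r := by
  rw [Trivialization.continuousLinearMapAt_apply, Trivialization.coe_linearMapAt_of_mem _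
    (by exact mem_univ y)]
  rfl

theorem trivializationAt_dual_snd {x : M} {p : DualSpace F E} :
    (trivializationAt (F →L[ℝ] ℝ) (Dual E) x p).2 =
      p.2 ∘L (trivializationAt F E x).symmL ℝ p.proj := by
  refine ContinuousLinearMap.ext fun z => ?_
  exact Trivial.continuousLinearMapAt_apply_self x p.proj _

theorem fiberLinear_eq {x : M} (X : ∀ x, E x) {p : DualSpace F E}
    (hp : p.proj ∈ (trivializationAt F E x).baseSet) :
    fiberLinear X p = (trivializationAt (F →L[ℝ] ℝ) (Dual E) x p).2 (coordAt F x X p.proj) := by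
  rw [trivializationAt_dual_snd, ContinuousLinearMap.comp_apply,
    Trivialization.symmL_apply (R := ℝ) _ hp, symm_coordAt X hp]
  rfl

/-- In the trivializations of the prolongation and of `E*` at `p₀`, the Liouville section is
`(p, (b, v)) ↦ p(b)` with the fibre coordinate of `p`, which is smooth. -/
theorem smooth_liouville (A : AlgebroidData I F E) :
    SmoothDualSection (dualModel I F) (F × (F →L[ℝ] ℝ)) (liouville A) := by
  intro p₀
  have hbase := FiberBundle.mem_baseSet_trivializationAt F E p₀.proj
  have h := contMDiffAt_trivializationAt_snd (I := I) (V := Dual E) p₀.proj (p := p₀)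
    (FiberBundle.mem_baseSet_trivializationAt (F →L[ℝ] ℝ) (Dual E) p₀.proj)
  refine (contMDiffAt_hom_bundle (F₂ := ℝ) (E₂ := Bundle.Trivial (DualSpace F E) ℝ) _).2
    ⟨contMDiffAt_id, ?_⟩
  have h2 := h.clm_comp (contMDiffAt_const (c := ContinuousLinearMap.fst ℝ F (F →L[ℝ] ℝ)))
  refine h2.congr_of_eventuallyEq ?_
  filter_upwards [mem_prolBase_nhds (A := A) p₀] with p hp
  refine ContinuousLinearMap.ext fun z => ?_
  have hb : p ∈ (trivializationAt (F × (F →L[ℝ] ℝ)) (CoProl A) p₀).baseSet := hp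
  have hs : (trivializationAt (F × (F →L[ℝ] ℝ)) (CoProl A) p₀).symmL ℝ p z =
      prolMk (F →L[ℝ] ℝ) (Dual E) A p₀ p z := by
    rw [Trivialization.symmL_apply _ hb]
    exact prolPretriv_symm_apply _ _ A hp z
  refine (Trivial.continuousLinearMapAt_apply_self p₀ p _).trans ?_
  change liouville A p ((trivializationAt (F × (F →L[ℝ] ℝ)) (CoProl A) p₀).symmL ℝ p z) = _
  rw [hs, trivializationAt_dual_snd]
  exact congrArg (fun w : E p.proj × TangentSpace (dualModel I F) p => p.2 w.1)
    (prolMk_val (F →L[ℝ] ℝ) (Dual E) A hp.1 z)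

variable [FiniteDimensional ℝ EM] [I.Boundaryless] [T2Space M] [FiniteDimensional ℝ F]

theorem dirDeriv_fiberLinear_localExt {p : DualSpace F E} (b : E p.proj)
    (v : TangentSpace (dualModel I F) p) :
    dirDeriv (dualModel I F) (fiberLinear (localExt I F b)) p v =
      fiberComp p v (trivializationAt F E p.proj ⟨p.proj, b⟩).2 := by
  have hπ : Filter.Tendsto (π (F →L[ℝ] ℝ) (Dual E)) (𝓝 p) (𝓝 p.proj) :=
    (FiberBundle.continuous_proj (F →L[ℝ] ℝ) (Dual E)).continuousAt
  have e : fiberLinear (localExt I F b) =ᶠ[𝓝 p] fun q =>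
      (ContinuousLinearMap.apply ℝ ℝ (trivializationAt F E p.proj ⟨p.proj, b⟩).2)
        (trivializationAt (F →L[ℝ] ℝ) (Dual E) p.proj q).2 := by
    filter_upwards [hπ.eventually (coordAt_localExt (I := I) (F := F) b),
      hπ.eventually (baseSet_mem_nhds (F := F) (E := E) p.proj)] with q h1 h2
    rw [fiberLinear_eq _ h2]
    exact congrArg _ h1
  rw [dirDeriv_congr e, dirDeriv_clm _ (mdifferentiableAt_trivializationAt_snd p)]
  rfl

/-- For `w = (Y, v)` in the prolongation at `p`, the expression `v(X) + p(⟦X, Y⟧)`, where `v` acts on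
the fibrewise linear function of `X`, is tensorial in `X`: the two Leibniz terms cancel because `v`
projects to `ρ(Y)`. -/
theorem IsSkewAlgebroid.dirDeriv_fiberLinear_congr (h : IsSkewAlgebroid A) {p : DualSpace F E}
    (w : CoProl A p) {X X' Y : ∀ x, E x} (hX : SmoothSection I F X) (hX' : SmoothSection I F X')
    (hY : SmoothSection I F Y) (hw : w.1.1 = Y p.proj) (hXX : X p.proj = X' p.proj) :
    dirDeriv (dualModel I F) (fiberLinear X) p w.1.2 + p.2 (A.bracket X Y p.proj) =
      dirDeriv (dualModel I F) (fiberLinear X') p w.1.2 + p.2 (A.bracket X' Y p.proj) := by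
  refine eq_of_tensorial (I := I) (F := F) (Φ := fun X => dirDeriv (dualModel I F) (fiberLinear X) p
    w.1.2 + p.2 (A.bracket X Y p.proj)) ?_ ?_ hX hX' hXX
  · intro X X' hX hX'
    have e : fiberLinear (F := F) (X + X') = fun q => fiberLinear X q + fiberLinear X' q :=
      funext fun q => map_add q.2 _ _
    rw [e, dirDeriv_add (mdifferentiableAt_of_smooth (contMDiff_fiberLinear hX) p)
      (mdifferentiableAt_of_smooth (contMDiff_fiberLinear hX') p), h.add_left hX hX' hY,
      Pi.add_apply, map_add]
    ring
  · intro f X hf hX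
    have e : fiberLinear (F := F) (fun y => f y • X y) =
        fun q => f (π _ _ q) * fiberLinear X q :=
      funext fun q => map_smul q.2 _ _
    have e2 := dirDeriv_comp (I := dualModel I F) (J := I) (g := π _ _)
      (mdifferentiableAt_of_smooth hf p.proj) (mdifferentiableAt_proj p) w.1.2
    have e3 := Prol.anchor_fst w
    have hf' : ContMDiff (dualModel I F) 𝓘(ℝ, ℝ) ∞ fun q : DualSpace F E => f q.proj :=
      hf.comp (Bundle.contMDiff_proj (Dual E))
    have e4 := dirDeriv_mul (mdifferentiableAt_of_smooth hf' p)
      (mdifferentiableAt_of_smooth (contMDiff_fiberLinear hX) p) w.1.2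
    have e5 : dirDeriv (dualModel I F) (fun q : DualSpace F E => f q.proj) p w.1.2 =
        dirDeriv I f p.proj (A.anchor p.proj (Y p.proj)) :=
      e2.trans (congrArg _ (e3.trans (congrArg _ hw)))
    rw [e, e4, h.leibniz_left hf hX hY, map_sub, map_smul, map_smul, e5]
    simp only [anchorDeriv, smul_eq_mul, fiberLinear]
    ring

variable (h : IsLieAlgebroid A)
include h

/-- The value of the canonical section, computed with sections of `E` through the first
components. -/
theorem IsLieAlgebroid.canonicalSection_apply {p : DualSpace F E} (u w : CoProl A p)
    {X Y : ∀ x, E x} (hX : SmoothSection I F X) (hY : SmoothSection I F Y)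
    (hu : u.1.1 = X p.proj) (hw : w.1.1 = Y p.proj) :
    canonicalSection A p u w = -dirDeriv (dualModel I F) (fiberLinear Y) p u.1.2 +
      dirDeriv (dualModel I F) (fiberLinear X) p w.1.2 + p.2 (A.bracket X Y p.proj) := by
  have ht : T2Space (DualSpace F E) := t2Space_totalSpace
  have hsk := h.isSkewAlgebroid
  have hL : IsLieAlgebroid (coProlong A) := h.prolong_isLieAlgebroid
  have hS := smooth_localExt (I := dualModel I F) (F := F × (F →L[ℝ] ℝ)) u
  have hT := smooth_localExt (I := dualModel I F) (F := F × (F →L[ℝ] ℝ)) w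
  have hX0 := smooth_localExt (I := I) (F := F) (x := p.proj) u.1.1
  have hY0 := smooth_localExt (I := I) (F := F) (x := p.proj) w.1.1
  have hSX := projectsAt_localExt u
  have hTY := projectsAt_localExt w
  have e1 := hL.isSkewAlgebroid.d1_apply (smooth_liouville A) hS hT p
  have e2 : ∀ (v : CoProl A p), (fun q => liouville A q (localExt (dualModel I F)
      (F × (F →L[ℝ] ℝ)) v q)) =ᶠ[𝓝 p] fiberLinear (localExt I F (x := p.proj) v.1.1) := by
    intro v
    filter_upwards [projectsAt_localExt v] with q hq
    exact congrArg q.2 hq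
  have e3 : liouville A p ((coProlong A).bracket (localExt (dualModel I F) (F × (F →L[ℝ] ℝ)) u)
      (localExt (dualModel I F) (F × (F →L[ℝ] ℝ)) w) p) =
      p.2 (A.bracket (localExt I F (x := p.proj) u.1.1) (localExt I F (x := p.proj) w.1.1)
        p.proj) :=
    congrArg p.2 (h.projectsAt_bracket hS hT hX0 hY0 hSX hTY).self
  simp only [anchorDeriv] at e1
  rw [e3, dirDeriv_congr (e2 u), dirDeriv_congr (e2 w), localExt_self, localExt_self] at e1
  have e4 := hsk.dirDeriv_fiberLinear_congr w hX hX0 hY hw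
    (hu.symm.trans (localExt_self (I := I) (F := F) (x := p.proj) _).symm)
  have e5 := hsk.dirDeriv_fiberLinear_congr u hY hY0 hX0
    (localExt_self (I := I) (F := F) (x := p.proj) _).symm
    (hw.symm.trans (localExt_self (I := I) (F := F) (x := p.proj) _).symm)
  rw [hsk.skew _ _ hY hX0, hsk.skew _ _ hY0 hX0] at e5
  simp only [Pi.neg_apply, map_neg] at e5
  have e6 : canonicalSection A p u w = -(dirDeriv (dualModel I F)
      (fiberLinear (localExt I F (x := p.proj) w.1.1)) p u.1.2 - dirDeriv (dualModel I F)
      (fiberLinear (localExt I F (x := p.proj) u.1.1)) p w.1.2 - p.2 (A.bracket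
        (localExt I F (x := p.proj) u.1.1) (localExt I F (x := p.proj) w.1.1) p.proj)) :=
    congrArg Neg.neg e1
  rw [e6]
  linarith

/-- In coordinates the matrix of the canonical section has zero vertical block and, up to sign, the
identity as mixed block. -/
theorem IsLieAlgebroid.canonicalSection_nondegenerate {p : DualSpace F E} (u : CoProl A p)
    (hu : ∀ w, canonicalSection A p u w = 0) : u = 0 := by
  have hx := FiberBundle.mem_baseSet_trivializationAt F E p.proj
  have hz : SmoothSection I F (0 : ∀ x, E x) := smoothSection_zero
  have h0 : ∀ v : TangentSpace (dualModel I F) p,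
      dirDeriv (dualModel I F) (fiberLinear (0 : ∀ x, E x)) p v = 0 := fun v => by
    have : fiberLinear (F := F) (0 : ∀ x, E x) = fun _ => 0 := funext fun q => map_zero q.2
    rw [this, dirDeriv_const]
  -- pairing with vertical vectors shows that the first component vanishes
  have h1 : u.1.1 = 0 := by
    have hc : (trivializationAt F E p.proj ⟨p.proj, u.1.1⟩).2 = 0 := by
      refine SeparatingDual.eq_zero_of_forall_dual_eq_zero (R := ℝ) fun g => ?_
      obtain ⟨v, hv1, hv2⟩ := exists_fiberComp_eq (I := I) p 0 g
      have hm : ((0 : E p.proj), v) ∈ prolFiber (dualModel I F) A (π (F →L[ℝ] ℝ) (Dual E)) p := by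
        rw [mem_prolFiber, hv1, map_zero]
      have e := (hu ⟨_, hm⟩).symm.trans <| h.canonicalSection_apply u ⟨_, hm⟩ (smooth_localExt (x := p.proj) u.1.1) hz
        (localExt_self (I := I) (F := F) (x := p.proj) _).symm rfl
      rw [h0, h.isSkewAlgebroid.zero_right (smooth_localExt _)] at e
      have e2 := dirDeriv_fiberLinear_localExt (I := I) (p := p) u.1.1 v
      rw [hv2] at e2
      rw [← e2]
      simpa using e.symm
    have := (trivializationAt F E p.proj).symm_apply_apply_mk hx u.1.1
    have e : (trivializationAt F E p.proj ⟨p.proj, u.1.1⟩) = (p.proj, 0) :=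
      Prod.ext ((trivializationAt F E p.proj).coe_fst' hx) hc
    rw [e] at this
    rw [← this]
    exact ((trivializationAt F E p.proj).symmL_apply (R := ℝ) hx 0).symm.trans
      (ContinuousLinearMap.map_zero _)
  -- then `u` is vertical, and pairing with vectors over arbitrary elements of `E` shows that its
  -- fibre component vanishes
  have h2 : u.1.2 = 0 := by
    refine ext_of_fiberComp ?_ ?_
    · refine (Prol.anchor_fst u).trans ?_
      rw [h1]
      exact (ContinuousLinearMap.map_zero _).trans (ContinuousLinearMap.map_zero _).symm
    · refine ContinuousLinearMap.ext fun z => ?_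
      let b : E p.proj := (trivializationAt F E p.proj).symm p.proj z
      obtain ⟨v, hv1, -⟩ := exists_fiberComp_eq (I := I) p (A.anchor p.proj b) 0
      have hm : (b, v) ∈ prolFiber (dualModel I F) A (π (F →L[ℝ] ℝ) (Dual E)) p := by
        rw [mem_prolFiber, hv1]
      have e := (hu ⟨_, hm⟩).symm.trans <| h.canonicalSection_apply u ⟨_, hm⟩ hz (smooth_localExt (x := p.proj) b) h1
        (localExt_self (I := I) (F := F) (x := p.proj) _).symm
      rw [h0, h.isSkewAlgebroid.skew _ _ hz (smooth_localExt b),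
        h.isSkewAlgebroid.zero_right (smooth_localExt b), dirDeriv_fiberLinear_localExt] at e
      have e3 : (trivializationAt F E p.proj ⟨p.proj, b⟩).2 = z :=
        congrArg Prod.snd ((trivializationAt F E p.proj).apply_mk_symm hx z)
      rw [e3] at e
      have e4 : fiberComp p (0 : TangentSpace (dualModel I F) p) = 0 := dirDeriv_vec_zero _ _
      rw [e4]
      simpa using e.symm
  exact Subtype.ext (Prod.ext h1 h2)

theorem IsLieAlgebroid.isSymplecticSection_canonicalSection :
    IsSymplecticSection (coProlong A) (canonicalSection A) := by
  have ht : T2Space (DualSpace F E) := t2Space_totalSpace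
  have hL : IsLieAlgebroid (coProlong A) := h.prolong_isLieAlgebroid
  exact
    { toIsTwoSection := hL.isTwoSection_neg_d1 (smooth_liouville A)
      nondegenerate := fun p u hu => h.canonicalSection_nondegenerate u hu
      closed := fun X Y Z hX hY hZ p => hL.neg_d1_closed (smooth_liouville A) hX hY hZ p }

/-- The Hamiltonian section is the representative of the linear form `w ↦ dH(ρ(w))` with respect to
the nondegenerate canonical section. -/
theorem IsLieAlgebroid.exists_hamiltonianSection {H : DualSpace F E → ℝ}
    (hH : ContMDiff (dualModel I F) 𝓘(ℝ, ℝ) ∞ H) :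
    ∃ ξ : ∀ p, CoProl A p, SmoothSection (dualModel I F) (F × (F →L[ℝ] ℝ)) ξ ∧
      IsHamiltonianSection A H ξ ∧ ∀ η, IsHamiltonianSection A H η → η = ξ := by
  have ht : T2Space (DualSpace F E) := t2Space_totalSpace
  have hΩ := h.isSymplecticSection_canonicalSection
  exact hΩ.toIsTwoSection.existsUnique_smooth_of_nondegenerate hΩ.nondegenerate
    (fun p => (mfderiv (dualModel I F) 𝓘(ℝ, ℝ) H p).toLinearMap ∘ₗ
      ((coProlong A).anchor p).toLinearMap)
    (fun X hX => contMDiff_anchorDeriv (coProlong A) hX hH)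

end Canonical

/-! ### The complete lift of a symplectic section -/

section CompleteLiftForm

variable {EM : Type*} [NormedAddCommGroup EM] [NormedSpace ℝ EM]
  {HM : Type*} [TopologicalSpace HM] {I : ModelWithCorners ℝ EM HM}
  {M : Type*} [TopologicalSpace M] [ChartedSpace HM M] [IsManifold I ∞ M]
  {F : Type*} [NormedAddCommGroup F] [NormedSpace ℝ F]
  {E : M → Type*} [TopologicalSpace (TotalSpace F E)] [∀ x, TopologicalSpace (E x)]
  [∀ x, AddCommGroup (E x)] [∀ x, Module ℝ (E x)]
  [FiberBundle F E] [VectorBundle ℝ F E] [ContMDiffVectorBundle ∞ F E I]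

variable (I F) in
/-- The derivative of the section `X` at `x` along `v`, for the flat connection of the trivialization
at `x`. -/
def sectionDeriv (X : ∀ x, E x) (x : M) (v : TangentSpace I x) : E x :=
  (trivializationAt F E x).symmL ℝ x (dirDeriv I (coordAt F x X) x v)

theorem symmL_trivializationAt {x : M} (u : E x) :
    (trivializationAt F E x).symmL ℝ x (trivializationAt F E x ⟨x, u⟩).2 = u :=
  have hx := FiberBundle.mem_baseSet_trivializationAt F E x
  ((trivializationAt F E x).symmL_apply (R := ℝ) hx _).trans
    ((trivializationAt F E x).symm_apply_apply_mk hx u)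

theorem sectionDeriv_add {X Y : ∀ x, E x} (hX : SmoothSection I F X) (hY : SmoothSection I F Y)
    (x : M) (v : TangentSpace I x) :
    sectionDeriv I F (X + Y) x v = sectionDeriv I F X x v + sectionDeriv I F Y x v := by
  have hx := FiberBundle.mem_baseSet_trivializationAt F E x
  have e : coordAt F x (X + Y) =ᶠ[𝓝 x] fun y => coordAt F x X y + coordAt F x Y y := by
    filter_upwards [baseSet_mem_nhds (F := F) (E := E) x] with y hy
    exact coordAt_add X Y hy
  unfold sectionDeriv
  rw [dirDeriv_congr e, dirDeriv_add (hX.mdifferentiableAt_coordAt hx)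
    (hY.mdifferentiableAt_coordAt hx), map_add]

theorem sectionDeriv_smul {f : M → ℝ} {X : ∀ x, E x} (hf : ContMDiff I 𝓘(ℝ, ℝ) ∞ f)
    (hX : SmoothSection I F X) (x : M) (v : TangentSpace I x) :
    sectionDeriv I F (fun y => f y • X y) x v =
      f x • sectionDeriv I F X x v + dirDeriv I f x v • X x := by
  have hx := FiberBundle.mem_baseSet_trivializationAt F E x
  have e : coordAt F x (fun y => f y • X y) =ᶠ[𝓝 x] fun y => f y • coordAt F x X y := by
    filter_upwards [baseSet_mem_nhds (F := F) (E := E) x] with y hy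
    exact coordAt_smul f X hy
  unfold sectionDeriv
  rw [dirDeriv_congr e, dirDeriv_smul (mdifferentiableAt_of_smooth hf x)
    (hX.mdifferentiableAt_coordAt hx), map_add, map_smul, map_smul]
  congr 2
  exact symmL_trivializationAt (X x)

variable [FiniteDimensional ℝ EM] [I.Boundaryless] [T2Space M]

theorem sectionDeriv_localExt {x : M} (u : E x) (v : TangentSpace I x) :
    sectionDeriv I F (localExt I F u) x v = 0 := by
  unfold sectionDeriv
  rw [dirDeriv_coordAt_localExt, map_zero]

/-- The section `localExt` through `0` vanishes near `x`, although not necessarily everywhere. -/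
theorem dirDeriv_localExt_zero {x : M} {Ω : ∀ x, E x → E x → ℝ} (hΩ : IsTwoSection I F Ω)
    (u : E x) (v : TangentSpace I x) :
    dirDeriv I (fun y => Ω y (localExt I F (0 : E x) y) (localExt I F u y)) x v = 0 := by
  have e : (fun y => Ω y (localExt I F (0 : E x) y) (localExt I F u y)) =ᶠ[𝓝 x] fun _ => 0 := by
    filter_upwards [localExt_smul (I := I) (F := F) 0 (0 : E x)] with y hy
    rw [zero_smul, zero_smul] at hy
    have := hΩ.smul_left y 0 0 (localExt I F u y)
    rwa [zero_smul, zero_mul, ← hy] at this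
  rw [dirDeriv_congr e, dirDeriv_const]

variable [FiniteDimensional ℝ F]

theorem IsTwoSection.dirDeriv_eq_left {Ω : ∀ x, E x → E x → ℝ} (hΩ : IsTwoSection I F Ω)
    {X Y : ∀ x, E x} (hX : SmoothSection I F X) (hY : SmoothSection I F Y) (x : M)
    (v : TangentSpace I x) :
    dirDeriv I (fun y => Ω y (X y) (Y y)) x v =
      dirDeriv I (fun y => Ω y (localExt I F (X x) y) (Y y)) x v +
        Ω x (sectionDeriv I F X x v) (Y x) := by
  have key := eq_of_tensorial (I := I) (F := F) (x := x)
    (Φ := fun X => dirDeriv I (fun y => Ω y (X y) (Y y)) x v -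
      Ω x (sectionDeriv I F X x v) (Y x)) ?_ ?_ hX (smooth_localExt (X x))
    (localExt_self (I := I) (F := F) (X x)).symm
  · simp only [sectionDeriv_localExt] at key
    have h0 := hΩ.smul_left x 0 0 (Y x)
    rw [zero_smul, zero_mul] at h0
    linarith
  · intro X X' hX hX'
    have e : (fun y => Ω y ((X + X') y) (Y y)) = fun y => Ω y (X y) (Y y) + Ω y (X' y) (Y y) :=
      funext fun y => hΩ.add_left y _ _ _
    rw [e, dirDeriv_add (mdifferentiableAt_of_smooth (hΩ.smooth _ _ hX hY) x)
      (mdifferentiableAt_of_smooth (hΩ.smooth _ _ hX' hY) x), sectionDeriv_add hX hX',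
      hΩ.add_left]
    ring
  · intro f X hf hX
    have e : (fun y => Ω y (f y • X y) (Y y)) = fun y => f y * Ω y (X y) (Y y) :=
      funext fun y => hΩ.smul_left y _ _ _
    rw [e, dirDeriv_mul (mdifferentiableAt_of_smooth hf x)
      (mdifferentiableAt_of_smooth (hΩ.smooth _ _ hX hY) x), sectionDeriv_smul hf hX,
      hΩ.add_left, hΩ.smul_left, hΩ.smul_left, smul_eq_mul]
    ring

/-- The product rule for a `2`-section applied to two sections. -/
theorem IsTwoSection.dirDeriv_eq {Ω : ∀ x, E x → E x → ℝ} (hΩ : IsTwoSection I F Ω)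
    {X Y : ∀ x, E x} (hX : SmoothSection I F X) (hY : SmoothSection I F Y) (x : M)
    (v : TangentSpace I x) :
    dirDeriv I (fun y => Ω y (X y) (Y y)) x v =
      dirDeriv I (fun y => Ω y (localExt I F (X x) y) (localExt I F (Y x) y)) x v +
        Ω x (sectionDeriv I F X x v) (Y x) + Ω x (X x) (sectionDeriv I F Y x v) := by
  have hX0 := smooth_localExt (I := I) (F := F) (X x)
  have hY0 := smooth_localExt (I := I) (F := F) (Y x)
  have hswap : ∀ Z, SmoothSection I F Z →
      dirDeriv I (fun y => Ω y (localExt I F (X x) y) (Z y)) x v =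
      -dirDeriv I (fun y => Ω y (Z y) (localExt I F (X x) y)) x v := by
    intro Z hZ
    rw [← dirDeriv_neg v (mdifferentiableAt_of_smooth (hΩ.smooth _ _ hZ hX0) x)]
    exact congrArg (fun f => dirDeriv I f x v) (funext fun y => hΩ.skew y _ _)
  rw [hΩ.dirDeriv_eq_left hX hY, hswap Y hY, hΩ.dirDeriv_eq_left hY hX0, hswap _ hY0,
    localExt_self, hΩ.skew x (X x)]
  ring

variable {A : AlgebroidData I F E}

theorem IsSkewAlgebroid.bracket_eq_sectionDeriv (h : IsSkewAlgebroid A) {X Y : ∀ x, E x}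
    (hX : SmoothSection I F X) (hY : SmoothSection I F Y) (x : M) :
    A.bracket X Y x = A.bracket (localExt I F (X x)) (localExt I F (Y x)) x +
      (sectionDeriv I F Y x (A.anchor x (X x)) - sectionDeriv I F X x (A.anchor x (Y x))) := by
  rw [h.bracket_eq hX hY, map_sub]
  rfl

variable (A) in
/-- For `u = (b, w)` in the prolongation of `E` over `E → M` at `a`: the value of `⟦X, s⟧`, where `X`
and `s` are sections through `b` and `a` such that `X` is constant in the trivialization at the base
point and `w` is the derivative of `s` along `ρ(b)`. -/
def bracketVec (a : TotalSpace F E) (u : prolFiber (I.prod 𝓘(ℝ, F)) A (π F E) a) : E a.proj :=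
  (trivializationAt F E a.proj).symmL ℝ a.proj (fiberComp a u.1.2) +
    A.bracket (localExt I F u.1.1) (localExt I F a.2) a.proj

variable (A) in
/-- The complete lift of the `2`-section `Ω`. For `u = (b₁, w₁)` and `v = (b₂, w₂)` at `a`, let `X₁`
and `X₂` be the sections through `b₁` and `b₂` with constant coordinates. The value at `(u, v)` is
`ρ(a)(Ω(X₁, X₂)) + Ω(e₁, b₂) + Ω(b₁, e₂)`, where `eᵢ` is the `bracketVec` of `u` and of `v`. Since
`bracketVec` is the derivative of `X` along `ρ(a)` on `X^c` and is `X` on `X^v`, the three defining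
identities amount to the product rule `IsTwoSection.dirDeriv_eq`. -/
def completeLift (Ω : ∀ x, E x → E x → ℝ) (a : TotalSpace F E)
    (u v : prolFiber (I.prod 𝓘(ℝ, F)) A (π F E) a) : ℝ :=
  dirDeriv I (fun x => Ω x (localExt I F u.1.1 x) (localExt I F v.1.1 x)) a.proj
      (A.anchor a.proj a.2) +
    Ω a.proj (bracketVec A a u) v.1.1 + Ω a.proj u.1.1 (bracketVec A a v)

theorem IsSkewAlgebroid.bracketVec_add (h : IsSkewAlgebroid A) (a : TotalSpace F E)
    (u v : prolFiber (I.prod 𝓘(ℝ, F)) A (π F E) a) :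
    bracketVec A a (u + v) = bracketVec A a u + bracketVec A a v := by
  have e1 : fiberComp a (u + v).1.2 = fiberComp a u.1.2 + fiberComp a v.1.2 := fiberComp_add a _ _
  have e2 : A.bracket (localExt I F (u + v).1.1) (localExt I F a.2) a.proj =
      A.bracket (localExt I F u.1.1) (localExt I F a.2) a.proj +
      A.bracket (localExt I F v.1.1) (localExt I F a.2) a.proj := by
    rw [h.bracket_localExt_skew, h.bracket_localExt_skew u.1.1, h.bracket_localExt_skew v.1.1,
      ← neg_add, ← h.bracket_localExt_add_right]
    rfl
  unfold bracketVec
  rw [e1, e2, map_add]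
  abel

theorem IsSkewAlgebroid.bracketVec_smul (h : IsSkewAlgebroid A) (a : TotalSpace F E) (c : ℝ)
    (u : prolFiber (I.prod 𝓘(ℝ, F)) A (π F E) a) :
    bracketVec A a (c • u) = c • bracketVec A a u := by
  have e1 : fiberComp a (c • u).1.2 = c • fiberComp a u.1.2 := fiberComp_smul a _ _
  have e2 : A.bracket (localExt I F (c • u).1.1) (localExt I F a.2) a.proj =
      c • A.bracket (localExt I F u.1.1) (localExt I F a.2) a.proj := by
    rw [h.bracket_localExt_skew, h.bracket_localExt_skew u.1.1, smul_neg,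
      ← h.bracket_localExt_smul_right]
    rfl
  unfold bracketVec
  rw [e1, e2, map_smul, smul_add]

/-- The complete lift of `X` at `a` has the fibre component of `-⟦X, s⟧`, where `s` is the section
through `a` that is constant in the trivialization at the base point. -/
theorem IsSkewAlgebroid.fiberComp_completeLift (h : IsSkewAlgebroid A) {X : ∀ x, E x}
    (hX : SmoothSection I F X) {a : TotalSpace F E} {w : TangentSpace (I.prod 𝓘(ℝ, F)) a}
    (hw : IsCompleteLiftAt A X a w) :
    (trivializationAt F E a.proj).symmL ℝ a.proj (fiberComp a w) =
      -A.bracket X (localExt I F a.2) a.proj := by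
  have hx := FiberBundle.mem_baseSet_trivializationAt F E a.proj
  have ha := smooth_localExt (I := I) (F := F) a.2
  have hT := FiberBundle.mem_baseSet_trivializationAt (F →L[ℝ] ℝ) (Dual E) a.proj
  have key : fiberComp a w = -coordAt F a.proj (A.bracket X (localExt I F a.2)) a.proj := by
    refine sub_eq_zero.1 (SeparatingDual.eq_zero_of_forall_dual_eq_zero (R := ℝ) fun g => ?_)
    -- a smooth section of the dual bundle with the constant coordinates `g`
    let α : ∀ y, Dual E y := localExt I (F →L[ℝ] ℝ) (E := Dual E) (x := a.proj)
      ((trivializationAt (F →L[ℝ] ℝ) (Dual E) a.proj).symm a.proj g)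
    have hα : SmoothDualSection I F α := smooth_localExt (I := I) (F := F →L[ℝ] ℝ) _
    have hα1 : ∀ᶠ y in 𝓝 a.proj, ∀ b : E y, α y b = g (trivializationAt F E a.proj ⟨y, b⟩).2 := by
      filter_upwards [coordAt_localExt (I := I) (F := F →L[ℝ] ℝ) (E := Dual E) (x := a.proj)
        ((trivializationAt (F →L[ℝ] ℝ) (Dual E) a.proj).symm a.proj g),
        baseSet_mem_nhds (F := F) (E := E) a.proj] with y h1 hy b
      have h2 : (trivializationAt (F →L[ℝ] ℝ) (Dual E) a.proj ⟨y, α y⟩).2 = g :=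
        h1.trans (congrArg Prod.snd ((trivializationAt (F →L[ℝ] ℝ) (Dual E)
          a.proj).apply_mk_symm hT g))
      rw [trivializationAt_dual_snd] at h2
      rw [← h2, ContinuousLinearMap.comp_apply, Trivialization.symmL_apply (R := ℝ) _ hy,
        Trivialization.symm_apply_apply_mk _ hy]
    have hπ : Filter.Tendsto (π F E) (𝓝 a) (𝓝 a.proj) :=
      (FiberBundle.continuous_proj F E).continuousAt
    have e1 : dirDeriv (I.prod 𝓘(ℝ, F)) (fun b : TotalSpace F E => α b.proj b.2) a w =
        g (fiberComp a w) := by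
      have e : (fun b : TotalSpace F E => α b.proj b.2) =ᶠ[𝓝 a]
          fun b => g (trivializationAt F E a.proj b).2 := by
        filter_upwards [hπ.eventually hα1] with b hb
        exact hb b.2
      rw [dirDeriv_congr e, dirDeriv_clm g (mdifferentiableAt_trivializationAt_snd a)]
      rfl
    have e2 := h.d1_apply hα hX ha a.proj
    rw [localExt_self] at e2
    have e3 : anchorDeriv A X (fun y => α y (localExt I F a.2 y)) a.proj = 0 := by
      have e : (fun y => α y (localExt I F a.2 y)) =ᶠ[𝓝 a.proj]
          fun _ => g (trivializationAt F E a.proj a).2 := by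
        filter_upwards [hα1, coordAt_localExt (I := I) (F := F) a.2] with y h1 h2
        rw [h1]
        exact congrArg g h2
      unfold anchorDeriv
      rw [dirDeriv_congr e, dirDeriv_const]
    have e4 : anchorDeriv A (localExt I F a.2) (fun y => α y (X y)) a.proj =
        dirDeriv I (fun y => α y (X y)) a.proj (A.anchor a.proj a.2) := by
      unfold anchorDeriv
      rw [localExt_self]
    have e5 := hw.2 α hα
    have e6 : α a.proj (A.bracket X (localExt I F a.2) a.proj) =
      g (coordAt F a.proj (A.bracket X (localExt I F a.2)) a.proj) := hα1.self_of_nhds _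
    rw [e1, lieDeriv, e2, e3, e4, e6] at e5
    rw [map_sub, map_neg, e5]
    ring
  rw [key, map_neg]
  exact congrArg Neg.neg (symmL_trivializationAt _)

theorem IsSkewAlgebroid.bracketVec_completeLift (h : IsSkewAlgebroid A) {X : ∀ x, E x}
    (hX : SmoothSection I F X) {a : TotalSpace F E}
    {u : prolFiber (I.prod 𝓘(ℝ, F)) A (π F E) a} (hu : u.1.1 = X a.proj)
    (hw : IsCompleteLiftAt A X a u.1.2) :
    bracketVec A a u = sectionDeriv I F X a.proj (A.anchor a.proj a.2) := by
  have e := h.bracket_eq_sectionDeriv hX (smooth_localExt (I := I) (F := F) a.2) a.proj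
  rw [sectionDeriv_localExt, localExt_self] at e
  unfold bracketVec
  rw [h.fiberComp_completeLift hX hw, e, hu]
  abel

theorem trivializationAt_fiberLine (a : TotalSpace F E) (e : E a.proj) :
    (fun t : ℝ => (trivializationAt F E a.proj
      (TotalSpace.mk' F (E := E) a.proj (a.2 + t • e))).2) = fun t : ℝ =>
      (trivializationAt F E a.proj).continuousLinearMapAt ℝ a.proj a.2 +
        t • (trivializationAt F E a.proj).continuousLinearMapAt ℝ a.proj e := by
  funext t
  rw [← map_smul, ← map_add, Trivialization.continuousLinearMapAt_apply,
    Trivialization.coe_linearMapAt_of_mem _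
      (FiberBundle.mem_baseSet_trivializationAt F E a.proj)]

theorem contMDiff_fiberLine (a : TotalSpace F E) (e : E a.proj) :
    ContMDiff 𝓘(ℝ, ℝ) (I.prod 𝓘(ℝ, F)) ∞
      (fun t : ℝ => TotalSpace.mk' F (E := E) a.proj (a.2 + t • e)) := by
  have hx := FiberBundle.mem_baseSet_trivializationAt F E a.proj
  intro t
  refine ((trivializationAt F E a.proj).contMDiffAt_iff
    ((trivializationAt F E a.proj).mem_source.2 hx)).2 ⟨contMDiffAt_const, ?_⟩
  rw [trivializationAt_fiberLine]
  exact (contDiff_const.add (contDiff_id.smul contDiff_const)).contMDiff t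

theorem dirDeriv_verticalLift {W : Type*} [NormedAddCommGroup W] [NormedSpace ℝ W]
    {f : TotalSpace F E → W} {a : TotalSpace F E}
    (hf : MDifferentiableAt (I.prod 𝓘(ℝ, F)) 𝓘(ℝ, W) f a) (e : E a.proj) :
    dirDeriv (I.prod 𝓘(ℝ, F)) f a (verticalLift I F a e) =
      deriv (fun t : ℝ => f (TotalSpace.mk' F a.proj (a.2 + t • e))) 0 := by
  have h0 : TotalSpace.mk' F (E := E) a.proj (a.2 + (0 : ℝ) • e) = a := by
    rw [zero_smul, add_zero]
  have h1 : MDifferentiableAt (I.prod 𝓘(ℝ, F)) 𝓘(ℝ, W) f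
      (TotalSpace.mk' F (E := E) a.proj (a.2 + (0 : ℝ) • e)) := by
    rwa [h0]
  have e2 := dirDeriv_comp (I := 𝓘(ℝ, ℝ)) (x := (0 : ℝ))
    (g := fun t : ℝ => TotalSpace.mk' F (E := E) a.proj (a.2 + t • e)) h1
    ((contMDiff_fiberLine (I := I) a e 0).mdifferentiableAt (by simp)) (1 : ℝ)
  unfold dirDeriv at e2
  rw [mfderiv_eq_fderiv] at e2
  refine Eq.trans ?_ e2.symm
  unfold verticalLift dirDeriv
  congr 2
  exact h0.symm

theorem mfderiv_proj_verticalLift (a : TotalSpace F E) (e : E a.proj) :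
    mfderiv (I.prod 𝓘(ℝ, F)) I (π F E) a (verticalLift I F a e) = 0 := by
  have h0 : TotalSpace.mk' F (E := E) a.proj (a.2 + (0 : ℝ) • e) = a := by
    rw [zero_smul, add_zero]
  have e2 := mfderiv_comp_apply (I := 𝓘(ℝ, ℝ)) (x := (0 : ℝ))
    (f := fun t : ℝ => TotalSpace.mk' F (E := E) a.proj (a.2 + t • e))
    (mdifferentiableAt_proj (I := I) (TotalSpace.mk' F (E := E) a.proj (a.2 + (0 : ℝ) • e)))
    ((contMDiff_fiberLine (I := I) a e 0).mdifferentiableAt (by simp)) (1 : ℝ)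
  have e3 : mfderiv 𝓘(ℝ, ℝ) I
      (π F E ∘ fun t : ℝ => TotalSpace.mk' F (E := E) a.proj (a.2 + t • e)) 0 = 0 :=
    mfderiv_const (c := a.proj)
  rw [e3] at e2
  refine Eq.trans ?_ e2.symm
  unfold verticalLift
  congr 2
  exact h0.symm

theorem fiberComp_verticalLift (a : TotalSpace F E) (e : E a.proj) :
    fiberComp a (verticalLift I F a e) = (trivializationAt F E a.proj ⟨a.proj, e⟩).2 := by
  have hx := FiberBundle.mem_baseSet_trivializationAt F E a.proj
  refine (dirDeriv_verticalLift (mdifferentiableAt_trivializationAt_snd a) e).trans ?_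
  rw [trivializationAt_fiberLine]
  have hd : HasDerivAt (fun t : ℝ =>
      (trivializationAt F E a.proj).continuousLinearMapAt ℝ a.proj a.2 +
        t • (trivializationAt F E a.proj).continuousLinearMapAt ℝ a.proj e)
        ((1 : ℝ) • (trivializationAt F E a.proj).continuousLinearMapAt ℝ a.proj e) 0 :=
    ((hasDerivAt_id (0 : ℝ)).smul_const _).const_add _
  rw [hd.deriv, one_smul, Trivialization.continuousLinearMapAt_apply,
    Trivialization.coe_linearMapAt_of_mem _ hx]

theorem IsSkewAlgebroid.bracketVec_verticalLift (h : IsSkewAlgebroid A) {a : TotalSpace F E}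
    {u : prolFiber (I.prod 𝓘(ℝ, F)) A (π F E) a} {e : E a.proj}
    (hu : u.1 = (0, verticalLift I F a e)) : bracketVec A a u = e := by
  have e1 : A.bracket (localExt I F (0 : E a.proj)) (localExt I F a.2) a.proj = 0 := by
    have := h.bracket_localExt_smul_right (0 : ℝ) a.2 (0 : E a.proj)
    rw [zero_smul, zero_smul] at this
    rw [h.bracket_localExt_skew, this, neg_zero]
  unfold bracketVec
  rw [hu, e1, add_zero]
  exact (congrArg _ (fiberComp_verticalLift a e)).trans (symmL_trivializationAt e)

theorem IsSkewAlgebroid.isCompleteLift_completeLift (h : IsSkewAlgebroid A)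
    {Ω : ∀ x, E x → E x → ℝ} (hΩ : IsTwoSection I F Ω) :
    IsCompleteLift A Ω (completeLift A Ω) where
  add_left a u u' v := by
    have hv := smooth_localExt (I := I) (F := F) (x := a.proj) v.1.1
    have e : (fun x => Ω x (localExt I F (u + u').1.1 x) (localExt I F v.1.1 x)) =ᶠ[𝓝 a.proj]
        fun x => Ω x (localExt I F u.1.1 x) (localExt I F v.1.1 x) +
          Ω x (localExt I F u'.1.1 x) (localExt I F v.1.1 x) := by
      filter_upwards [localExt_add (I := I) (F := F) (x := a.proj) u.1.1 u'.1.1] with x hx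
      exact (congrArg (fun z => Ω x z _) hx).trans (hΩ.add_left x _ _ _)
    have e2 : (u + u').1.1 = u.1.1 + u'.1.1 := rfl
    unfold completeLift
    rw [dirDeriv_congr e, dirDeriv_add
      (mdifferentiableAt_of_smooth (hΩ.smooth _ _ (smooth_localExt u.1.1) hv) _)
      (mdifferentiableAt_of_smooth (hΩ.smooth _ _ (smooth_localExt u'.1.1) hv) _),
      h.bracketVec_add, hΩ.add_left, e2, hΩ.add_left]
    ring
  smul_left a c u v := by
    have hv := smooth_localExt (I := I) (F := F) (x := a.proj) v.1.1
    have e : (fun x => Ω x (localExt I F (c • u).1.1 x) (localExt I F v.1.1 x)) =ᶠ[𝓝 a.proj]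
        fun x => c * Ω x (localExt I F u.1.1 x) (localExt I F v.1.1 x) := by
      filter_upwards [localExt_smul (I := I) (F := F) (x := a.proj) c u.1.1] with x hx
      exact (congrArg (fun z => Ω x z _) hx).trans (hΩ.smul_left x _ _ _)
    have e2 : (c • u).1.1 = c • u.1.1 := rfl
    unfold completeLift
    rw [dirDeriv_congr e, dirDeriv_mul (mdifferentiableAt_of_smooth contMDiff_const _)
      (mdifferentiableAt_of_smooth (hΩ.smooth _ _ (smooth_localExt u.1.1) hv) _), dirDeriv_const,
      h.bracketVec_smul, hΩ.smul_left, e2, hΩ.smul_left]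
    ring
  skew a u v := by
    have e : (fun x => Ω x (localExt I F u.1.1 x) (localExt I F v.1.1 x)) =
        fun x => -Ω x (localExt I F v.1.1 x) (localExt I F u.1.1 x) :=
      funext fun x => hΩ.skew x _ _
    unfold completeLift
    rw [e, dirDeriv_neg _ (mdifferentiableAt_of_smooth
      (hΩ.smooth _ _ (smooth_localExt v.1.1) (smooth_localExt u.1.1)) _),
      hΩ.skew _ (bracketVec A a u), hΩ.skew _ u.1.1]
    ring
  complete_complete X Y hX hY a u v hu hu' hv hv' := by
    unfold completeLift
    rw [h.bracketVec_completeLift hX hu hu', h.bracketVec_completeLift hY hv hv', hu, hv,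
      hΩ.dirDeriv_eq hX hY]
  vertical_complete X Y hX hY a u v hu hv hv' := by
    have h0 : u.1.1 = 0 := congrArg Prod.fst hu
    have h1 := hΩ.smul_left a.proj 0 0 (bracketVec A a v)
    rw [zero_smul, zero_mul] at h1
    unfold completeLift
    rw [h.bracketVec_verticalLift hu, h0, h1, dirDeriv_localExt_zero hΩ, hv, zero_add, add_zero]
  vertical_vertical X Y hX hY a u v hu hv := by
    have h0 : u.1.1 = 0 := congrArg Prod.fst hu
    have h0' : v.1.1 = 0 := congrArg Prod.fst hv
    have h1 : ∀ z, Ω a.proj 0 z = 0 := fun z => by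
      have h1 := hΩ.smul_left a.proj 0 0 z
      rwa [zero_smul, zero_mul] at h1
    unfold completeLift
    rw [h0, h0', dirDeriv_localExt_zero hΩ, h1, hΩ.skew _ _ 0, h1]
    ring

/-! ### Hamiltonian sections present Lagrangian submanifolds -/

variable (A) in
/-- The linear map `b ↦ (b, Tξ(ρ(b)))` from `E` to the prolongation of `E` over `E → M`. -/
def prolSection {ξ : ∀ x, E x} (hξ : SmoothSection I F ξ) (x : M) :
    E x →ₗ[ℝ] prolFiber (I.prod 𝓘(ℝ, F)) A (π F E) (TotalSpace.mk' F x (ξ x)) :=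
  LinearMap.codRestrict _ (LinearMap.prod LinearMap.id
    ((mfderiv I (I.prod 𝓘(ℝ, F)) (fun y => TotalSpace.mk' F y (ξ y)) x).toLinearMap ∘ₗ
      (A.anchor x).toLinearMap)) fun b => by
    have h1 := mfderiv_comp_apply x (mdifferentiableAt_proj (TotalSpace.mk' F x (ξ x)))
      ((hξ x).mdifferentiableAt (by simp)) (A.anchor x b)
    exact (DFunLike.congr_fun (mfderiv_id (I := I) (x := x)) (A.anchor x b)).symm.trans h1

theorem prolSection_injective {ξ : ∀ x, E x} (hξ : SmoothSection I F ξ) (x : M) :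
    Function.Injective (prolSection A hξ x) := fun _ _ hb =>
  congrArg (fun u : prolFiber (I.prod 𝓘(ℝ, F)) A (π F E) (TotalSpace.mk' F x (ξ x)) => u.1.1) hb

theorem finrank_prolFiber (a : TotalSpace F E) :
    Module.finrank ℝ (prolFiber (I.prod 𝓘(ℝ, F)) A (π F E) a) = 2 * Module.finrank ℝ F := by
  have hb := FiberBundle.mem_baseSet_trivializationAt (F × F) (Prol F E A) a
  have e := ((trivializationAt (F × F) (Prol F E A) a).continuousLinearEquivAt ℝ a
    hb).toLinearEquiv.finrank_eq
  rw [Module.finrank_prod, ← two_mul] at e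
  exact e

theorem finrank_fiber (x : M) : Module.finrank ℝ (E x) = Module.finrank ℝ F :=
  ((trivializationAt F E x).continuousLinearEquivAt ℝ x
    (FiberBundle.mem_baseSet_trivializationAt F E x)).toLinearEquiv.finrank_eq

/-- On the vectors `(b, Tξ(ρ(b)))` tangent to the image of a section `ξ`, the `bracketVec` is the
bracket with `ξ` itself. -/
theorem IsSkewAlgebroid.bracketVec_prolSection (h : IsSkewAlgebroid A) {ξ : ∀ x, E x}
    (hξ : SmoothSection I F ξ) (x : M) (b : E x) :
    bracketVec A _ (prolSection A hξ x b) = A.bracket (localExt I F b) ξ x := by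
  have e := h.bracket_eq_sectionDeriv (smooth_localExt (I := I) (F := F) b) hξ x
  rw [sectionDeriv_localExt, localExt_self, sub_zero] at e
  rw [e, add_comm]
  refine congrArg (fun z => z + _) ?_
  refine congrArg ((trivializationAt F E x).symmL ℝ x) ?_
  exact (dirDeriv_comp (g := fun y => TotalSpace.mk' F y (ξ y))
    (mdifferentiableAt_trivializationAt_snd (TotalSpace.mk' F x (ξ x)))
    ((hξ x).mdifferentiableAt (by simp)) (A.anchor x b)).symm

/-- The pairs `(b, Tξ(ρ(b)))` are isotropic for the complete lift when `ξ` is the Hamiltonian section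
of a function. For sections `X`, `Y` through the first components, the value of the complete lift is
`ρ(ξ)(Ω(X, Y)) + Ω(⟦X, ξ⟧, Y) + Ω(X, ⟦Y, ξ⟧)`. As `Ω` is closed and `Ω(ξ, ·) = dH ∘ ρ`, this equals
`ρ(X)ρ(Y)H - ρ(Y)ρ(X)H - ρ(⟦X, Y⟧)H`, and the anchor is a homomorphism. -/
theorem IsLieAlgebroid.completeLift_prolSection (h : IsLieAlgebroid A) {Ω : ∀ x, E x → E x → ℝ}
    (hΩ : IsSymplecticSection A Ω) {H : M → ℝ} (hH : ContMDiff I 𝓘(ℝ, ℝ) ∞ H) {ξ : ∀ x, E x}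
    (hξ : SmoothSection I F ξ) (hξH : ∀ x w, Ω x (ξ x) w = dirDeriv I H x (A.anchor x w)) (x : M)
    (b b' : E x) :
    completeLift A Ω _ (prolSection A hξ x b) (prolSection A hξ x b') = 0 := by
  have hb := smooth_localExt (I := I) (F := F) b
  have hb' := smooth_localExt (I := I) (F := F) b'
  have hsk := h.isSkewAlgebroid
  have e1 := hΩ.closed _ _ _ hξ hb hb' x
  have e2 : ∀ Z : ∀ x, E x, (fun y => Ω y (ξ y) (Z y)) = anchorDeriv A Z H :=
    fun Z => funext fun y => hξH y (Z y)
  have e3 := h.anchorDeriv_bracket hb hb' hH x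
  have e4 : Ω x (A.bracket (localExt I F b) (localExt I F b') x) (ξ x) =
      -anchorDeriv A (A.bracket (localExt I F b) (localExt I F b')) H x := by
    rw [hΩ.skew, hξH]
    rfl
  rw [e2, e2, e4, e3, hsk.skew _ _ hξ hb, hsk.skew _ _ hξ hb'] at e1
  simp only [Pi.neg_apply, localExt_self, hΩ.toIsTwoSection.neg_left] at e1
  have e5 : completeLift A Ω _ (prolSection A hξ x b) (prolSection A hξ x b') =
      dirDeriv I (fun y => Ω y (localExt I F b y) (localExt I F b' y)) x (A.anchor x (ξ x)) +
      Ω x (A.bracket (localExt I F b) ξ x) b' + Ω x b (A.bracket (localExt I F b') ξ x) := by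
    rw [← hsk.bracketVec_prolSection hξ, ← hsk.bracketVec_prolSection hξ]
    rfl
  rw [e5, hΩ.skew x b]
  unfold anchorDeriv at e1
  simp only [localExt_self] at e1
  linarith

/-- The image of the Hamiltonian section of a function on a symplectic Lie algebroid is a Lagrangian
submanifold. As it is parametrized by the whole base, the rank condition is trivial, and the relevant
subspace at `ξ(x)` is the graph of `b ↦ Tξ(ρ(b))`, of dimension equal to the rank of the bundle. -/
theorem IsLieAlgebroid.isLagrangianSubmanifold (h : IsLieAlgebroid A) {Ω : ∀ x, E x → E x → ℝ}
    (hΩ : IsSymplecticSection A Ω) {H : M → ℝ} (hH : ContMDiff I 𝓘(ℝ, ℝ) ∞ H) {ξ : ∀ x, E x}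
    (hξ : SmoothSection I F ξ) (hξH : ∀ x w, Ω x (ξ x) w = dirDeriv I H x (A.anchor x w)) :
    IsLagrangianSubmanifold I A Ω (fun x => TotalSpace.mk' F x (ξ x)) := by
  have hid : ∀ x, mfderiv I I (fun s : M => s) x = ContinuousLinearMap.id ℝ (TangentSpace I x) :=
    fun x => mfderiv_id
  refine ⟨hξ, ?_, fun x => ?_, ⟨Module.finrank ℝ EM, fun x => ?_⟩, completeLift A Ω,
    h.isSkewAlgebroid.isCompleteLift_completeLift hΩ.toIsTwoSection, fun x =>
    ⟨LinearMap.range (prolSection A hξ x), fun w => ?_, ?_, ?_⟩⟩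
  · exact Function.LeftInverse.isEmbedding (f := π F E) (fun x => rfl)
      (FiberBundle.continuous_proj F E) hξ.continuous
  · have h1 : ∀ v : TangentSpace I x, mfderiv (I.prod 𝓘(ℝ, F)) I (π F E) (TotalSpace.mk' F x (ξ x))
        (mfderiv I (I.prod 𝓘(ℝ, F)) (fun y => TotalSpace.mk' F y (ξ y)) x v) = v := fun v =>
      (mfderiv_comp_apply x (mdifferentiableAt_proj (TotalSpace.mk' F x (ξ x)))
        ((hξ x).mdifferentiableAt (by simp)) v).symm.trans (DFunLike.congr_fun (hid x) v)
    intro v v' hv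
    rw [← h1 v, ← h1 v']
    exact congrArg _ hv
  · have h1 : LinearMap.range (mfderiv I I (fun s : M => s) x).toLinearMap = ⊤ := by
      rw [hid]
      exact LinearMap.range_id
    have h2 : LinearMap.range (A.anchor x).toLinearMap ⊔
      LinearMap.range (mfderiv I I (fun s : M => s) x).toLinearMap = ⊤ := by
      rw [h1, sup_top_eq]
    refine Eq.trans (congrArg (fun S : Submodule ℝ (TangentSpace I x) => Module.finrank ℝ S) h2) ?_
    exact finrank_top ℝ EM
  · constructor
    · rintro ⟨b, rfl⟩
      refine ⟨(b, A.anchor x b), ?_, rfl⟩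
      exact (DFunLike.congr_fun (hid x) _).symm
    · rintro ⟨z, hz, hw⟩
      have h1 : A.anchor x z.1 = z.2 := (mem_prolFiber.1 hz).trans (DFunLike.congr_fun (hid x) _)
      refine ⟨z.1, Subtype.ext ?_⟩
      rw [hw, ← h1]
      rfl
  · rintro _ ⟨b, rfl⟩ _ ⟨b', rfl⟩
    exact h.completeLift_prolSection hΩ hH hξ hξH x b b'
  · rw [LinearMap.finrank_range_of_inj (prolSection_injective hξ x), finrank_prolFiber,
      finrank_fiber (F := F)]

end CompleteLiftForm

/-! ### Local coordinates -/

section Coordinates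

variable {EM : Type*} [NormedAddCommGroup EM] [NormedSpace ℝ EM]
  {HM : Type*} [TopologicalSpace HM] {I : ModelWithCorners ℝ EM HM}
  {M : Type*} [TopologicalSpace M] [ChartedSpace HM M] [IsManifold I ∞ M]
  {F : Type*} [NormedAddCommGroup F] [NormedSpace ℝ F]
  {E : M → Type*} [TopologicalSpace (TotalSpace F E)] [∀ x, TopologicalSpace (E x)]
  [∀ x, AddCommGroup (E x)] [∀ x, Module ℝ (E x)]
  [FiberBundle F E] [VectorBundle ℝ F E] [ContMDiffVectorBundle ∞ F E I]

namespace LocalCoords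

variable (φ : LocalCoords I F E)

theorem contMDiffAt_extend_chart {x : M} (hx : x ∈ φ.dom) :
    ContMDiffAt I 𝓘(ℝ, EM) ∞ (φ.chart.extend I) x :=
  φ.chart.contMDiffAt_extend φ.chart_mem (φ.dom_subset hx)

theorem extend_symm_extend {x : M} (hx : x ∈ φ.dom) :
    (φ.chart.extend I).symm (φ.chart.extend I x) = x :=
  φ.chart.extend_left_inv (φ.dom_subset hx)

theorem contMDiffAt_extend_symm [I.Boundaryless] {x : M} (hx : x ∈ φ.dom) :
    ContMDiffAt 𝓘(ℝ, EM) I ∞ (φ.chart.extend I).symm (φ.chart.extend I x) := by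
  have h1 : ContMDiffAt I I ∞ φ.chart.symm (I.symm (φ.chart.extend I x)) := by
    refine contMDiffAt_symm_of_mem_maximalAtlas φ.chart_mem ?_
    have : I.symm (φ.chart.extend I x) = φ.chart x := I.left_inv _
    rw [this]
    exact φ.chart.map_source (φ.dom_subset hx)
  have h2 : ContMDiff 𝓘(ℝ, EM) I ∞ I.symm := by
    have := I.contMDiffOn_symm (n := ∞)
    rwa [I.range_eq_univ, contMDiffOn_univ] at this
  exact h1.comp _ h2.contMDiffAt

theorem mfderiv_extend_symm [I.Boundaryless] {x : M} (hx : x ∈ φ.dom) (v : TangentSpace I x) :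
    mfderiv 𝓘(ℝ, EM) I (φ.chart.extend I).symm (φ.chart.extend I x)
      (mfderiv I 𝓘(ℝ, EM) (φ.chart.extend I) x v) = v := by
  have h := mfderiv_comp_apply x ((φ.contMDiffAt_extend_symm hx).mdifferentiableAt (by simp))
    ((φ.contMDiffAt_extend_chart hx).mdifferentiableAt (by simp)) v
  have e : (φ.chart.extend I).symm ∘ φ.chart.extend I =ᶠ[𝓝 x] id := by
    filter_upwards [φ.isOpen_dom.mem_nhds hx] with y hy
    exact φ.extend_symm_extend hy
  rw [e.mfderiv_eq, mfderiv_id] at h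
  exact h.symm

theorem point_extend {x : M} (hx : x ∈ φ.dom) (y : Fin φ.rank → ℝ) :
    φ.point (φ.chart.extend I x) y =
      TotalSpace.mk' (F →L[ℝ] ℝ) (E := Dual E) x (∑ α, y α • φ.coframe α x) :=
  congrArg (fun z => (TotalSpace.mk' (F →L[ℝ] ℝ) (E := Dual E) z (∑ α, y α • φ.coframe α z)))
    (φ.extend_symm_extend hx)

theorem sum_fiberCoord {p : DualSpace F E} (hp : p.proj ∈ φ.dom) :
    ∑ α, φ.fiberCoord p α • φ.coframe α p.proj = p.2 := by
  refine ContinuousLinearMap.ext fun v => ?_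
  conv_rhs => rw [← φ.sum_coframe p.proj hp v, map_sum]
  rw [FunLike.coe_sum, Finset.sum_apply]
  refine Finset.sum_congr rfl fun α _ => ?_
  rw [map_smul, smul_eq_mul, mul_comm]
  rfl

theorem point_coords {p : DualSpace F E} (hp : p.proj ∈ φ.dom) :
    φ.point (φ.baseCoord p) (φ.fiberCoord p) = p :=
  (φ.point_extend hp _).trans (congrArg (TotalSpace.mk' (F →L[ℝ] ℝ) p.proj) (φ.sum_fiberCoord hp))

theorem mdifferentiableAt_baseCoord {p : DualSpace F E} (hp : p.proj ∈ φ.dom) :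
    MDifferentiableAt (dualModel I F) 𝓘(ℝ, EM) φ.baseCoord p :=
  ((φ.contMDiffAt_extend_chart hp).mdifferentiableAt (by simp)).comp p (mdifferentiableAt_proj p)

theorem dirDeriv_baseCoord {p : DualSpace F E} (hp : p.proj ∈ φ.dom)
    (v : TangentSpace (dualModel I F) p) :
    dirDeriv (dualModel I F) φ.baseCoord p v = mfderiv I 𝓘(ℝ, EM) (φ.chart.extend I) p.proj
      (mfderiv (dualModel I F) I (π (F →L[ℝ] ℝ) (Dual E)) p v) :=
  dirDeriv_comp (g := π (F →L[ℝ] ℝ) (Dual E))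
    ((φ.contMDiffAt_extend_chart hp).mdifferentiableAt (by simp)) (mdifferentiableAt_proj p) v

theorem mdifferentiableAt_fiberCoord (p : DualSpace F E) (α : Fin φ.rank) :
    MDifferentiableAt (dualModel I F) 𝓘(ℝ, ℝ) (fun q => φ.fiberCoord q α) p :=
  mdifferentiableAt_of_smooth (contMDiff_fiberLinear (φ.smooth_frame α)) p

/-- The coframe is smooth on the domain of the coordinates, because it is given by the inverse of the
matrix of the frame. -/
theorem contMDiffAt_coframe [FiniteDimensional ℝ F] {x : M} (hx : x ∈ φ.dom) (α : Fin φ.rank) :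
    ContMDiffAt I (I.prod 𝓘(ℝ, F →L[ℝ] ℝ)) ∞
      (fun y => TotalSpace.mk' (F →L[ℝ] ℝ) (E := Dual E) y (φ.coframe α y)) x := by
  have hxF := FiberBundle.mem_baseSet_trivializationAt F E x
  let B : M → (Fin φ.rank → ℝ) →L[ℝ] F := fun y => ∑ β,
    ContinuousLinearMap.smulRightL ℝ (Fin φ.rank → ℝ) F (ContinuousLinearMap.proj β)
      (coordAt F x (φ.frame β) y)
  let K : M → F →L[ℝ] (Fin φ.rank → ℝ) := fun y => ContinuousLinearMap.pi fun β =>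
    φ.coframe β y ∘L (trivializationAt F E x).symmL ℝ y
  have hB_apply : ∀ y c, B y c = ∑ β, c β • coordAt F x (φ.frame β) y := by
    intro y c
    simp only [B, FunLike.coe_sum, Finset.sum_apply]
    rfl
  have hBK : ∀ y ∈ φ.dom, y ∈ (trivializationAt F E x).baseSet →
      B y ∘L K y = ContinuousLinearMap.id ℝ F ∧
      K y ∘L B y = ContinuousLinearMap.id ℝ (Fin φ.rank → ℝ) := by
    intro y hy hyF
    have hco : ∀ β, coordAt F x (φ.frame β) y =
        (trivializationAt F E x).continuousLinearMapAt ℝ y (φ.frame β y) := fun β =>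
      coordAt_eq_continuousLinearMapAt _ hyF
    constructor
    · refine ContinuousLinearMap.ext fun z => ?_
      rw [ContinuousLinearMap.comp_apply, hB_apply]
      have e := congrArg ((trivializationAt F E x).continuousLinearMapAt ℝ y)
        (φ.sum_coframe y hy ((trivializationAt F E x).symmL ℝ y z))
      rw [Trivialization.continuousLinearMapAt_symmL _ hyF, map_sum] at e
      refine Eq.trans (Finset.sum_congr rfl fun β _ => ?_) e
      rw [map_smul, hco]
      rfl
    · refine ContinuousLinearMap.ext fun c => funext fun β => ?_
      have e : (K y ∘L B y) c β = φ.coframe β y ((trivializationAt F E x).symmL ℝ y (B y c)) := rfl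
      rw [e, hB_apply, map_sum, map_sum, Finset.sum_eq_single β]
      · rw [map_smul, map_smul, hco, Trivialization.symmL_continuousLinearMapAt _ hyF,
          φ.coframe_frame β β y hy, if_pos rfl, smul_eq_mul, mul_one]
        rfl
      · intro γ _ hγ
        rw [map_smul, map_smul, hco, Trivialization.symmL_continuousLinearMapAt _ hyF,
          φ.coframe_frame β γ y hy, if_neg hγ.symm, smul_zero]
      · exact fun hβ => absurd (Finset.mem_univ β) hβ
  have hB : ContMDiffAt I 𝓘(ℝ, (Fin φ.rank → ℝ) →L[ℝ] F) ∞ B x :=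
    ContMDiffAt.sum fun β _ => (ContinuousLinearMap.contMDiff _).contMDiffAt.comp x
      (contMDiffAt_coordAt (φ.smooth_frame β x) hxF)
  have hK : ContMDiffAt I 𝓘(ℝ, F →L[ℝ] (Fin φ.rank → ℝ)) ∞ K x := by
    have hx' := hBK x hx hxF
    have h1 : ContDiffAt ℝ ∞ ContinuousLinearMap.inverse (B x) :=
      contDiffAt_map_inverse (ContinuousLinearEquiv.equivOfInverse' (B x) (K x) hx'.1 hx'.2)
    refine (h1.contMDiffAt.comp x hB).congr_of_eventuallyEq ?_
    filter_upwards [φ.isOpen_dom.mem_nhds hx, baseSet_mem_nhds (F := F) (E := E) x] with y hy hyF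
    exact (ContinuousLinearMap.inverse_eq (hBK y hy hyF).1 (hBK y hy hyF).2).symm
  refine contMDiffAt_of_coordAt (E := Dual E)
    (FiberBundle.mem_baseSet_trivializationAt (F →L[ℝ] ℝ) (Dual E) x) ?_
  have e : coordAt (F →L[ℝ] ℝ) x (φ.coframe α) = fun y =>
      (ContinuousLinearMap.proj α : (Fin φ.rank → ℝ) →L[ℝ] ℝ) ∘L K y := by
    funext y
    unfold coordAt
    rw [trivializationAt_dual_snd]
    rfl
  rw [e]
  exact contMDiffAt_const.clm_comp hK

theorem contMDiffAt_point [I.Boundaryless] [FiniteDimensional ℝ F] {x : M} (hx : x ∈ φ.dom)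
    (y : Fin φ.rank → ℝ) :
    ContMDiffAt 𝓘(ℝ, EM) (dualModel I F) ∞ (fun z => φ.point z y) (φ.chart.extend I x) := by
  have h1 : ContMDiffAt I (dualModel I F) ∞ (fun z => TotalSpace.mk' (F →L[ℝ] ℝ) (E := Dual E) z
      (∑ α, y α • φ.coframe α z)) x :=
    ContMDiffAt.sum_section fun α _ => (φ.contMDiffAt_coframe hx α).const_smul_section
  rw [← φ.extend_symm_extend hx] at h1
  exact h1.comp (φ.chart.extend I x) (φ.contMDiffAt_extend_symm hx)

variable {φ} in
/-- A tangent vector to `E*` is determined by the derivatives of the coordinates along it. -/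
theorem ext_tangent [I.Boundaryless] [FiniteDimensional ℝ EM] [T2Space M] [FiniteDimensional ℝ F]
    {p : DualSpace F E} (hp : p.proj ∈ φ.dom)
    {v w : TangentSpace (dualModel I F) p}
    (h1 : dirDeriv (dualModel I F) φ.baseCoord p v = dirDeriv (dualModel I F) φ.baseCoord p w)
    (h2 : ∀ α, dirDeriv (dualModel I F) (fun q => φ.fiberCoord q α) p v =
      dirDeriv (dualModel I F) (fun q => φ.fiberCoord q α) p w) : v = w := by
  have hx := FiberBundle.mem_baseSet_trivializationAt F E p.proj
  have hπ : Filter.Tendsto (π (F →L[ℝ] ℝ) (Dual E)) (𝓝 p) (𝓝 p.proj) :=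
    (FiberBundle.continuous_proj (F →L[ℝ] ℝ) (Dual E)).continuousAt
  have e1 : mfderiv (dualModel I F) I (π (F →L[ℝ] ℝ) (Dual E)) p v =
      mfderiv (dualModel I F) I (π (F →L[ℝ] ℝ) (Dual E)) p w := by
    rw [φ.dirDeriv_baseCoord hp, φ.dirDeriv_baseCoord hp] at h1
    rw [← φ.mfderiv_extend_symm hp (mfderiv (dualModel I F) I (π (F →L[ℝ] ℝ) (Dual E)) p v), h1]
    exact φ.mfderiv_extend_symm hp _
  have e2 : ∀ α (u : TangentSpace (dualModel I F) p),
      dirDeriv (dualModel I F) (fun q => φ.fiberCoord q α) p u =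
      fiberComp p u (coordAt F p.proj (φ.frame α) p.proj) +
        (trivializationAt (F →L[ℝ] ℝ) (Dual E) p.proj p).2
          (dirDeriv I (coordAt F p.proj (φ.frame α)) p.proj
            (mfderiv (dualModel I F) I (π (F →L[ℝ] ℝ) (Dual E)) p u)) := by
    intro α u
    have hc := (φ.smooth_frame α).mdifferentiableAt_coordAt hx
    have e : (fun q => φ.fiberCoord q α) =ᶠ[𝓝 p] fun q => ContinuousLinearMap.id ℝ (F →L[ℝ] ℝ)
        (trivializationAt (F →L[ℝ] ℝ) (Dual E) p.proj q).2
        (coordAt F p.proj (φ.frame α) (π (F →L[ℝ] ℝ) (Dual E) q)) := by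
      filter_upwards [hπ.eventually (baseSet_mem_nhds (F := F) (E := E) p.proj)] with q hq
      exact fiberLinear_eq _ hq
    have hg : MDifferentiableAt (dualModel I F) 𝓘(ℝ, F)
        (fun q => coordAt F p.proj (φ.frame α) (π (F →L[ℝ] ℝ) (Dual E) q)) p :=
      hc.comp p (mdifferentiableAt_proj p)
    rw [dirDeriv_congr e, dirDeriv_bilin _ (mdifferentiableAt_trivializationAt_snd p) hg,
      dirDeriv_comp (g := π (F →L[ℝ] ℝ) (Dual E)) hc (mdifferentiableAt_proj p)]
    rfl
  refine ext_of_fiberComp e1 (ContinuousLinearMap.ext fun z => ?_)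
  have e3 : ∀ α, fiberComp p v (coordAt F p.proj (φ.frame α) p.proj) =
      fiberComp p w (coordAt F p.proj (φ.frame α) p.proj) := by
    intro α
    have := h2 α
    rw [e2, e2, e1] at this
    exact add_right_cancel this
  have e4 := congrArg ((trivializationAt F E p.proj).continuousLinearMapAt ℝ p.proj)
    (φ.sum_coframe p.proj hp ((trivializationAt F E p.proj).symmL ℝ p.proj z))
  rw [Trivialization.continuousLinearMapAt_symmL _ hx, map_sum] at e4
  rw [← e4, map_sum, map_sum]
  refine Finset.sum_congr rfl fun α _ => ?_
  rw [map_smul, map_smul, map_smul, ← coordAt_eq_continuousLinearMapAt _ hx, e3]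

/-- The coordinate partial derivative along the fibre is the derivative along the vertical lift of
the coframe. -/
theorem partialFiber_eq [FiniteDimensional ℝ EM] [I.Boundaryless] [T2Space M]
    [FiniteDimensional ℝ F] {H : DualSpace F E → ℝ}
    (hH : ContMDiff (dualModel I F) 𝓘(ℝ, ℝ) ∞ H) {p : DualSpace F E} (hp : p.proj ∈ φ.dom)
    (β : Fin φ.rank) :
    φ.partialFiber H p β =
      dirDeriv (dualModel I F) H p (verticalLift I (F →L[ℝ] ℝ) p (φ.coframe β p.proj)) := by
  classical
  have ht : T2Space (DualSpace F E) := t2Space_totalSpace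
  rw [dirDeriv_verticalLift (mdifferentiableAt_of_smooth hH p)]
  have e : (fun t => H (φ.point (φ.baseCoord p) (Function.update (φ.fiberCoord p) β t))) =
      fun t => (fun s => H (TotalSpace.mk' (F →L[ℝ] ℝ) p.proj (p.2 + s • φ.coframe β p.proj)))
        (t - φ.fiberCoord p β) := by
    funext t
    refine congrArg H ((φ.point_extend hp _).trans ?_)
    refine congrArg (TotalSpace.mk' (F →L[ℝ] ℝ) p.proj) ?_
    conv_rhs => rw [← φ.sum_fiberCoord hp]
    rw [← Finset.add_sum_erase _ _ (Finset.mem_univ β),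
      ← Finset.add_sum_erase Finset.univ (fun α => φ.fiberCoord p α • φ.coframe α p.proj)
        (Finset.mem_univ β), Function.update_self]
    have : ∑ α ∈ Finset.univ.erase β, Function.update (φ.fiberCoord p) β t α • φ.coframe α p.proj =
        ∑ α ∈ Finset.univ.erase β, φ.fiberCoord p α • φ.coframe α p.proj :=
      Finset.sum_congr rfl fun α hα => by
        rw [Function.update_of_ne (Finset.ne_of_mem_erase hα)]
    have hs : (t - φ.fiberCoord p β) • φ.coframe β p.proj =
        t • φ.coframe β p.proj - φ.fiberCoord p β • φ.coframe β p.proj :=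
      ContinuousLinearMap.ext fun z => sub_mul _ _ (φ.coframe β p.proj z)
    rw [this, hs]
    abel
  unfold partialFiber
  rw [e]
  refine (deriv_comp_sub_const (fun s => H (TotalSpace.mk' (F →L[ℝ] ℝ) p.proj
    (p.2 + s • φ.coframe β p.proj))) _ _).trans ?_
  rw [sub_self]

/-- The coordinate partial derivative along the base is the derivative along the tangent vector whose
fibre coordinates vanish. -/
theorem partialBase_eq [I.Boundaryless] [FiniteDimensional ℝ F] {H : DualSpace F E → ℝ}
    (hH : ContMDiff (dualModel I F) 𝓘(ℝ, ℝ) ∞ H) {p : DualSpace F E} (hp : p.proj ∈ φ.dom)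
    (e : EM) :
    φ.partialBase H p e = dirDeriv (dualModel I F) H p
      (mfderiv 𝓘(ℝ, EM) (dualModel I F) (fun z => φ.point z (φ.fiberCoord p)) (φ.baseCoord p)
        e : EM × (F →L[ℝ] ℝ)) := by
  have hpt := φ.point_coords hp
  have h1 : MDifferentiableAt (dualModel I F) 𝓘(ℝ, ℝ) H
      (φ.point (φ.baseCoord p) (φ.fiberCoord p)) := mdifferentiableAt_of_smooth hH _
  have h2 := dirDeriv_comp (I := 𝓘(ℝ, EM)) (g := fun z => φ.point z (φ.fiberCoord p)) h1
    ((φ.contMDiffAt_point hp (φ.fiberCoord p)).mdifferentiableAt (by simp)) e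
  unfold dirDeriv at h2
  rw [mfderiv_eq_fderiv] at h2
  refine h2.trans ?_
  unfold dirDeriv
  congr 2

variable (I F E) in
/-- Every point has local coordinates. The frame consists of global sections with constant
coordinates near `x`; the domain is shrunk to the set where these coordinates are constant. -/
theorem exists_mem_dom [FiniteDimensional ℝ EM] [I.Boundaryless] [T2Space M]
    [FiniteDimensional ℝ F] (x : M) : ∃ φ : LocalCoords I F E, x ∈ φ.dom := by
  have hx := FiberBundle.mem_baseSet_trivializationAt F E x
  let b := Module.finBasis ℝ F
  let e : Fin (Module.finrank ℝ F) → ∀ y, E y := fun i =>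
    localExt I F ((trivializationAt F E x).symm x (b i))
  let U : Set M := {y | (∀ i, coordAt F x (e i) y = b i) ∧ y ∈ (trivializationAt F E x).baseSet ∧
    y ∈ (chartAt HM x).source}
  have hU : U ∈ 𝓝 x := by
    have h1 : ∀ᶠ y in 𝓝 x, ∀ i, coordAt F x (e i) y = b i := by
      rw [Filter.eventually_all]
      intro i
      filter_upwards [coordAt_localExt (I := I) (F := F)
        ((trivializationAt F E x).symm x (b i))] with y hy
      exact hy.trans (congrArg Prod.snd ((trivializationAt F E x).apply_mk_symm hx (b i)))
    filter_upwards [h1, baseSet_mem_nhds (F := F) (E := E) x,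
      (chartAt HM x).open_source.mem_nhds (mem_chart_source HM x)] with y h1 h2 h3
    exact ⟨h1, h2, h3⟩
  have hco : ∀ i, ∀ y ∈ U, (trivializationAt F E x).continuousLinearMapAt ℝ y (e i y) = b i :=
    fun i y hy => (coordAt_eq_continuousLinearMapAt _ hy.2.1).symm.trans (hy.1 i)
  refine ⟨{
    chart := chartAt HM x
    chart_mem := IsManifold.chart_mem_maximalAtlas x
    rank := Module.finrank ℝ F
    dom := interior U
    isOpen_dom := isOpen_interior
    dom_subset := fun y hy => (interior_subset hy).2.2
    frame := e
    smooth_frame := fun i => smooth_localExt _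
    coframe := fun i y => (LinearMap.toContinuousLinearMap (b.coord i)) ∘L
      (trivializationAt F E x).continuousLinearMapAt ℝ y
    coframe_frame := fun i j y hy => ?_
    sum_coframe := fun y hy v => ?_ }, mem_interior_iff_mem_nhds.2 hU⟩
  · rw [ContinuousLinearMap.comp_apply, hco j y (interior_subset hy)]
    change b.coord i (b j) = _
    rw [Module.Basis.coord_apply, Module.Basis.repr_self, Finsupp.single_apply]
    simp only [eq_comm]
  · have hy' := (interior_subset hy).2.1
    have e1 : ∀ i, e i y = (trivializationAt F E x).symmL ℝ y (b i) := fun i => by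
      rw [← hco i y (interior_subset hy), Trivialization.symmL_continuousLinearMapAt _ hy']
    have e2 := congrArg ((trivializationAt F E x).symmL ℝ y)
      (b.sum_repr ((trivializationAt F E x).continuousLinearMapAt ℝ y v))
    rw [Trivialization.symmL_continuousLinearMapAt _ hy', map_sum] at e2
    refine Eq.trans (Finset.sum_congr rfl fun i _ => ?_) e2
    rw [map_smul, e1]
    rfl

end LocalCoords

end Coordinates

/-! ### The Hamilton equations -/

section Hamilton

variable {EM : Type*} [NormedAddCommGroup EM] [NormedSpace ℝ EM]
  {HM : Type*} [TopologicalSpace HM] {I : ModelWithCorners ℝ EM HM}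
  {M : Type*} [TopologicalSpace M] [ChartedSpace HM M] [IsManifold I ∞ M]
  {F : Type*} [NormedAddCommGroup F] [NormedSpace ℝ F]
  {E : M → Type*} [TopologicalSpace (TotalSpace F E)] [∀ x, TopologicalSpace (E x)]
  [∀ x, AddCommGroup (E x)] [∀ x, Module ℝ (E x)]
  [FiberBundle F E] [VectorBundle ℝ F E] [ContMDiffVectorBundle ∞ F E I]
  {A : AlgebroidData I F E}

theorem IsSkewAlgebroid.bracket_sum_right (h : IsSkewAlgebroid A) {ι : Type*} (s : Finset ι)
    {X : ∀ x, E x} (hX : SmoothSection I F X) (c : ι → ℝ) {Y : ι → ∀ x, E x}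
    (hY : ∀ i, SmoothSection I F (Y i)) (x : M) :
    A.bracket X (∑ i ∈ s, c i • Y i) x = ∑ i ∈ s, c i • A.bracket X (Y i) x ∧
      SmoothSection I F (∑ i ∈ s, c i • Y i) := by
  classical
  induction s using Finset.induction_on with
  | empty =>
    simp only [Finset.sum_empty]
    rw [h.zero_right hX]
    exact ⟨rfl, smoothSection_zero⟩
  | insert i s hi ih =>
    rw [Finset.sum_insert hi, Finset.sum_insert hi,
      h.add_right _ _ _ hX ((hY i).const_smul _) ih.2, h.smul_right _ hX (hY i), Pi.add_apply, ih.1]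
    exact ⟨rfl, ((hY i).const_smul _).add ih.2⟩

variable [FiniteDimensional ℝ EM] [I.Boundaryless] [T2Space M] [FiniteDimensional ℝ F]

variable (h : IsLieAlgebroid A) (φ : LocalCoords I F E) {H : DualSpace F E → ℝ}
  (hH : ContMDiff (dualModel I F) 𝓘(ℝ, ℝ) ∞ H) {ξ : ∀ p, CoProl A p}
  (hξ : IsHamiltonianSection A H ξ)
include h hH hξ

/-- The components of the Hamiltonian section in the local frame are the derivatives of `H` along
the fibres. -/
theorem IsLieAlgebroid.coframe_hamiltonian {p : DualSpace F E} (hp : p.proj ∈ φ.dom)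
    (β : Fin φ.rank) : φ.coframe β p.proj (ξ p).1.1 = φ.partialFiber H p β := by
  -- pair the Hamiltonian section with the vertical lift of the coframe
  let v := verticalLift I (F →L[ℝ] ℝ) p (φ.coframe β p.proj)
  have hm : ((0 : E p.proj), v) ∈ prolFiber (dualModel I F) A (π (F →L[ℝ] ℝ) (Dual E)) p :=
    mem_prolFiber.2 ((ContinuousLinearMap.map_zero _).trans (mfderiv_proj_verticalLift p _).symm)
  have hz : SmoothSection I F (0 : ∀ x, E x) := smoothSection_zero
  have h0 : ∀ v : TangentSpace (dualModel I F) p,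
      dirDeriv (dualModel I F) (fiberLinear (0 : ∀ x, E x)) p v = 0 := fun v => by
    have : fiberLinear (F := F) (0 : ∀ x, E x) = fun _ => 0 := funext fun q => map_zero q.2
    rw [this, dirDeriv_const]
  have e := (hξ p ⟨_, hm⟩).symm.trans <| h.canonicalSection_apply (ξ p) ⟨_, hm⟩
    (smooth_localExt (x := p.proj) (ξ p).1.1) hz
    (localExt_self (I := I) (F := F) (x := p.proj) _).symm rfl
  rw [h0, h.isSkewAlgebroid.zero_right (smooth_localExt _)] at e
  have e2 := dirDeriv_fiberLinear_localExt (I := I) (p := p) (ξ p).1.1 v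
  have e3 : fiberComp p v (trivializationAt F E p.proj ⟨p.proj, (ξ p).1.1⟩).2 =
      φ.coframe β p.proj (ξ p).1.1 := by
    rw [fiberComp_verticalLift, trivializationAt_dual_snd]
    exact congrArg (φ.coframe β p.proj) (symmL_trivializationAt _)
  rw [φ.partialFiber_eq hH hp]
  refine Eq.trans ?_ e.symm
  refine Eq.trans (e3.symm.trans e2.symm) ?_
  rw [neg_zero, zero_add]
  exact ((congrArg (fun z => _ + z) (ContinuousLinearMap.map_zero p.2)).trans (add_zero _)).symm

theorem IsLieAlgebroid.sum_partialFiber_smul {p : DualSpace F E} (hp : p.proj ∈ φ.dom) :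
    ∑ β, φ.partialFiber H p β • φ.frame β p.proj = (ξ p).1.1 := by
  rw [← φ.sum_coframe p.proj hp (ξ p).1.1]
  exact Finset.sum_congr rfl fun β _ => by rw [h.coframe_hamiltonian φ hH hξ hp]

/-- The Hamiltonian vector field satisfies the first Hamilton equation, because it projects to
`ρ` of the first component of the Hamiltonian section. -/
theorem IsLieAlgebroid.dirDeriv_baseCoord_hamiltonian {p : DualSpace F E} (hp : p.proj ∈ φ.dom) :
    dirDeriv (dualModel I F) φ.baseCoord p (ξ p).1.2 =
      ∑ β, φ.partialFiber H p β • φ.anchorComp A β p.proj := by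
  rw [φ.dirDeriv_baseCoord hp, Prol.anchor_fst, ← h.sum_partialFiber_smul φ hH hξ hp, map_sum]
  refine (map_sum (mfderiv I 𝓘(ℝ, EM) (φ.chart.extend I) p.proj) _ _).trans ?_
  refine Finset.sum_congr rfl fun β _ => ?_
  rw [map_smul]
  exact map_smul (mfderiv I 𝓘(ℝ, EM) (φ.chart.extend I) p.proj) _ _

/-- The Hamiltonian vector field satisfies the second Hamilton equation: pair the Hamiltonian section
with the vector over `e_α` whose fibre coordinates vanish. -/
theorem IsLieAlgebroid.dirDeriv_fiberCoord_hamiltonian {p : DualSpace F E} (hp : p.proj ∈ φ.dom)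
    (α : Fin φ.rank) :
    dirDeriv (dualModel I F) (fun q => φ.fiberCoord q α) p (ξ p).1.2 =
      -(∑ β, ∑ γ, φ.structureFun A α β γ p.proj * φ.fiberCoord p γ * φ.partialFiber H p β +
        φ.partialBase H p (φ.anchorComp A α p.proj)) := by
  have hpt := φ.point_coords hp
  -- the tangent vector to `E*` with the components `ρ_α^i` and `0`
  let v : TangentSpace (dualModel I F) p := (mfderiv 𝓘(ℝ, EM) (dualModel I F)
    (fun z => φ.point z (φ.fiberCoord p)) (φ.baseCoord p) (φ.anchorComp A α p.proj) :
      EM × (F →L[ℝ] ℝ))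
  have hdpt := (φ.contMDiffAt_point hp (φ.fiberCoord p)).mdifferentiableAt (by simp)
  have hv : ∀ f : DualSpace F E → ℝ,
      MDifferentiableAt (dualModel I F) 𝓘(ℝ, ℝ) f p → dirDeriv (dualModel I F) f p v =
        dirDeriv 𝓘(ℝ, EM) (fun z => f (φ.point z (φ.fiberCoord p))) (φ.baseCoord p)
          (φ.anchorComp A α p.proj) := by
    intro f hf
    rw [← hpt] at hf
    have := dirDeriv_comp (I := 𝓘(ℝ, EM)) (g := fun z => φ.point z (φ.fiberCoord p)) hf hdpt
      (φ.anchorComp A α p.proj)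
    refine Eq.trans ?_ this.symm
    unfold dirDeriv
    congr 2
    exact hpt.symm
  have hm : (φ.frame α p.proj, v) ∈ prolFiber (dualModel I F) A (π (F →L[ℝ] ℝ) (Dual E)) p := by
    rw [mem_prolFiber]
    have h1 := mfderiv_comp_apply (I := 𝓘(ℝ, EM)) (φ.baseCoord p)
      (f := fun z => φ.point z (φ.fiberCoord p))
      (mdifferentiableAt_proj (I := I) (φ.point (φ.baseCoord p) (φ.fiberCoord p))) hdpt
      (φ.anchorComp A α p.proj)
    have h2 := φ.mfderiv_extend_symm hp (A.anchor p.proj (φ.frame α p.proj))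
    refine h2.symm.trans (h1.trans ?_)
    congr 2
  -- the section through the first component of `ξ p` with constant coefficients in the frame
  let X : ∀ x, E x := ∑ β, φ.partialFiber H p β • φ.frame β
  have hX' := h.isSkewAlgebroid.bracket_sum_right Finset.univ (φ.smooth_frame α)
    (φ.partialFiber H p) φ.smooth_frame p.proj
  have hXb : A.bracket (φ.frame α) X p.proj =
    ∑ β, φ.partialFiber H p β • A.bracket (φ.frame α) (φ.frame β) p.proj := hX'.1
  have hX : SmoothSection I F X := hX'.2
  have hX_apply : ∀ x, X x = ∑ β, φ.partialFiber H p β • φ.frame β x := fun x => by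
    simp only [X, Finset.sum_apply, Pi.smul_apply]
  have e := (hξ p ⟨_, hm⟩).symm.trans <| h.canonicalSection_apply (ξ p) ⟨_, hm⟩ hX
    (φ.smooth_frame α) ((h.sum_partialFiber_smul φ hH hξ hp).symm.trans (hX_apply p.proj).symm) rfl
  have e1 : dirDeriv (dualModel I F) H p v =
      φ.partialBase H p (φ.anchorComp A α p.proj) := (φ.partialBase_eq hH hp _).symm
  -- the fibrewise linear function of `X` has constant coefficients in the coordinates
  have e2 : dirDeriv (dualModel I F) (fiberLinear X) p v = 0 := by
    rw [hv _ (mdifferentiableAt_of_smooth (contMDiff_fiberLinear hX) p)]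
    have : (fun z => fiberLinear (F := F) X (φ.point z (φ.fiberCoord p))) =ᶠ[𝓝 (φ.baseCoord p)]
        fun _ => ∑ β, φ.partialFiber H p β * φ.fiberCoord p β := by
      have hc : ∀ᶠ z in 𝓝 (φ.baseCoord p), (φ.chart.extend I).symm z ∈ φ.dom := by
        have hcont := (φ.contMDiffAt_extend_symm hp).continuousAt
        refine hcont.eventually ?_
        rw [φ.extend_symm_extend hp]
        exact φ.isOpen_dom.mem_nhds hp
      filter_upwards [hc] with z hz
      change (∑ γ, φ.fiberCoord p γ • φ.coframe γ ((φ.chart.extend I).symm z))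
        (X ((φ.chart.extend I).symm z)) = _
      rw [hX_apply, map_sum]
      refine Finset.sum_congr rfl fun β _ => ?_
      rw [map_smul, FunLike.coe_sum, Finset.sum_apply, smul_eq_mul]
      refine congrArg (fun r => φ.partialFiber H p β * r) ?_
      rw [Finset.sum_eq_single β]
      · change φ.fiberCoord p β * φ.coframe β _ (φ.frame β _) = _
        rw [φ.coframe_frame β β _ hz, if_pos rfl, mul_one]
      · intro γ _ hγ
        change φ.fiberCoord p γ * φ.coframe γ _ (φ.frame β _) = _
        rw [φ.coframe_frame γ β _ hz, if_neg hγ, mul_zero]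
      · exact fun hβ => absurd (Finset.mem_univ β) hβ
    exact (dirDeriv_congr this _).trans (dirDeriv_const _ _ _)
  have e3 : p.2 (A.bracket X (φ.frame α) p.proj) = -∑ β, ∑ γ, φ.structureFun A α β γ p.proj *
      φ.fiberCoord p γ * φ.partialFiber H p β := by
    rw [h.skew _ _ hX (φ.smooth_frame α), Pi.neg_apply, hXb, map_neg, map_sum]
    refine congrArg Neg.neg (Finset.sum_congr rfl fun β _ => ?_)
    rw [map_smul, ← φ.sum_coframe p.proj hp (A.bracket (φ.frame α) (φ.frame β) p.proj), map_sum,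
      smul_eq_mul, Finset.mul_sum]
    refine Finset.sum_congr rfl fun γ _ => ?_
    rw [map_smul, smul_eq_mul]
    exact mul_comm _ _
  have e4 : dirDeriv (dualModel I F) (fun q => φ.fiberCoord q α) p (ξ p).1.2 =
    dirDeriv (dualModel I F) (fiberLinear (φ.frame α)) p (ξ p).1.2 := rfl
  have e5 := e1.symm.trans e
  have e6 : dirDeriv (dualModel I F) (fiberLinear X) p
    (⟨_, hm⟩ : CoProl A p).1.2 = 0 := e2
  have e7 : φ.partialBase H p (φ.anchorComp A α p.proj) =
      -dirDeriv (dualModel I F) (fiberLinear (φ.frame α)) p (ξ p).1.2 + 0 +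
        p.2 (A.bracket X (φ.frame α) p.proj) := by
    rw [← e6]
    exact e5
  rw [e4]
  rw [e3] at e7
  linarith

/-- The solutions of the Hamilton equations are the integral curves of the Hamiltonian vector field,
because the derivatives of the coordinates determine a tangent vector. -/
theorem IsLieAlgebroid.isHamiltonSolution_iff {J : TopologicalSpace.Opens ℝ}
    {c : J → DualSpace F E} : IsHamiltonSolution A H c ↔
      ContMDiff 𝓘(ℝ, ℝ) (dualModel I F) ∞ c ∧
        ∀ t, (ξ (c t)).1.2 = mfderiv 𝓘(ℝ, ℝ) (dualModel I F) c t (1 : ℝ) := by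
  refine and_congr_right fun hc => ?_
  have hd : ∀ t, MDifferentiableAt 𝓘(ℝ, ℝ) (dualModel I F) c t :=
    fun t => (hc t).mdifferentiableAt (by simp)
  have hb : ∀ (φ : LocalCoords I F E) (t : J), (c t).proj ∈ φ.dom →
      dirDeriv 𝓘(ℝ, ℝ) (fun s => φ.baseCoord (c s)) t (1 : ℝ) =
        dirDeriv (dualModel I F) φ.baseCoord (c t)
          (mfderiv 𝓘(ℝ, ℝ) (dualModel I F) c t (1 : ℝ)) := fun φ t ht =>
    dirDeriv_comp (φ.mdifferentiableAt_baseCoord ht) (hd t) (1 : ℝ)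
  have hf : ∀ (φ : LocalCoords I F E) (t : J) α,
      dirDeriv 𝓘(ℝ, ℝ) (fun s => φ.fiberCoord (c s) α) t (1 : ℝ) =
        dirDeriv (dualModel I F) (fun q => φ.fiberCoord q α) (c t)
          (mfderiv 𝓘(ℝ, ℝ) (dualModel I F) c t (1 : ℝ)) := fun φ t α =>
    dirDeriv_comp (φ.mdifferentiableAt_fiberCoord (c t) α) (hd t) (1 : ℝ)
  constructor
  · intro hs t
    obtain ⟨φ, hφ⟩ := LocalCoords.exists_mem_dom I F E (c t).proj
    obtain ⟨h1, h2⟩ := hs φ t hφ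
    refine LocalCoords.ext_tangent hφ ?_ fun α => ?_
    · exact (h.dirDeriv_baseCoord_hamiltonian φ hH hξ hφ).trans (h1.symm.trans (hb φ t hφ))
    · exact (h.dirDeriv_fiberCoord_hamiltonian φ hH hξ hφ α).trans ((h2 α).symm.trans (hf φ t α))
  · intro hs φ t ht
    refine ⟨?_, fun α => ?_⟩
    · rw [hb φ t ht, ← hs t]
      exact h.dirDeriv_baseCoord_hamiltonian φ hH hξ ht
    · rw [hf φ t α, ← hs t]
      exact h.dirDeriv_fiberCoord_hamiltonian φ hH hξ ht α

end Hamilton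

end LieAlgebroid

end

theorem mainTheorem2
    {EM : Type*} [NormedAddCommGroup EM] [NormedSpace ℝ EM] [FiniteDimensional ℝ EM]
    {HM : Type*} [TopologicalSpace HM] {I : ModelWithCorners ℝ EM HM} [I.Boundaryless]
    {M : Type*} [TopologicalSpace M] [ChartedSpace HM M] [IsManifold I ∞ M]
    [T2Space M] [ParacompactSpace M]
    {F : Type*} [NormedAddCommGroup F] [NormedSpace ℝ F] [FiniteDimensional ℝ F]
    {E : M → Type*} [TopologicalSpace (TotalSpace F E)] [∀ x, TopologicalSpace (E x)]
    [∀ x, AddCommGroup (E x)] [∀ x, Module ℝ (E x)]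
    [FiberBundle F E] [VectorBundle ℝ F E] [ContMDiffVectorBundle ∞ F E I]
    (A : AlgebroidData I F E) (hA : IsLieAlgebroid A)
    (H : DualSpace F E → ℝ) (hH : ContMDiff (dualModel I F) 𝓘(ℝ, ℝ) ∞ H) :
    IsLieAlgebroid (coProlong A) ∧
    IsSymplecticSection (coProlong A) (canonicalSection A) ∧
    ∃ ξ : ∀ p, CoProl A p,
      SmoothSection (dualModel I F) (F × (F →L[ℝ] ℝ)) ξ ∧
      IsHamiltonianSection A H ξ ∧
      (∀ η, IsHamiltonianSection A H η → η = ξ) ∧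
      IsLagrangianSubmanifold (dualModel I F) (coProlong A) (canonicalSection A)
        (sectionMap ξ) ∧
      ∀ J : TopologicalSpace.Opens ℝ,
        BijOn (fun (c : J → DualSpace F E) t => sectionMap ξ (c t))
          {c | ContMDiff 𝓘(ℝ, ℝ) (dualModel I F) ∞ c}
          {γ | ContMDiff 𝓘(ℝ, ℝ) ((dualModel I F).prod 𝓘(ℝ, F × (F →L[ℝ] ℝ))) ∞ γ ∧
            ∀ t, γ t ∈ range (sectionMap ξ)} ∧
        BijOn (fun (c : J → DualSpace F E) t => sectionMap ξ (c t))
          {c | IsHamiltonSolution A H c}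
          {γ | IsAdmissible A γ ∧ ∀ t, γ t ∈ range (sectionMap ξ)} := by
  have ht : T2Space (DualSpace F E) := t2Space_totalSpace
  have hL : IsLieAlgebroid (coProlong A) := hA.prolong_isLieAlgebroid
  have hΩ := hA.isSymplecticSection_canonicalSection
  obtain ⟨ξ, hξs, hξ, huniq⟩ := hA.exists_hamiltonianSection hH
  refine ⟨hL, hΩ, ξ, hξs, hξ, huniq, hL.isLagrangianSubmanifold hΩ hH hξs hξ, fun J => ?_⟩
  -- the projection to the dual bundle is inverse to composition with the section
  have hinj : ∀ c c' : J → DualSpace F E,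
      (fun t => sectionMap ξ (c t)) = (fun t => sectionMap ξ (c' t)) → c = c' := fun c c' e =>
    funext fun t => congrArg (fun γ : J → TotalSpace (F × (F →L[ℝ] ℝ)) (CoProl A) => (γ t).proj) e
  have hlift : ∀ γ : J → TotalSpace (F × (F →L[ℝ] ℝ)) (CoProl A),
      (∀ t, γ t ∈ range (sectionMap ξ)) → (fun t => sectionMap ξ (γ t).proj) = γ := by
    intro γ hγ
    funext t
    obtain ⟨p, hp⟩ := hγ t
    rw [← hp]
    rfl
  have hproj : ContMDiff ((dualModel I F).prod 𝓘(ℝ, F × (F →L[ℝ] ℝ))) (dualModel I F) ∞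
      (π (F × (F →L[ℝ] ℝ)) (CoProl A)) := Bundle.contMDiff_proj (CoProl A)
  refine ⟨⟨fun c hc => ⟨hξs.comp hc, fun t => mem_range_self (c t)⟩, fun c _ c' _ e => hinj c c' e,
    fun γ hγ => ⟨fun t => (γ t).proj, hproj.comp hγ.1, hlift γ hγ.2⟩⟩,
    ⟨fun c hc => ?_, fun c _ c' _ e => hinj c c' e, fun γ hγ => ?_⟩⟩
  · have hc' := (hA.isHamiltonSolution_iff hH hξ).1 hc
    exact ⟨⟨hξs.comp hc'.1, hc'.2⟩, fun t => mem_range_self (c t)⟩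
  · refine ⟨fun t => (γ t).proj, (hA.isHamiltonSolution_iff hH hξ).2
      ⟨hproj.comp hγ.1.1, fun t => ?_⟩, hlift γ hγ.2⟩
    refine Eq.trans ?_ (hγ.1.2 t)
    obtain ⟨p, hp⟩ := hγ.2 t
    rw [← hp]
    rfl
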